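/- A monoid is viewed with its identity element as a nullary operation. A monoid variety is the class of all monoids satisfying a given set of identities $\mathbf u\approx\mathbf v$, where $\mathbf u,\mathbf v$ are words over a countably infinite alphabet $\mathfrak X$; varieties are ordered by inclusion, and $\vee$, $\wedge$ are the lattice operations of the lattice of all monoid varieties. For a word $\mathbf w$ let $S(\mathbf w)$ be the Rees quotient of the free monoid $\mathfrak X^\ast$ by the ideal of all words that are not (contiguous) subwords of $\mathbf w$. Let $\operatorname{var}A$ denote the variety generated by the monoid $A$, let $\operatorname{var}\Sigma$ denote the variety given by the identity system $\Sigma$, and let $\mathbf V\Sigma=\mathbf V\wedge\operatorname{var}\Sigma$. Different symbols $x,y,z,s,t,t_1,t_2,\dots$ denote different letters. Put \[ \mathbf D_1=\operatorname{var}S(xy),\qquad \mathbf D_k=\operatorname{var}S(xt_1xt_2\cdots xt_{k-1}x)\ (2\le k<\infty),\qquad \mathbf D_\infty=\bigvee_{1\le k<\infty}\mathbf D_k,\qquad \mathbf M=\operatorname{var}S(xytxsy), \] \[ \mathbf N=\operatorname{var}\{x^2\approx x^3,\ x^2y\approx yx^2,\ xyxzx\approx x^2yz,\ xsytxy\approx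 xsytyx,\ xsxyty\approx xsyxty\}, \] let $\mathbf T$ be the trivial variety, $\mathbf{SL}$ the variety of all commutative idempotent monoids, and $\mathbf C_2=\operatorname{var}\{x^2\approx x^3,\ xy\approx yx\}$. For $1\le k<\infty$ let $\delta_k$ be the identity $xt_1xt_2x\cdots t_kx\approx x^2t_1t_2\cdots t_k$, and let $\delta_\infty$ be the trivial identity. A variety $\mathbf V$ is called $fi$-permutable if any two fully invariant congruences $\alpha,\beta$ on any $\mathbf V$-free monoid permute, i.e. $\alpha\circ\beta=\beta\circ\alpha$. Proposition. The variety $\mathbf D_\infty\vee\mathbf N$ is $fi$-permutable. Moreover, its subvariety lattice is as follows. (a) For every $k$ with $2\le k\le\infty$ the interval $[\mathbf D_k,(\mathbf D_\infty\vee\mathbf N)\{\delta_k\}]$ is the three-element chain $\mathbf D_k\subset\mathbf D_k\vee\mathbf M\subset\mathbf D_k\vee\mathbf N$. (b) The subvarieties of $\mathbf D_\infty\vee\mathbf N$ are exactly $\mathbf T$, $\mathbf{SL}$, $\mathbf C_2$, $\mathbf D_1$ and the members of the intervals in (a). (c) The inclusions between them are determined by $\mathbf T\subset\mathbf{SL}\subset\mathbf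 C_2\subset\mathbf D_1\subset\mathbf D_2\subset\mathbf M\subset\mathbf N$ (all strict) and, for $2\le k,\ell\le\infty$ and $\mathbf U,\mathbf W\in\{\mathbf D_2,\mathbf M,\mathbf N\}$, by the rule that $\mathbf D_k\vee\mathbf U\subseteq\mathbf D_\ell\vee\mathbf W$ if and only if $k\le\ell$ and $\mathbf U\subseteq\mathbf W$. -/

import Mathlib

universe u v

namespace MonVar

/-- Words over the countably infinite alphabet `ℕ`. -/
abbrev Word : Type := FreeMonoid ℕ

/-- An identity `p.1 ≈ p.2` is a pair of words. -/
abbrev Identity : Type := Word × Word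

/-- The monoid `M` satisfies the identity `e`: both sides take the same value
under every substitution of elements of `M` for letters. -/
def Holds (M : Type v) [Monoid M] (e : Identity) : Prop :=
  ∀ φ : ℕ → M, FreeMonoid.lift φ e.1 = FreeMonoid.lift φ e.2

/-- A monoid variety: a class of monoids that consists of all monoids satisfying some
set of identities. -/
structure MonoidVariety where
  /-- Membership of a monoid in the variety. -/
  Mem : ∀ (M : Type u) [Monoid M], Prop
  equational : ∃ E : Set Identity, ∀ (M : Type u) [Monoid M], Mem M ↔ ∀ e ∈ E, Holds M e

namespace MonoidVariety

theorem mem_injective {V W : MonoidVariety.{u}}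
    (h : ∀ (M : Type u) [Monoid M], V.Mem M ↔ W.Mem M) : V = W := by
  cases V with
  | mk A hA =>
    cases W with
    | mk B hB =>
      have hAB : @A = @B := by
        funext M inst
        exact propext (h M)
      subst hAB
      rfl

/-- Varieties are ordered by inclusion of classes. -/
instance : PartialOrder MonoidVariety.{u} where
  le V W := ∀ (M : Type u) [Monoid M], V.Mem M → W.Mem M
  le_refl _ _ _ h := h
  le_trans _ _ _ h₁ h₂ M _ h := h₂ M (h₁ M h)
  le_antisymm _ _ h₁ h₂ := mem_injective fun M _ => ⟨h₁ M, h₂ M⟩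

/-- The meet of a set of varieties is their intersection. -/
instance : InfSet MonoidVariety.{u} where
  sInf S :=
    { Mem := fun M _ => ∀ V ∈ S, V.Mem M
      equational := by
        refine ⟨{e | ∃ V ∈ S, ∀ (M : Type u) [Monoid M], V.Mem M → Holds M e}, ?_⟩
        intro M _
        constructor
        · rintro h e ⟨V, hV, he⟩
          exact he M (h V hV)
        · intro h V hV
          obtain ⟨E, hE⟩ := V.equational
          refine (hE M).2 fun e he => h e ⟨V, hV, ?_⟩
          intro N _ hN
          exact (hE N).1 hN e he }

/-- The lattice of all monoid varieties. Joins are least upper bounds for inclusion. -/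
instance : CompleteLattice MonoidVariety.{u} :=
  completeLatticeOfInf _ fun _ =>
    ⟨fun _ hV _ _ h => h _ hV, fun _ hW M _ h V hV => hW hV M h⟩

/-- The variety given by a set of identities. -/
def ofIdentities (E : Set Identity) : MonoidVariety.{u} where
  Mem M _ := ∀ e ∈ E, Holds M e
  equational := ⟨E, fun _ _ => Iff.rfl⟩

/-- The variety generated by a monoid `A`: all monoids satisfying every identity of `A`. -/
def generatedBy (A : Type v) [Monoid A] : MonoidVariety.{u} :=
  ofIdentities {e | Holds A e}

/-- `generatedBy A` is the least variety containing `A`. -/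
theorem generatedBy_le_iff (A : Type u) [Monoid A] (V : MonoidVariety.{u}) :
    generatedBy A ≤ V ↔ V.Mem A := by
  constructor
  · intro h
    exact h A fun e he => he
  · intro hA M _ hM
    obtain ⟨E, hE⟩ := V.equational
    exact (hE M).2 fun e he => hM e ((hE A).1 hA e he)

/-- The congruence on the free monoid over `X` that consists of the pairs of words having
equal values in all members of `V` under all substitutions. -/
def freeCon (V : MonoidVariety.{u}) (X : Type u) : Con (FreeMonoid X) where
  r a b := ∀ (M : Type u) [Monoid M], V.Mem M →
    ∀ φ : X → M, FreeMonoid.lift φ a = FreeMonoid.lift φ b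
  iseqv :=
    ⟨fun _ _ _ _ _ => rfl, fun h M _ hM φ => (h M hM φ).symm,
      fun h₁ h₂ M _ hM φ => (h₁ M hM φ).trans (h₂ M hM φ)⟩
  mul' h₁ h₂ M _ hM φ := by
    rw [map_mul, map_mul, h₁ M hM φ, h₂ M hM φ]

/-- The `V`-free monoid over the alphabet `X`. -/
abbrev FreeObj (V : MonoidVariety.{u}) (X : Type u) : Type u := (V.freeCon X).Quotient

/-- The `V`-free monoid belongs to `V`. -/
theorem mem_freeObj (V : MonoidVariety.{u}) (X : Type u) : V.Mem (V.FreeObj X) := by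
  obtain ⟨E, hE⟩ := V.equational
  refine (hE _).2 fun e he φ => ?_
  choose f hf using fun n => Con.mk'_surjective (c := V.freeCon X) (φ n)
  have key : ∀ w : Word, FreeMonoid.lift φ w
      = (V.freeCon X).mk' (FreeMonoid.lift f w) := by
    intro w
    have : FreeMonoid.lift φ = (V.freeCon X).mk'.comp (FreeMonoid.lift f) := by
      apply FreeMonoid.hom_eq
      intro n
      exact (FreeMonoid.lift_eval_of φ n).trans ((hf n).symm.trans
        (congrArg (V.freeCon X).mk' (FreeMonoid.lift_eval_of f n).symm))
    rw [this]
    rfl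
  rw [key, key]
  refine (Con.eq _).2 ?_
  intro M _ hM ψ
  have h := (hE M).1 hM e he (fun n => FreeMonoid.lift ψ (f n))
  have key' : ∀ w : Word, FreeMonoid.lift (fun n => FreeMonoid.lift ψ (f n)) w
      = FreeMonoid.lift ψ (FreeMonoid.lift f w) := by
    intro w
    have : FreeMonoid.lift (fun n => FreeMonoid.lift ψ (f n))
        = (FreeMonoid.lift ψ).comp (FreeMonoid.lift f) := by
      apply FreeMonoid.hom_eq
      intro n
      simp
    rw [this]
    rfl
  rw [key', key'] at h
  exact h

/-- The universal property of the `V`-free monoid over `X`. -/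
theorem existsUnique_freeObj_hom (V : MonoidVariety.{u}) (X : Type u) (M : Type u) [Monoid M]
    (hM : V.Mem M) (φ : X → M) :
    ∃! f : V.FreeObj X →* M, ∀ x : X, f ((V.freeCon X).mk' (FreeMonoid.of x)) = φ x := by
  refine ⟨(V.freeCon X).lift (FreeMonoid.lift φ) fun a b h => h M hM φ, fun x => ?_, ?_⟩
  · exact FreeMonoid.lift_eval_of φ x
  · intro g hg
    apply Con.hom_ext
    apply FreeMonoid.hom_eq
    intro x
    exact (hg x).trans (FreeMonoid.lift_eval_of φ x).symm

end MonoidVariety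

/-- A congruence is fully invariant if it is preserved by every endomorphism. -/
def IsFullyInvariant {M : Type v} [Monoid M] (c : Con M) : Prop :=
  ∀ (f : M →* M) (a b : M), c a b → c (f a) (f b)

/-- A variety is fi-permutable if any two fully invariant congruences on any of its free
objects permute. -/
def IsFiPermutable (V : MonoidVariety.{u}) : Prop :=
  ∀ (X : Type u) (α β : Con (V.FreeObj X)), IsFullyInvariant α → IsFullyInvariant β →
    Relation.Comp (fun a b => α a b) (fun a b => β a b)
      = Relation.Comp (fun a b => β a b) (fun a b => α a b)

/-- `u` is a (contiguous) subword of some word in `W`. -/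
def IsSubwordOf (W : Set Word) (u : Word) : Prop :=
  ∃ w ∈ W, ∃ p q : Word, w = p * u * q

/-- The Rees congruence of the ideal `I(W)` of all words that are not subwords of words
in `W`. -/
def reesCon (W : Set Word) : Con Word where
  r a b := a = b ∨ (¬ IsSubwordOf W a ∧ ¬ IsSubwordOf W b)
  iseqv := by
    refine ⟨fun _ => Or.inl rfl, ?_, ?_⟩
    · rintro a b (rfl | ⟨h₁, h₂⟩)
      · exact Or.inl rfl
      · exact Or.inr ⟨h₂, h₁⟩
    · rintro a b c (rfl | ⟨h₁, h₂⟩) (rfl | ⟨h₃, h₄⟩)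
      · exact Or.inl rfl
      · exact Or.inr ⟨h₃, h₄⟩
      · exact Or.inr ⟨h₁, h₂⟩
      · exact Or.inr ⟨h₁, h₄⟩
  mul' := by
    have hl : ∀ a b : Word, ¬ IsSubwordOf W a → ¬ IsSubwordOf W (a * b) := by
      rintro a b h ⟨w, hw, p, q, rfl⟩
      exact h ⟨_, hw, p, b * q, by simp only [mul_assoc]⟩
    have hr : ∀ a b : Word, ¬ IsSubwordOf W b → ¬ IsSubwordOf W (a * b) := by
      rintro a b h ⟨w, hw, p, q, rfl⟩
      exact h ⟨_, hw, p * a, q, by simp only [mul_assoc]⟩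
    rintro a b c d (rfl | ⟨h₁, h₂⟩) (rfl | ⟨h₃, h₄⟩)
    · exact Or.inl rfl
    · exact Or.inr ⟨hr _ _ h₃, hr _ _ h₄⟩
    · exact Or.inr ⟨hl _ _ h₁, hl _ _ h₂⟩
    · exact Or.inr ⟨hl _ _ h₁, hl _ _ h₂⟩

/-- The Rees quotient monoid `S(W)`. -/
abbrev S (W : Set Word) : Type := (reesCon W).Quotient

/-- The `n`-th letter. -/
abbrev letter (n : ℕ) : Word := FreeMonoid.of n

abbrev x : Word := letter 0
abbrev y : Word := letter 1
abbrev z : Word := letter 2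
abbrev t : Word := letter 3
abbrev s : Word := letter 4

/-- The word `x t₁ x t₂ x ⋯ t_k x`, where `x` is letter `0` and `t_i` is letter `i`. -/
def xtWord (k : ℕ) : Word :=
  x * ((List.range k).map fun i => letter (i + 1) * x).prod

/-- The word `t₁ t₂ ⋯ t_k`, where `t_i` is letter `i`. -/
def tWord (k : ℕ) : Word :=
  ((List.range k).map fun i => letter (i + 1)).prod

/-- The identity `δ_k : x t₁ x t₂ x ⋯ t_k x ≈ x² t₁ t₂ ⋯ t_k`; `δ_∞` is trivial. -/
def delta : ℕ∞ → Identity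
  | ⊤ => (1, 1)
  | (k : ℕ) => (xtWord k, x ^ 2 * tWord k)

/-- `D_k` for a finite `k ≥ 1`: `D_1 = var S(xy)` and `D_k = var S(x t₁ x ⋯ t_{k-1} x)`
for `k > 1` (the value at `k = 0` is never used). -/
def varDFin (k : ℕ) : MonoidVariety.{u} :=
  if k = 1 then .generatedBy (S {x * y}) else .generatedBy (S {xtWord (k - 1)})

/-- `D_k` for `1 ≤ k ≤ ∞`, where `D_∞` is the join of all `D_k` with `1 ≤ k < ∞`. -/
def varD : ℕ∞ → MonoidVariety.{u}
  | ⊤ => ⨆ k ∈ {k : ℕ | 1 ≤ k}, varDFin k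
  | (k : ℕ) => varDFin k

/-- `M = var S(xytxsy)`. -/
def varM : MonoidVariety.{u} := .generatedBy (S {x * y * t * x * s * y})

/-- `N = var {x² ≈ x³, x²y ≈ yx², xyxzx ≈ x²yz, xsytxy ≈ xsytyx, xsxyty ≈ xsyxty}`. -/
def varN : MonoidVariety.{u} := .ofIdentities
  {(x ^ 2, x ^ 3),
   (x ^ 2 * y, y * x ^ 2),
   (x * y * x * z * x, x ^ 2 * y * z),
   (x * s * y * t * x * y, x * s * y * t * y * x),
   (x * s * x * y * t * y, x * s * y * x * t * y)}

/-- The trivial variety. -/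
def varT : MonoidVariety.{u} := .ofIdentities {(x, 1)}

/-- The variety of semilattice monoids. -/
def varSL : MonoidVariety.{u} := .ofIdentities {(x ^ 2, x), (x * y, y * x)}

/-- `C_2 = var {x² ≈ x³, xy ≈ yx}`. -/
def varC2 : MonoidVariety.{u} := .ofIdentities {(x ^ 2, x ^ 3), (x * y, y * x)}

/-- The variety `D_∞ ∨ N`. -/
def varDN : MonoidVariety.{u} := varD ⊤ ⊔ varN

end MonVar

/-! The proof solves the word problem for every variety D_k ∨ U with k ≥ 2 and U one of D_2, M, N
(encoded by c = 0, 1, 2) and reads the rest off the solution. Call a letter simple in a word if it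
occurs once, and k-limited if it occurs at most k times and every gap between consecutive
occurrences contains a simple letter. Then D_k ∨ U satisfies u ≈ v exactly if `Agree k c u v`: both
words have the same letters, simple letters and k-limited letters, each limited letter occurs
equally often in total and before each simple letter, and the first occurrences of certain pairs of
limited letters occurring twice come in the same order. These are no pairs for D_2, the pairs whose
last occurrences are separated by a simple letter for M, and all pairs for N
(`HasType.entails_iff`).

Sufficiency (`Laws.ev_eq_of_agree`): a letter that is not limited can be replaced by a central
square, so it can be removed from both words. If all letters are limited, one word is sorted into
the other by swapping adjacent letters that are not simple. The laws of D_∞ ∨ N permit every such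
swap except that of the first occurrences of two letters occurring exactly twice; these swaps are
what c governs.

Necessity (`Entails.sameShape`, `Entails.agree`): S(w) belongs to V exactly if w is an isoterm for
V. Hence all words xt₁x⋯t_jx with j < k are isoterms for a variety above D_k. Deleting all letters
but a limited letter and its separators from an identity leaves such a word, so the arrangement is
preserved. A wrong order of first occurrences projects to xyzxy ≈ yxzxy or to xyzxty ≈ yxzxty.

So a subvariety above D_2 is determined by the least k for which xt₁x⋯t_kx is not an isoterm (then
δ_k holds, `entails_delta_of_not_isoterm`) and by which of the last two identities it satisfies. If
x, xy or xtx is not an isoterm, the variety is one of T, SL, C_2, D_1.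

Permutability: fully invariant congruences are described by subvarieties. For comparable ones an end
point of the chain u ≈ v ≈ w serves as the new middle word. Otherwise the types are (k, c) and (l,
d) with k ≤ l and d ≤ c, up to exchange. Both varieties contain D_k ∨ U_d, which therefore satisfies
u ≈ w, and the middle word has the k-limited letters arranged as in w and the other letters as in u,
glued along the simple letters (`Agree.exists_between`). -/

namespace MonVar

/-! ### Occurrences in words -/

/-- The number of occurrences of `x` in `u` before the first occurrence of `t`. -/
def countBefore (x t : ℕ) (u : List ℕ) : ℕ := (u.takeWhile (· ≠ t)).count x

theorem countBefore_nil (x t : ℕ) : countBefore x t [] = 0 := rfl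

theorem countBefore_cons (x t a : ℕ) (u : List ℕ) :
    countBefore x t (a :: u) =
      if a = t then 0 else (if a = x then 1 else 0) + countBefore x t u := by
  by_cases h : a = t
  · simp [countBefore, h]
  · have : (a :: u).takeWhile (· ≠ t) = a :: u.takeWhile (· ≠ t) := by simp [h]
    rw [countBefore, this, List.count_cons, if_neg h, countBefore, add_comm]
    simp

theorem countBefore_append (x t : ℕ) (u v : List ℕ) :
    countBefore x t (u ++ v) =
      if t ∈ u then countBefore x t u else u.count x + countBefore x t v := by
  induction u with
  | nil => simp
  | cons a u ih =>
    simp only [List.cons_append, countBefore_cons, ih, List.mem_cons, List.count_cons]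
    grind

theorem countBefore_le_count (x t : ℕ) (u : List ℕ) : countBefore x t u ≤ u.count x :=
  (List.takeWhile_sublist _).count_le _

theorem countBefore_eq_zero_of_notMem {x : ℕ} (t : ℕ) {u : List ℕ} (h : x ∉ u) :
    countBefore x t u = 0 :=
  Nat.le_zero.1 ((countBefore_le_count x t u).trans (List.count_eq_zero.2 h).le)

theorem countBefore_filter (P : ℕ → Bool) {x t : ℕ} (hx : P x) (ht : P t) (u : List ℕ) :
    countBefore x t (u.filter P) = countBefore x t u := by
  induction u with
  | nil => rfl
  | cons a u ih =>
    by_cases h : P a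
    · simp [h, countBefore_cons, ih]
    · have h1 : a ≠ x := by rintro rfl; exact h hx
      have h2 : a ≠ t := by rintro rfl; exact h ht
      simp [h, countBefore_cons, ih, h1, h2]

theorem count_filterMap_of_iff (ρ : ℕ → Option ℕ) {c a : ℕ} (hc : ∀ l, ρ l = some c ↔ l = a)
    (u : List ℕ) : (u.filterMap ρ).count c = u.count a := by
  induction u with
  | nil => rfl
  | cons b u ih =>
    have := hc b
    cases h : ρ b <;> simp [h, List.count_cons, ih] <;> grind

theorem countBefore_filterMap_of_iff (ρ : ℕ → Option ℕ) {c d a b : ℕ}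
    (hc : ∀ l, ρ l = some c ↔ l = a) (hd : ∀ l, ρ l = some d ↔ l = b) (u : List ℕ) :
    countBefore c d (u.filterMap ρ) = countBefore a b u := by
  induction u with
  | nil => rfl
  | cons e u ih =>
    have h1 := hc e
    have h2 := hd e
    cases h : ρ e <;> simp [h, countBefore_cons, ih] <;> grind

/-- If no `s` precedes the first `t`, then at most as many letters `x` precede `t` as `s`. -/
theorem countBefore_le_of_eq_zero (x : ℕ) {s t : ℕ} {u : List ℕ} (h : countBefore s t u = 0) :
    countBefore x t u ≤ countBefore x s u := by
  induction u with
  | nil => rfl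
  | cons a u ih =>
    simp only [countBefore_cons] at h ⊢
    grind

theorem countBefore_pos_of_lt {x s t : ℕ} {u : List ℕ} (h : countBefore x s u < countBefore x t u) :
    0 < countBefore s t u := by
  by_contra h0
  exact absurd (countBefore_le_of_eq_zero x (Nat.le_zero.1 (not_lt.1 h0))) (not_le.2 h)

theorem countBefore_eq_zero_of_pos {s t : ℕ} {u : List ℕ} (h : 0 < countBefore s t u) :
    countBefore t s u = 0 := by
  induction u with
  | nil => rfl
  | cons a u ih =>
    simp only [countBefore_cons] at h ⊢
    grind

theorem countBefore_pos_or {s t : ℕ} (hst : s ≠ t) {u : List ℕ} (hs : s ∈ u) :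
    0 < countBefore s t u ∨ 0 < countBefore t s u := by
  induction u with
  | nil => simp at hs
  | cons a u ih =>
    simp only [countBefore_cons]
    grind

/-- A word is determined by its letter counts and by the numbers of occurrences before simple
letters if it has at most one letter that is not simple. -/
theorem eq_of_count_eq (x₀ : ℕ) {u v : List ℕ} (hc : ∀ x, u.count x = v.count x)
    (hs : ∀ t ∈ u, t ≠ x₀ → u.count t = 1)
    (hb : ∀ t ∈ u, t ≠ x₀ → ∀ y, countBefore y t u = countBefore y t v) : u = v := by
  -- The hypotheses concern whole words, so the common prefix already matched is carried along as p.
  suffices H : ∀ p u v : List ℕ, (∀ x, (p ++ u).count x = (p ++ v).count x) →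
      (∀ t ∈ p ++ u, t ≠ x₀ → (p ++ u).count t = 1) →
      (∀ t ∈ p ++ u, t ≠ x₀ → ∀ y, countBefore y t (p ++ u) = countBefore y t (p ++ v)) →
      u = v from H [] u v hc hs hb
  clear hc hs hb u v
  intro p u
  induction u generalizing p with
  | nil =>
    intro v hc _ _
    cases v with
    | nil => rfl
    | cons d v => have := hc d; simp at this
  | cons c u ih =>
    intro v hc hs hb
    cases v with
    | nil => have := hc c; simp at this
    | cons d v =>
      by_cases hcd : c = d
      · subst hcd
        congr 1
        have e : ∀ w, (p ++ [c]) ++ w = p ++ c :: w := fun w => by simp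
        exact ih (p ++ [c]) v (by simpa only [e] using hc) (by simpa only [e] using hs)
          (by simpa only [e] using hb)
      · exfalso
        -- At the first difference c against d, one of the two letters is not x₀, hence is simple
        -- and absent from p. The number of occurrences of the other letter before it differs in the
        -- two words.
        have key : ∀ t ∈ p ++ c :: u, t ≠ x₀ → (t = c ∨ t = d) → False := by
          intro t ht htx h
          have h1 := hs t ht htx
          have h2 := hc t
          have h3 := hb t ht htx
          rcases h with rfl | rfl
          · have htp : t ∉ p := by
              intro hp
              have := List.count_pos_iff.2 hp
              simp at h1
              omega
            have := h3 d
            simp [countBefore_append, htp, countBefore_cons, Ne.symm hcd] at this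
          · have htp : t ∉ p := by
              intro hp
              have := List.count_pos_iff.2 hp
              simp at h1 h2
              omega
            have := h3 c
            simp [countBefore_append, htp, countBefore_cons, hcd] at this
        have hd : d ∈ p ++ c :: u := by
          rw [← List.count_pos_iff, hc d]
          simp
        by_cases hcx : c = x₀
        · exact key d hd (fun h => hcd (hcx.trans h.symm)) (Or.inr rfl)
        · exact key c (by simp) hcx (Or.inl rfl)

theorem exists_split_of_lt_count {x i : ℕ} {u : List ℕ} (h : i < u.count x) :
    ∃ p r, u = p ++ x :: r ∧ p.count x = i := by
  induction u generalizing i with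
  | nil => simp at h
  | cons a u ih =>
    by_cases ha : a = x
    · subst ha
      cases i with
      | zero => exact ⟨[], u, rfl, rfl⟩
      | succ i =>
        obtain ⟨p, r, rfl, hp⟩ := ih (i := i) (by simpa using h)
        exact ⟨a :: p, r, rfl, by simp [hp]⟩
    · obtain ⟨p, r, rfl, hp⟩ := ih (i := i) (by simpa [List.count_cons, ha] using h)
      exact ⟨a :: p, r, rfl, by simp [hp, ha]⟩

/-- Cuts off n blocks ending in x, the form in which the law `delta` is applied to a word. -/
theorem exists_flatten_of_le_count {x n : ℕ} {u : List ℕ} (h : n ≤ u.count x) :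
    ∃ (bs : List (List ℕ)) (r : List ℕ),
      bs.length = n ∧ u = (bs.map (· ++ [x])).flatten ++ r := by
  induction n generalizing u with
  | zero => exact ⟨[], u, rfl, rfl⟩
  | succ n ih =>
    obtain ⟨p, r, rfl, hp⟩ := exists_split_of_lt_count (i := 0) (x := x) (u := u) (by omega)
    obtain ⟨bs, r', hl, rfl⟩ := ih (u := r) (by simp [hp] at h; omega)
    exact ⟨p :: bs, r', by simp [hl], by simp⟩

/-! ### Limited letters and the invariants of words -/

/-- The letter `x` is `k`-limited in `u` if it occurs at most `k` times and any two of its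
occurrences are separated by a simple letter. -/
def Limited (k : ℕ∞) (x : ℕ) (u : List ℕ) : Prop :=
  (u.count x : ℕ∞) ≤ k ∧
    ∀ i, 1 ≤ i → i < u.count x → ∃ t, u.count t = 1 ∧ countBefore x t u = i

/-- Agreement of two words in the arrangement of the limited letters among the simple letters. -/
structure SameShape (k : ℕ∞) (u v : List ℕ) : Prop where
  mem_iff : ∀ x, x ∈ u ↔ x ∈ v
  simple_iff : ∀ x, u.count x = 1 ↔ v.count x = 1
  limited_iff : ∀ x, Limited k x u ↔ Limited k x v
  count_eq : ∀ x, Limited k x u → u.count x = v.count x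
  before_eq : ∀ x t, Limited k x u → u.count t = 1 → countBefore x t u = countBefore x t v

/-- The pairs of letters the order of whose first occurrences matters: none for `c = 0`, those
with last occurrences separated by a simple letter for `c = 1`, and all for larger `c`. -/
def Separated : ℕ → ℕ → ℕ → List ℕ → Prop
  | 0, _, _, _ => False
  | 1, x, y, u => ∃ t, u.count t = 1 ∧ 0 < countBefore x t u ∧ 0 < countBefore y t u ∧
      countBefore x t u ≠ countBefore y t u
  | _ + 2, _, _, _ => True

/-- The invariant of words that describes the identities of `D_k ∨ U` with
`U = D_2, M, N` for `c = 0, 1, 2`. -/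
structure Agree (k : ℕ∞) (c : ℕ) (u v : List ℕ) : Prop extends SameShape k u v where
  order_iff : ∀ x y, Limited k x u → Limited k y u → u.count x = 2 → u.count y = 2 →
    Separated c x y u → (0 < countBefore x y u ↔ 0 < countBefore x y v)

theorem limited_of_count_le_one {k : ℕ∞} (hk : 1 ≤ k) {x : ℕ} {u : List ℕ} (h : u.count x ≤ 1) :
    Limited k x u :=
  ⟨(by exact_mod_cast h : ((u.count x : ℕ) : ℕ∞) ≤ 1).trans hk, fun i h1 h2 => by omega⟩

theorem Limited.mono {k l : ℕ∞} {x : ℕ} {u : List ℕ} (h : Limited k x u)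
    (hl : (u.count x : ℕ∞) ≤ l) : Limited l x u := ⟨hl, h.2⟩

theorem limited_congr {k : ℕ∞} {x : ℕ} {u v : List ℕ} (hx : u.count x = v.count x)
    (hs : ∀ t, u.count t = 1 ↔ v.count t = 1)
    (hb : ∀ t, u.count t = 1 → countBefore x t u = countBefore x t v) :
    Limited k x u ↔ Limited k x v := by
  unfold Limited
  rw [hx]
  refine and_congr_right fun _ => forall₃_congr fun i _ _ => exists_congr fun t => ?_
  rw [← hs t]
  exact and_congr_right fun ht => by rw [hb t ht]

/-- If even the unlimited letters have equal counts and equal positions relative to the simple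
letters, the bound k plays no role. Rearranged words are compared in this way for several k at once.
-/
theorem sameShape_of_count_eq (k : ℕ∞) {u v : List ℕ} (hc : ∀ x, u.count x = v.count x)
    (hb : ∀ x t, u.count t = 1 → countBefore x t u = countBefore x t v) : SameShape k u v where
  mem_iff x := by rw [← List.count_pos_iff, ← List.count_pos_iff, hc]
  simple_iff x := by rw [hc]
  limited_iff x := limited_congr (hc x) (fun t => by rw [hc]) (hb x)
  count_eq x _ := hc x
  before_eq x t _ ht := hb x t ht

theorem Separated.congr {c x y : ℕ} {u v : List ℕ} (hs : ∀ t, u.count t = 1 ↔ v.count t = 1)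
    (hx : ∀ t, u.count t = 1 → countBefore x t u = countBefore x t v)
    (hy : ∀ t, u.count t = 1 → countBefore y t u = countBefore y t v)
    (h : Separated c x y u) : Separated c x y v := by
  match c, h with
  | 1, ⟨t, ht, h1, h2, h3⟩ =>
    exact ⟨t, (hs t).1 ht, hx t ht ▸ h1, hy t ht ▸ h2, hx t ht ▸ hy t ht ▸ h3⟩
  | _ + 2, _ => trivial

theorem SameShape.symm {k : ℕ∞} {u v : List ℕ} (h : SameShape k u v) : SameShape k v u where
  mem_iff x := (h.mem_iff x).symm
  simple_iff x := (h.simple_iff x).symm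
  limited_iff x := (h.limited_iff x).symm
  count_eq x hx := (h.count_eq x ((h.limited_iff x).2 hx)).symm
  before_eq x t hx ht := (h.before_eq x t ((h.limited_iff x).2 hx) ((h.simple_iff t).2 ht)).symm

/-! #### Deleting a letter that is not simple -/

theorem count_filter_ne {x y : ℕ} (h : y ≠ x) (u : List ℕ) :
    (u.filter (· ≠ x)).count y = u.count y := by
  rw [List.count_filter]
  simpa using h

theorem count_filter_ne_self (x : ℕ) (u : List ℕ) : (u.filter (· ≠ x)).count x = 0 := by
  simp [List.count_eq_zero]

theorem countBefore_filter_ne {x y t : ℕ} (h : y ≠ x) (ht : t ≠ x) (u : List ℕ) :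
    countBefore y t (u.filter (· ≠ x)) = countBefore y t u :=
  countBefore_filter _ (by simpa using h) (by simpa using ht) u

theorem simple_filter_ne_iff {x : ℕ} {u : List ℕ} (hx : u.count x ≠ 1) (t : ℕ) :
    (u.filter (· ≠ x)).count t = 1 ↔ u.count t = 1 := by
  by_cases h : t = x
  · subst h; rw [count_filter_ne_self]; omega
  · rw [count_filter_ne h]

theorem limited_filter_ne_iff {k : ℕ∞} {x y : ℕ} {u : List ℕ} (hx : u.count x ≠ 1) (hy : y ≠ x) :
    Limited k y (u.filter (· ≠ x)) ↔ Limited k y u := by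
  refine limited_congr (count_filter_ne hy u) (simple_filter_ne_iff hx) fun t ht => ?_
  refine countBefore_filter_ne hy ?_ u
  rintro rfl
  rw [count_filter_ne_self] at ht; omega

/-- Deleting a letter that is not simple changes neither the simple letters nor the data of the
other letters. This allows the induction that removes unlimited letters. -/
theorem Agree.filter_ne {k : ℕ∞} {c x : ℕ} {u v : List ℕ} (h : Agree k c u v)
    (hx : u.count x ≠ 1) : Agree k c (u.filter (· ≠ x)) (v.filter (· ≠ x)) := by
  have hx' : v.count x ≠ 1 := fun h' => hx ((h.simple_iff x).2 h')
  have hne : ∀ t, (u.filter (· ≠ x)).count t = 1 → t ≠ x := by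
    rintro t ht rfl
    rw [count_filter_ne_self] at ht; omega
  refine ⟨⟨fun y => ?_, fun y => ?_, fun y => ?_, fun y hy => ?_, fun y t hy ht => ?_⟩,
    fun y z hy hz hy2 hz2 hs => ?_⟩
  · simp [h.mem_iff]
  · rw [simple_filter_ne_iff hx, simple_filter_ne_iff hx', h.simple_iff]
  · by_cases hy : y = x
    · subst hy
      -- The deleted letter no longer occurs, so it is limited for trivial reasons.
      have : ∀ w : List ℕ, Limited k y (w.filter (· ≠ y)) := fun w =>
        ⟨by rw [count_filter_ne_self]; simp, fun i _ h2 => by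
          rw [count_filter_ne_self] at h2; omega⟩
      exact iff_of_true (this u) (this v)
    · rw [limited_filter_ne_iff hx hy, limited_filter_ne_iff hx' hy, h.limited_iff]
  · by_cases hyx : y = x
    · subst hyx; rw [count_filter_ne_self, count_filter_ne_self]
    · rw [count_filter_ne hyx, count_filter_ne hyx]
      exact h.count_eq y ((limited_filter_ne_iff hx hyx).1 hy)
  · have htx := hne t ht
    by_cases hyx : y = x
    · subst hyx
      rw [countBefore_eq_zero_of_notMem, countBefore_eq_zero_of_notMem] <;> simp
    · rw [countBefore_filter_ne hyx htx, countBefore_filter_ne hyx htx]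
      exact h.before_eq y t ((limited_filter_ne_iff hx hyx).1 hy) ((simple_filter_ne_iff hx t).1 ht)
  · have hyx : y ≠ x := by rintro rfl; rw [count_filter_ne_self] at hy2; omega
    have hzx : z ≠ x := by rintro rfl; rw [count_filter_ne_self] at hz2; omega
    rw [countBefore_filter_ne hyx hzx, countBefore_filter_ne hyx hzx]
    rw [count_filter_ne hyx] at hy2
    rw [count_filter_ne hzx] at hz2
    refine h.order_iff y z ((limited_filter_ne_iff hx hyx).1 hy) ((limited_filter_ne_iff hx hzx).1 hz)
      hy2 hz2 (hs.congr (simple_filter_ne_iff hx) (fun t ht => ?_) (fun t ht => ?_))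
    · exact countBefore_filter_ne hyx (hne t ht) u
    · exact countBefore_filter_ne hzx (hne t ht) u


/-! ### Deducing identities from the invariants -/

/-- The value of a word in a monoid. -/
def ev {A : Type u} [Monoid A] (φ : ℕ → A) (w : List ℕ) : A := (w.map φ).prod

section ev
variable {A : Type u} [Monoid A] (φ : ℕ → A)

@[simp] theorem ev_nil : ev φ [] = 1 := rfl

@[simp] theorem ev_cons (a : ℕ) (w : List ℕ) : ev φ (a :: w) = φ a * ev φ w := by simp [ev]

@[simp] theorem ev_append (v w : List ℕ) : ev φ (v ++ w) = ev φ v * ev φ w := by simp [ev]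

end ev

/-- The laws that hold in the monoids of the variety `D_k ∨ U`, where `U` is encoded by `c`
as in `Agree`. -/
structure Laws (A : Type u) [Monoid A] (k : ℕ∞) (c : ℕ) : Prop where
  sq : ∀ a : A, a * a * a = a * a
  central : ∀ a b : A, a * a * b = b * (a * a)
  last_first : ∀ a b d e : A, a * d * a * b * e * b = a * d * b * a * e * b
  last_last : ∀ a b d e : A, a * d * b * e * a * b = a * d * b * e * b * a
  thrice₁ : ∀ a b d e f : A, a * b * d * a * e * a * f * b = b * a * d * a * e * a * f * b
  thrice₂ : ∀ a b d e f : A, a * b * d * a * e * b * f * a = b * a * d * a * e * b * f * a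
  thrice₃ : ∀ a b d e f : A, a * b * d * b * e * a * f * a = b * a * d * b * e * a * f * a
  delta : ∀ n : ℕ, k = n → ∀ (a : A) (bs : List A), bs.length = n →
    a * (bs.map (· * a)).prod = a * a * bs.prod
  first_block : c ≤ 1 → ∀ a b d : A, a * b * d * a * b = b * a * d * a * b
  first_first : c = 0 → ∀ a b d e : A, a * b * d * a * e * b = b * a * d * a * e * b

/-! ### Moving and absorbing letters by means of the laws -/

namespace Laws
variable {A : Type u} [Monoid A] {k : ℕ∞} {c : ℕ} (L : Laws A k c) (φ : ℕ → A)
include L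

/-- The central square travels to each further occurrence of x and swallows it by a³ = a². -/
theorem absorb (x : ℕ) (w : List ℕ) :
    φ x * φ x * ev φ w = φ x * φ x * ev φ (w.filter (· ≠ x)) := by
  induction w with
  | nil => rfl
  | cons a w ih =>
    by_cases h : a = x
    · subst h
      have : (a :: w).filter (· ≠ a) = w.filter (· ≠ a) := by simp
      rw [this, ← ih, ev_cons, ← mul_assoc, L.sq]
    · have : (a :: w).filter (· ≠ x) = a :: w.filter (· ≠ x) := by simp [h]
      rw [this, ev_cons, ev_cons, ← mul_assoc, L.central, mul_assoc, ih, ← mul_assoc, ← mul_assoc,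
        ← mul_assoc (φ x * φ x), L.central (φ x) (φ a), ← mul_assoc (φ a)]

/-- Neither occurrence is a first one, so `last_last` applies. The law fixes the order of the
earlier occurrences, whence the two cases. -/
theorem swap_of_mem_of_mem {p r : List ℕ} {a b : ℕ} (ha : a ∈ p) (hb : b ∈ p) :
    ev φ (p ++ a :: b :: r) = ev φ (p ++ b :: a :: r) := by
  by_cases hab : a = b
  · rw [hab]
  obtain ⟨p₁, p₂, rfl⟩ := List.append_of_mem ha
  simp only [List.mem_append, List.mem_cons] at hb
  rcases hb with hb | hb | hb
  · obtain ⟨q₁, q₂, rfl⟩ := List.append_of_mem hb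
    have := congrArg (ev φ q₁ * · * ev φ r) (L.last_last (φ b) (φ a) (ev φ q₂) (ev φ p₂))
    simpa [mul_assoc] using this.symm
  · exact absurd hb.symm hab
  · obtain ⟨q₁, q₂, rfl⟩ := List.append_of_mem hb
    have := congrArg (ev φ p₁ * · * ev φ r) (L.last_last (φ a) (φ b) (ev φ q₁) (ev φ q₂))
    simpa [mul_assoc] using this

/-- A repeated occurrence of a meets an occurrence of b that is not the last one; this is
`last_first`. -/
theorem swap_of_mem_left {p r : List ℕ} {a b : ℕ} (ha : a ∈ p) (hb : b ∈ r) :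
    ev φ (p ++ a :: b :: r) = ev φ (p ++ b :: a :: r) := by
  obtain ⟨p₁, p₂, rfl⟩ := List.append_of_mem ha
  obtain ⟨r₁, r₂, rfl⟩ := List.append_of_mem hb
  have := congrArg (ev φ p₁ * · * ev φ r₂) (L.last_first (φ a) (φ b) (ev φ p₂) (ev φ r₁))
  simpa [mul_assoc] using this

/-- Here a occurs at least three times. The three `thrice` laws correspond to the positions of the
later b relative to the next two occurrences of a. -/
theorem swap_of_two_le {p r : List ℕ} {a b : ℕ} (ha : 2 ≤ r.count a) (hb : b ∈ r) (hab : a ≠ b) :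
    ev φ (p ++ a :: b :: r) = ev φ (p ++ b :: a :: r) := by
  obtain ⟨r₁, r₂, rfl, h1⟩ := exists_split_of_lt_count (i := 0) (x := a) (u := r) (by omega)
  obtain ⟨s₁, s₂, rfl, h2⟩ := exists_split_of_lt_count (i := 0) (x := a) (u := r₂)
    (by simp at ha; omega)
  simp only [List.mem_append, List.mem_cons] at hb
  rcases hb with hb | hb | hb | hb | hb
  · obtain ⟨q₁, q₂, rfl⟩ := List.append_of_mem hb
    have := congrArg (ev φ p * · * ev φ s₂)
      (L.thrice₃ (φ a) (φ b) (ev φ q₁) (ev φ q₂) (ev φ s₁))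
    simpa [mul_assoc] using this
  · exact absurd hb.symm hab
  · obtain ⟨q₁, q₂, rfl⟩ := List.append_of_mem hb
    have := congrArg (ev φ p * · * ev φ s₂)
      (L.thrice₂ (φ a) (φ b) (ev φ r₁) (ev φ q₁) (ev φ q₂))
    simpa [mul_assoc] using this
  · exact absurd hb.symm hab
  · obtain ⟨q₁, q₂, rfl⟩ := List.append_of_mem hb
    have := congrArg (ev φ p * · * ev φ q₂)
      (L.thrice₁ (φ a) (φ b) (ev φ r₁) (ev φ s₁) (ev φ q₁))
    simpa [mul_assoc] using this

/-- Adjacent occurrences of letters that are not simple commute unless both are first occurrences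
of letters that occur exactly twice. -/
theorem swap {p r : List ℕ} {a b : ℕ} (hab : a ≠ b) (ha : 2 ≤ (p ++ a :: b :: r).count a)
    (hb : 2 ≤ (p ++ a :: b :: r).count b)
    (h : ¬ (a ∉ p ∧ b ∉ p ∧ r.count a = 1 ∧ r.count b = 1)) :
    ev φ (p ++ a :: b :: r) = ev φ (p ++ b :: a :: r) := by
  have ha' : 1 ≤ p.count a + r.count a := by
    simp [Ne.symm hab] at ha; omega
  have hb' : 1 ≤ p.count b + r.count b := by
    simp [hab] at hb; omega
  by_cases hap : a ∈ p
  · by_cases hbp : b ∈ p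
    · exact L.swap_of_mem_of_mem φ hap hbp
    · rw [List.count_eq_zero.2 hbp] at hb'
      exact L.swap_of_mem_left φ hap (List.count_pos_iff.1 (by omega))
  · rw [List.count_eq_zero.2 hap] at ha'
    by_cases hbp : b ∈ p
    · exact (L.swap_of_mem_left φ hbp (List.count_pos_iff.1 (by omega))).symm
    · rw [List.count_eq_zero.2 hbp] at hb'
      by_cases h2 : 2 ≤ r.count a
      · exact L.swap_of_two_le φ h2 (List.count_pos_iff.1 (by omega)) hab
      · refine (L.swap_of_two_le φ ?_ (List.count_pos_iff.1 (by omega)) hab.symm).symm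
        by_contra h3
        exact h ⟨hap, hbp, by omega, by omega⟩

/-- An occurrence of `x` that is not the first one can be moved to the left over letters that
are not simple. -/
theorem move_left {p q r : List ℕ} {x : ℕ} (hx : x ∈ p)
    (hq : ∀ b ∈ q, 2 ≤ (p ++ (q ++ x :: r)).count b) :
    ev φ (p ++ (q ++ x :: r)) = ev φ (p ++ x :: (q ++ r)) := by
  induction q using List.reverseRecOn generalizing r with
  | nil => simp
  | append_singleton q b ih =>
    have e : p ++ ((q ++ [b]) ++ x :: r) = (p ++ q) ++ b :: x :: r := by simp
    have e' : (p ++ q) ++ x :: b :: r = p ++ (q ++ x :: (b :: r)) := by simp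
    have hc : ∀ l, (p ++ (q ++ x :: (b :: r))).count l = (p ++ ((q ++ [b]) ++ x :: r)).count l := by
      intro l
      simp only [List.count_append, List.count_cons, List.count_nil]
      omega
    have h1 : ev φ (p ++ ((q ++ [b]) ++ x :: r)) = ev φ (p ++ (q ++ x :: (b :: r))) := by
      by_cases hbx : b = x
      · subst hbx; simp
      · rw [e, ← e']
        refine L.swap φ hbx (e ▸ hq b (by simp)) ?_ ?_
        · have := List.count_pos_iff.2 hx
          simp [hbx]; omega
        · rintro ⟨_, h, _⟩
          simp [hx] at h
    rw [h1, ih]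
    · simp
    · intro l hl
      rw [hc]
      exact hq l (by simp [hl])

/-- A letter that is not limited can be replaced by a central square. -/
theorem ev_of_not_limited (hk : 1 ≤ k) {x : ℕ} {u : List ℕ} (hx : ¬ Limited k x u) :
    ev φ u = φ x * φ x * ev φ (u.filter (· ≠ x)) := by
  have fin : ∀ p r, ev φ p * (φ x * φ x) * ev φ r = φ x * φ x * ev φ ((p ++ r).filter (· ≠ x)) := by
    intro p r
    rw [← L.central, mul_assoc, ← ev_append, L.absorb]
  by_cases hc : (u.count x : ℕ∞) ≤ k
  -- The count is small enough, so limitedness fails because the gap after the i-th occurrence of x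
  -- contains no simple letter.
  · have : ∃ i, 1 ≤ i ∧ i < u.count x ∧ ∀ t, u.count t = 1 → countBefore x t u ≠ i := by
      by_contra! h
      exact hx ⟨hc, fun i h1 h2 => h i h1 h2⟩
    obtain ⟨i, hi, hiu, ht⟩ := this
    obtain ⟨p, r, rfl, hp⟩ := exists_split_of_lt_count (i := i - 1) (x := x) (u := u) (by omega)
    obtain ⟨q, r, rfl, hq⟩ := exists_split_of_lt_count (i := 0) (x := x) (u := r)
      (by simp at hiu; omega)
    -- A simple letter of q would have exactly i occurrences of x before it: i - 1 in p and the one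
    -- after p. So q has no simple letter, and the next x moves through it to form a square.
    have hm := L.move_left φ (p := p ++ [x]) (q := q) (r := r) (x := x) (by simp) (by
      intro b hb
      by_contra h2
      have hxb : x ≠ b := by rintro rfl; exact List.count_eq_zero.1 hq hb
      have hb1 : (p ++ x :: (q ++ x :: r)).count b = 1 := by
        have := List.count_pos_iff.2 hb
        simp only [List.count_append, List.count_cons, List.count_nil] at h2 ⊢
        omega
      have hbp : b ∉ p := by
        intro hbp
        have := List.count_pos_iff.2 hb
        have := List.count_pos_iff.2 hbp
        simp [hxb] at hb1
        omega
      have hq' := countBefore_eq_zero_of_notMem b (List.count_eq_zero.1 hq)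
      have := ht b hb1
      simp [countBefore_append, hbp, countBefore_cons, hxb, hb, hq', hp] at this
      omega)
    have h1 : p ++ x :: (q ++ x :: r) = p ++ [x] ++ (q ++ x :: r) := by simp
    have h2 : (p ++ x :: (q ++ x :: r)).filter (· ≠ x) = (p ++ (q ++ r)).filter (· ≠ x) := by
      simp
    rw [h2, ← fin, h1, hm]
    simp [mul_assoc]
  · cases k with
    | top => simp at hc
    | coe n =>
      have hc : n < u.count x := by exact_mod_cast not_le.1 hc
      -- More than n occurrences: the first n + 1 of them form a left side of δ_n, which turns them
      -- into a square.
      obtain ⟨p, r, rfl, hp⟩ := exists_split_of_lt_count (i := 0) (x := x) (u := u) (by omega)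
      obtain ⟨bs, r, hl, rfl⟩ := exists_flatten_of_le_count (n := n) (x := x) (u := r)
        (by simp at hc; omega)
      have h1 : ∀ l : List (List ℕ), ev φ (l.map (· ++ [x])).flatten
          = ((l.map (ev φ)).map (· * φ x)).prod := by
        intro l
        induction l with
        | nil => rfl
        | cons a l ih => simp [ih, mul_assoc]
      have h2 : ∀ l : List (List ℕ), (l.map (ev φ)).prod = ev φ l.flatten := by
        intro l
        induction l with
        | nil => rfl
        | cons a l ih => simp [ih]
      have h3 : ∀ l : List (List ℕ), ((l.map (· ++ [x])).flatten).filter (· ≠ x)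
          = l.flatten.filter (· ≠ x) := by
        intro l
        induction l with
        | nil => rfl
        | cons a l ih => simp_all
      have h4 := L.delta n rfl (φ x) (bs.map (ev φ)) (by simpa using hl)
      have h5 : (p ++ x :: ((bs.map (· ++ [x])).flatten ++ r)).filter (· ≠ x)
          = (p ++ (bs.flatten ++ r)).filter (· ≠ x) := by
        rw [List.filter_append, List.filter_cons, List.filter_append, h3, List.filter_append,
          List.filter_append]
        simp
      rw [h5, ← fin, ev_append, ev_cons, ev_append, h1, ← mul_assoc (φ x), h4, h2, ev_append]
      simp [mul_assoc]

end Laws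

/-- Agreement of a rearrangement `w` of the word `u` with `u`. -/
structure Rearranged (c : ℕ) (w u : List ℕ) : Prop where
  count_eq : ∀ x, w.count x = u.count x
  before_eq : ∀ x t, u.count t = 1 → countBefore x t w = countBefore x t u
  order_iff : ∀ x y, u.count x = 2 → u.count y = 2 → Separated c x y u →
    (0 < countBefore x y w ↔ 0 < countBefore x y u)

/-- Such a swap keeps all counts before simple letters. It affects the order of first occurrences
only for the pair a, b, and only if neither letter occurs in p. -/
theorem Rearranged.swap {c : ℕ} {p r u : List ℕ} {a b : ℕ} (h : Rearranged c (p ++ b :: a :: r) u)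
    (hab : a ≠ b) (ha : u.count a ≠ 1) (hb : u.count b ≠ 1)
    (hp : u.count a = 2 → u.count b = 2 → Separated c a b u → a ∈ p ∨ b ∈ p)
    (hp' : u.count a = 2 → u.count b = 2 → Separated c b a u → a ∈ p ∨ b ∈ p) :
    Rearranged c (p ++ a :: b :: r) u where
  count_eq x := by
    rw [← h.count_eq]
    simp only [List.count_append, List.count_cons]
    omega
  before_eq x t ht := by
    rw [← h.before_eq x t ht]
    have hat : a ≠ t := by rintro rfl; exact ha ht
    have hbt : b ≠ t := by rintro rfl; exact hb ht
    simp only [countBefore_append, countBefore_cons, hat, hbt, if_false]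
    grind
  order_iff x y hx hy hs := by
    rw [← h.order_iff x y hx hy hs]
    have hpos : ∀ l, 0 < p.count l ↔ l ∈ p := fun l => List.count_pos_iff
    have hz : ∀ l m, l ∉ p → countBefore l m p = 0 := fun l m =>
      countBefore_eq_zero_of_notMem m
    simp only [countBefore_append, countBefore_cons]
    by_cases hyp : y ∈ p
    · simp [hyp]
    · by_cases h1 : x = a ∧ y = b
      · obtain ⟨rfl, rfl⟩ := h1
        have := hp hx hy hs
        grind
      · by_cases h2 : x = b ∧ y = a
        · obtain ⟨rfl, rfl⟩ := h2
          have := hp' hy hx hs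
          grind
        · grind

theorem separated_symm {c x y : ℕ} {u : List ℕ} (h : Separated c x y u) : Separated c y x u := by
  match c, h with
  | 1, ⟨t, ht, h1, h2, h3⟩ => exact ⟨t, ht, h2, h1, h3.symm⟩
  | _ + 2, _ => trivial

/-- One step of the sorting of `w` towards `u`. -/
theorem Laws.step {A : Type u} [Monoid A] {k : ℕ∞} {c : ℕ} (L : Laws A k c) (φ : ℕ → A)
    {p q r s : List ℕ} {a b : ℕ} (h : Rearranged c (p ++ q ++ b :: a :: r) (p ++ a :: s))
    (hq : a ∉ q) (hab : a ≠ b) :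
    ev φ (p ++ q ++ b :: a :: r) = ev φ (p ++ q ++ a :: b :: r) ∧
      Rearranged c (p ++ q ++ a :: b :: r) (p ++ a :: s) := by
  set u := p ++ a :: s with hu
  have hca := h.count_eq a
  have hcb := h.count_eq b
  -- A simple a would be preceded in w by one more b than the prefix p and the word q account for,
  -- but in u only by those in p. Similarly, a simple b would be preceded by one more a in u than in
  -- w.
  have ha : u.count a ≠ 1 := by
    intro h1
    have hp : a ∉ p := by
      intro hp
      have := List.count_pos_iff.2 hp
      simp [hu] at h1
      omega
    have := h.before_eq b a h1
    simp [hu, countBefore_append, countBefore_cons, hp, hq, Ne.symm hab] at this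
  have hb : u.count b ≠ 1 := by
    intro h1
    have hp : b ∉ p ∧ b ∉ q := by
      constructor <;> intro hp <;> have := List.count_pos_iff.2 hp <;>
        simp [hab] at hcb <;> omega
    have hq0 := List.count_eq_zero.2 hq
    have := h.before_eq a b h1
    simp [hu, countBefore_append, countBefore_cons, hp, hab, hq0] at this
  have ha2 : 2 ≤ u.count a := by
    have : 0 < u.count a := List.count_pos_iff.2 (by simp [hu])
    omega
  have hb2 : 2 ≤ u.count b := by
    have : 0 < u.count b := by rw [← hcb, List.count_pos_iff]; simp
    omega
  -- If a does not occur in p and b does not occur in p or q, then a comes first in u and b comes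
  -- first in w.
  have key : u.count a = 2 → u.count b = 2 → Separated c a b u → a ∈ p ∨ b ∈ p ++ q := by
    intro h1 h2 hs
    by_contra hn
    simp only [List.mem_append, not_or] at hn
    have := h.order_iff a b h1 h2 hs
    simp [hu, countBefore_append, countBefore_cons, hn, hab, List.count_eq_zero.2 hn.1,
      List.count_eq_zero.2 hq] at this
  have key' : u.count a = 2 → u.count b = 2 → Separated c a b u → a ∈ p ++ q ∨ b ∈ p ++ q := by
    intro h1 h2 hs
    rcases key h1 h2 hs with h | h
    · exact Or.inl (List.mem_append_left _ h)
    · exact Or.inr h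
  refine ⟨?_, h.swap hab ha hb key' fun h1 h2 hs => key' h1 h2 (separated_symm hs)⟩
  -- The exceptional case of `Laws.swap`: two first occurrences of letters occurring exactly twice.
  -- By `key'` it arises only for pairs that are not separated.
  by_cases hn : b ∉ p ++ q ∧ a ∉ p ++ q ∧ r.count b = 1 ∧ r.count a = 1
  · obtain ⟨hbp, hap, hrb, hra⟩ := hn
    have h1 : u.count a = 2 := by
      rw [← hca, List.count_append, List.count_eq_zero.2 hap]; simp [Ne.symm hab, hra]
    have h2 : u.count b = 2 := by
      rw [← hcb, List.count_append, List.count_eq_zero.2 hbp]; simp [hab, hrb]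
    have hns : ¬ Separated c a b u := fun hs => by
      rcases key' h1 h2 hs with h | h
      · exact hap h
      · exact hbp h
    -- the remaining occurrences of `a` and `b`, in either order
    have main : ∀ {a b : ℕ} {r₁ r₂ r₃ : List ℕ}, a ≠ b → a ∉ p ++ q → b ∉ p ++ q →
        b ∉ r₁ → b ∉ r₂ → a ∉ r₁ → (∀ l, (p ++ q ++ a :: b :: (r₁ ++ a :: (r₂ ++ b :: r₃))).count l
          = u.count l) → (∀ x t, u.count t = 1 →
          countBefore x t (p ++ q ++ a :: b :: (r₁ ++ a :: (r₂ ++ b :: r₃))) = countBefore x t u) →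
        ¬ Separated c a b u →
        ev φ (p ++ q ++ a :: b :: (r₁ ++ a :: (r₂ ++ b :: r₃))) =
          ev φ (p ++ q ++ b :: a :: (r₁ ++ a :: (r₂ ++ b :: r₃))) := by
      intro a b r₁ r₂ r₃ hab ha hb hb1 hb2 ha1 hc hbef hns
      match c, hns, L with
      | 0, _, L =>
        have := congrArg (ev φ (p ++ q) * · * ev φ r₃)
          (L.first_first rfl (φ a) (φ b) (ev φ r₁) (ev φ r₂))
        simpa [mul_assoc] using this
      | c + 2, hns, _ => exact absurd trivial hns
      | 1, hns, L =>
        -- A simple letter between the second occurrences would separate a and b. As there is none,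
        -- the second b can be moved next to the second a; there `first_block` swaps the first
        -- occurrences, and b is moved back.
        have hr : ∀ l ∈ r₂, l ≠ a → 2 ≤ u.count l := by
          intro l hl hla
          by_contra h2
          have hl1 : u.count l = 1 := by
            have := List.count_pos_iff.2 hl
            have := hc l
            simp only [List.count_append, List.count_cons] at this h2
            omega
          have hlc := hc l
          have hlb : b ≠ l := by rintro rfl; exact hb2 hl
          have hlp : l ∉ p ++ q ∧ l ∉ r₁ := by
            have := List.count_pos_iff.2 hl
            constructor <;> intro hp <;> have := List.count_pos_iff.2 hp <;>
              simp only [List.count_append, List.count_cons] at hlc this <;> omega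
          have hb2' := countBefore_eq_zero_of_notMem l hb2
          have e1 := hbef a l hl1
          have e2 := hbef b l hl1
          simp only [countBefore_append _ _ (p ++ q), hlp, if_false, countBefore_cons, Ne.symm hla,
            hlb, hab, hab.symm, if_true, countBefore_append _ _ r₁, List.count_eq_zero.2 ha,
            List.count_eq_zero.2 hb, List.count_eq_zero.2 ha1, List.count_eq_zero.2 hb1,
            countBefore_append _ _ r₂, hl, hb2'] at e1 e2
          exact hns ⟨l, hl1, by omega, by omega, by omega⟩
        have mv : ∀ P : List ℕ, a ∈ P → b ∈ P → (∀ l, (P ++ (r₂ ++ b :: r₃)).count l = u.count l) →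
            ev φ (P ++ (r₂ ++ b :: r₃)) = ev φ (P ++ b :: (r₂ ++ r₃)) := by
          intro P haP hbP hPc
          refine L.move_left φ hbP fun l hl => ?_
          by_cases hla : l = a
          · subst hla
            have := List.count_pos_iff.2 hl
            have := List.count_pos_iff.2 haP
            simp; omega
          · rw [hPc]; exact hr l hl hla
        have m1 := mv (p ++ q ++ a :: b :: (r₁ ++ [a])) (by simp) (by simp) (by
          intro l; rw [← hc l]; simp)
        have m2 := mv (p ++ q ++ b :: a :: (r₁ ++ [a])) (by simp) (by simp) (by
          intro l; rw [← hc l]; simp only [List.count_append, List.count_cons, List.count_nil]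
          omega)
        have e : ∀ (i j : ℕ) (w : List ℕ),
            p ++ q ++ i :: j :: (r₁ ++ a :: w) = p ++ q ++ i :: j :: (r₁ ++ [a]) ++ w := by simp
        rw [e a b, e b a, m1, m2]
        have := congrArg (ev φ (p ++ q) * · * ev φ (r₂ ++ r₃))
          (L.first_block le_rfl (φ a) (φ b) (ev φ r₁))
        simpa [mul_assoc] using this
    obtain ⟨r₁, r₂, rfl, hr1⟩ := exists_split_of_lt_count (i := 0) (x := a) (u := r) (by omega)
    have hra2 : a ∉ r₂ := List.count_eq_zero.1 (by simpa [hr1] using hra)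
    have hmem : b ∈ r₁ ++ a :: r₂ := List.count_pos_iff.1 (by omega)
    have hc2 : ∀ l, (p ++ q ++ a :: b :: (r₁ ++ a :: r₂)).count l = u.count l := by
      intro l
      rw [← h.count_eq]
      simp only [List.count_append, List.count_cons]
      omega
    have h' := h.swap hab ha hb key' fun h1 h2 hs => key' h1 h2 (separated_symm hs)
    have hmem : b ∈ r₁ ∨ b ∈ r₂ := by simpa [Ne.symm hab] using hmem
    rcases hmem with hm | hm
    · obtain ⟨s₁, s₂, rfl, hs1⟩ := exists_split_of_lt_count (i := 0) (x := b) (u := r₁)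
        (List.count_pos_iff.2 hm)
      have e : s₁ ++ b :: s₂ ++ a :: r₂ = s₁ ++ b :: (s₂ ++ a :: r₂) := by simp
      rw [e] at h h' ⊢
      rw [List.count_append] at hr1
      exact main hab.symm hbp hap (List.count_eq_zero.1 (by omega))
        (List.count_eq_zero.1 (by rw [List.count_cons] at hr1; omega))
        (List.count_eq_zero.1 hs1) h.count_eq h.before_eq fun hs => hns (separated_symm hs)
    · obtain ⟨s₁, s₂, rfl, hs1⟩ := exists_split_of_lt_count (i := 0) (x := b) (u := r₂)
        (List.count_pos_iff.2 hm)
      refine (main hab hap hbp ?_ (List.count_eq_zero.1 hs1) (List.count_eq_zero.1 hr1)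
        h'.count_eq h'.before_eq hns).symm
      intro hb1
      have := List.count_pos_iff.2 hb1
      rw [List.count_append, List.count_cons, List.count_append, List.count_cons_self] at hrb
      omega
  · refine L.swap φ hab.symm ?_ ?_ hn
    · rw [hcb]; exact hb2
    · rw [hca]; exact ha2

/-- Bubble sort: the next letter of u is carried to the front of the unsorted part of w by steps
that preserve both the value and the agreement with u. -/
theorem Laws.ev_eq_of_rearranged {A : Type u} [Monoid A] {k : ℕ∞} {c : ℕ} (L : Laws A k c)
    (φ : ℕ → A) {w u : List ℕ} (h : Rearranged c w u) : ev φ w = ev φ u := by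
  suffices H : ∀ (s p w : List ℕ), Rearranged c (p ++ w) (p ++ s) → ev φ (p ++ w) = ev φ (p ++ s)
    from H u [] w h
  clear h w u
  intro s
  induction s with
  | nil =>
    intro p w h
    cases w with
    | nil => rfl
    | cons d w => have := h.count_eq d; simp at this
  | cons a s ih =>
    intro p w h
    have hmove : ∀ q r : List ℕ, a ∉ q → Rearranged c (p ++ q ++ a :: r) (p ++ a :: s) →
        ev φ (p ++ q ++ a :: r) = ev φ (p ++ a :: (q ++ r)) ∧
          Rearranged c (p ++ a :: (q ++ r)) (p ++ a :: s) := by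
      intro q
      induction q using List.reverseRecOn with
      | nil => intro r _ h; simpa using h
      | append_singleton q b ihq =>
        intro r hq hr
        simp only [List.mem_append, List.mem_singleton, not_or] at hq
        have e : p ++ (q ++ [b]) ++ a :: r = p ++ q ++ b :: a :: r := by simp
        rw [e] at hr ⊢
        obtain ⟨h1, h2⟩ := L.step φ hr hq.1 hq.2
        obtain ⟨h3, h4⟩ := ihq (b :: r) hq.1 h2
        have e2 : q ++ [b] ++ r = q ++ b :: r := by simp
        rw [e2]
        exact ⟨h1.trans h3, h4⟩
    have haw : 0 < w.count a := by
      have := h.count_eq a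
      simp at this
      omega
    obtain ⟨q, r, rfl, hq⟩ := exists_split_of_lt_count (i := 0) haw
    obtain ⟨h1, h2⟩ := hmove q r (List.count_eq_zero.1 hq) (by simpa using h)
    have e : ∀ w, p ++ a :: w = (p ++ [a]) ++ w := by simp
    rw [e (q ++ r), e s] at h2
    have := ih (p ++ [a]) _ h2
    rw [← List.append_assoc, h1, e (q ++ r), e s, this]

/-- Words that agree have equal values in monoids with the corresponding laws. -/
theorem Laws.ev_eq_of_agree {A : Type u} [Monoid A] {k : ℕ∞} {c : ℕ} (L : Laws A k c)
    (hk : 1 ≤ k) (φ : ℕ → A) {u v : List ℕ} (h : Agree k c u v) : ev φ u = ev φ v := by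
  induction hn : u.length using Nat.strong_induction_on generalizing u v with
  | _ n ih =>
    -- If all letters are limited, agreement makes v a rearrangement of u. Otherwise an unlimited
    -- letter becomes the same central square in both words and the induction continues with shorter
    -- words.
    by_cases hl : ∀ x, Limited k x u
    · refine (L.ev_eq_of_rearranged φ ⟨fun x => (h.count_eq x (hl x)).symm,
        fun x t ht => (h.before_eq x t (hl x) ht).symm,
        fun x y hx hy hs => (h.order_iff x y (hl x) (hl y) hx hy hs).symm⟩).symm
    · push Not at hl
      obtain ⟨x, hx⟩ := hl
      have hxv : ¬ Limited k x v := fun hv => hx ((h.limited_iff x).2 hv)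
      have hx1 : ¬ u.count x ≤ 1 := fun h1 => hx (limited_of_count_le_one hk h1)
      rw [L.ev_of_not_limited φ hk hx, L.ev_of_not_limited φ hk hxv,
        ih _ ?_ (h.filter_ne (x := x) (by omega)) rfl]
      rw [← hn]
      refine lt_of_le_of_ne (List.length_filter_le _ _) fun he => ?_
      have := List.length_filter_eq_length_iff.1 he x (List.count_pos_iff.1 (by omega))
      simp at this


/-! ### Varieties and the identities they satisfy -/

theorem lift_eq_ev {A : Type v} [Monoid A] (φ : ℕ → A) (w : Word) :
    FreeMonoid.lift φ w = ev φ w.toList := FreeMonoid.lift_apply φ w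

theorem holds_iff {A : Type v} [Monoid A] (e : Identity) :
    Holds A e ↔ ∀ φ : ℕ → A, ev φ e.1.toList = ev φ e.2.toList := by
  simp only [Holds, lift_eq_ev]

theorem map_ev {A : Type u} {B : Type v} [Monoid A] [Monoid B] (f : A →* B) (φ : ℕ → A)
    (w : List ℕ) : f (ev φ w) = ev (fun n => f (φ n)) w := by
  induction w with
  | nil => simp
  | cons a w ih => simp [ih]

theorem ev_flatMap {A : Type u} [Monoid A] (φ : ℕ → A) (σ : ℕ → List ℕ) (w : List ℕ) :
    ev φ (w.flatMap σ) = ev (fun n => ev φ (σ n)) w := by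
  induction w with
  | nil => rfl
  | cons a w ih => simp [ih]

/-- The variety `V` satisfies the identity `u ≈ v`. -/
def Entails (V : MonoidVariety.{u}) (u v : List ℕ) : Prop :=
  ∀ (M : Type u) [Monoid M], V.Mem M → ∀ φ : ℕ → M, ev φ u = ev φ v

namespace Entails
variable {V : MonoidVariety.{u}} {u v w u' v' : List ℕ}

theorem refl (V : MonoidVariety.{u}) (u : List ℕ) : Entails V u u := fun _ _ _ _ => rfl

theorem symm (h : Entails V u v) : Entails V v u := fun M _ hM φ => (h M hM φ).symm

theorem trans (h : Entails V u v) (h' : Entails V v w) : Entails V u w :=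
  fun M _ hM φ => (h M hM φ).trans (h' M hM φ)

theorem append (h : Entails V u v) (h' : Entails V u' v') : Entails V (u ++ u') (v ++ v') :=
  fun M _ hM φ => by rw [ev_append, ev_append, h M hM φ, h' M hM φ]

theorem flatMap (h : Entails V u v) (σ : ℕ → List ℕ) :
    Entails V (u.flatMap σ) (v.flatMap σ) :=
  fun M _ hM φ => by rw [ev_flatMap, ev_flatMap]; exact h M hM _

/-- A partial renaming is a substitution that sends the deleted letters to the empty word. -/
theorem filterMap (h : Entails V u v) (ρ : ℕ → Option ℕ) :
    Entails V (u.filterMap ρ) (v.filterMap ρ) := by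
  have e : ∀ w : List ℕ, w.filterMap ρ = w.flatMap fun l => (ρ l).toList := by
    intro w
    induction w with
    | nil => rfl
    | cons a w ih => cases h : ρ a <;> simp [h, ih]
  rw [e, e]
  exact h.flatMap _

end Entails

theorem le_iff_entails {V W : MonoidVariety.{u}} :
    V ≤ W ↔ ∀ u v, Entails W u v → Entails V u v := by
  constructor
  · intro h u v e M _ hM
    exact e M (h M hM)
  · intro h M _ hM
    obtain ⟨E, hE⟩ := W.equational
    refine (hE M).2 fun e he => (holds_iff e).2 ?_
    exact h _ _ (fun N _ hN => (holds_iff e).1 ((hE N).1 hN e he)) M hM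

theorem le_ofIdentities_iff {V : MonoidVariety.{u}} {E : Set Identity} :
    V ≤ .ofIdentities E ↔ ∀ e ∈ E, Entails V e.1.toList e.2.toList :=
  ⟨fun h e he M _ hM => (holds_iff e).1 (h M hM e he),
    fun h M _ hM e he => (holds_iff e).2 (h e he M hM)⟩

theorem le_ofIdentities_singleton_iff {V : MonoidVariety.{u}} {u v : List ℕ} :
    V ≤ .ofIdentities {(FreeMonoid.ofList u, FreeMonoid.ofList v)} ↔ Entails V u v := by
  rw [le_ofIdentities_iff]
  simp

/-- An identity holds in a variety exactly if the variety lies below the one defined by the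
identity, so this is the universal property of the join. -/
theorem entails_sup {V W : MonoidVariety.{u}} {u v : List ℕ} :
    Entails (V ⊔ W) u v ↔ Entails V u v ∧ Entails W u v := by
  simp only [← le_ofIdentities_singleton_iff, sup_le_iff]

theorem entails_varD_top {u v : List ℕ} :
    Entails (varD.{u} ⊤) u v ↔ ∀ k : ℕ, 1 ≤ k → Entails (varD.{u} k) u v := by
  simp only [← le_ofIdentities_singleton_iff]
  change (⨆ k ∈ {k : ℕ | 1 ≤ k}, varDFin k) ≤ _ ↔ ∀ k : ℕ, 1 ≤ k → varDFin k ≤ _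
  simp

theorem holds_ulift {A : Type} [Monoid A] (e : Identity) :
    Holds (ULift.{u} A) e ↔ Holds A e := by
  rw [holds_iff, holds_iff]
  constructor
  · intro h φ
    have := congrArg (MulEquiv.ulift : ULift.{u} A ≃* A).toMonoidHom (h fun n => ULift.up (φ n))
    rw [map_ev, map_ev] at this
    exact this
  · intro h φ
    apply (MulEquiv.ulift : ULift.{u} A ≃* A).injective
    have key : ∀ w, (MulEquiv.ulift : ULift.{u} A ≃* A) (ev φ w) = ev (fun n => (φ n).down) w :=
      fun w => map_ev (MulEquiv.ulift : ULift.{u} A ≃* A).toMonoidHom φ w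
    rw [key, key, h]

/-- The generators S(w) and the syntactic monoid used below live in the lowest universe; `ULift`
supplies a copy that is a member of the variety. -/
theorem entails_generatedBy {A : Type} [Monoid A] {u v : List ℕ} :
    Entails (.generatedBy A : MonoidVariety.{u}) u v ↔ ∀ φ : ℕ → A, ev φ u = ev φ v := by
  have hA : (MonoidVariety.generatedBy A : MonoidVariety.{u}).Mem (ULift.{u} A) :=
    fun e he => (holds_ulift e).2 he
  constructor
  · intro h
    have : Holds A (FreeMonoid.ofList u, FreeMonoid.ofList v) :=
      (holds_ulift.{u} _).1 ((holds_iff _).2 (h _ hA))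
    exact (holds_iff _).1 this
  · intro h M _ hM
    exact (holds_iff (FreeMonoid.ofList u, FreeMonoid.ofList v)).1 (hM _ ((holds_iff _).2 h))

/-! #### Isoterms -/

/-- The word `w` is an isoterm for `V`. -/
def Isoterm (V : MonoidVariety.{u}) (w : List ℕ) : Prop := ∀ v, Entails V w v → v = w

theorem ev_mk (W : Set Word) (ψ : ℕ → List ℕ) (u : List ℕ) :
    ev (fun n => (reesCon W).mk' (FreeMonoid.ofList (ψ n))) u
      = (reesCon W).mk' (FreeMonoid.ofList (u.flatMap ψ)) := by
  induction u with
  | nil => rfl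
  | cons a u ih => rw [ev_cons, ih, ← map_mul, List.flatMap_cons]; rfl

/-- Values in the Rees quotient lift to words, so evaluation becomes substitution. Two images are
equal in S(w) if they are the same word or if neither is a factor of w; a context that completes one
image to w must complete the other as well. -/
theorem entails_S {w u v : List ℕ} :
    Entails (.generatedBy (S {FreeMonoid.ofList w}) : MonoidVariety.{u}) u v ↔
      ∀ (ψ : ℕ → List ℕ) (p q : List ℕ),
        p ++ u.flatMap ψ ++ q = w ↔ p ++ v.flatMap ψ ++ q = w := by
  have hsub : ∀ a : List ℕ, IsSubwordOf {FreeMonoid.ofList w} (FreeMonoid.ofList a) ↔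
      ∃ p q, p ++ a ++ q = w := by
    intro a
    constructor
    · rintro ⟨_, rfl, p, q, h⟩
      exact ⟨p.toList, q.toList, h.symm⟩
    · rintro ⟨p, q, h⟩
      exact ⟨_, rfl, FreeMonoid.ofList p, FreeMonoid.ofList q, h.symm⟩
  rw [entails_generatedBy]
  constructor
  · intro h ψ p q
    have := h fun n => (reesCon _).mk' (FreeMonoid.ofList (ψ n))
    rw [ev_mk, ev_mk] at this
    rcases (Con.eq _).1 this with h | ⟨h1, h2⟩
    · rw [FreeMonoid.ofList.injective h]
    · exact iff_of_false (fun h => h1 ((hsub _).2 ⟨p, q, h⟩))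
        fun h => h2 ((hsub _).2 ⟨p, q, h⟩)
  · intro h φ
    choose f hf using fun n => Con.mk'_surjective (c := reesCon {FreeMonoid.ofList w}) (φ n)
    obtain rfl : (fun n => (reesCon _).mk' (FreeMonoid.ofList (f n).toList)) = φ := funext hf
    rw [ev_mk, ev_mk]
    refine (Con.eq _).2 ?_
    by_cases h1 : ∃ p q, p ++ u.flatMap (fun n => (f n).toList) ++ q = w
    · obtain ⟨p, q, h1⟩ := h1
      have h2 := (h _ p q).1 h1
      rw [← h2] at h1
      exact Or.inl (congrArg FreeMonoid.ofList
        (List.append_cancel_left (List.append_cancel_right h1)))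
    · refine Or.inr ⟨fun h3 => h1 ((hsub _).1 h3), fun h3 => h1 ?_⟩
      obtain ⟨p, q, h3⟩ := (hsub _).1 h3
      exact ⟨p, q, (h _ p q).2 h3⟩

/-- If w is an isoterm and an image of u completes to w in some context, then V equates w with the
same context around the image of v, so the two words coincide. Conversely, the identity substitution
in S(w) recognizes w. -/
theorem generatedBy_S_le_iff {V : MonoidVariety.{u}} {w : List ℕ} :
    .generatedBy (S {FreeMonoid.ofList w}) ≤ V ↔ Isoterm V w := by
  have hid : ∀ u : List ℕ, u.flatMap (fun n => [n]) = u := by simp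
  rw [le_iff_entails]
  constructor
  · intro h v hv
    have := (entails_S.1 (h _ _ hv) (fun n => [n]) [] []).1 (by simp)
    simpa using this
  · intro h u v huv
    refine entails_S.2 fun ψ p q => ⟨fun h1 => ?_, fun h1 => ?_⟩
    · have := ((Entails.refl V p).append (huv.flatMap ψ)).append (Entails.refl V q)
      rw [h1] at this
      exact h _ this
    · have := ((Entails.refl V p).append (huv.symm.flatMap ψ)).append (Entails.refl V q)
      rw [h1] at this
      exact h _ this

theorem Isoterm.of_append {V : MonoidVariety.{u}} {p w q : List ℕ} (h : Isoterm V (p ++ w ++ q)) :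
    Isoterm V w := fun v hv => by
  have := h _ (((Entails.refl V p).append hv).append (Entails.refl V q))
  exact List.append_cancel_left (List.append_cancel_right this)

theorem Isoterm.mono {V W : MonoidVariety.{u}} (hVW : V ≤ W) {w : List ℕ} (h : Isoterm V w) :
    Isoterm W w := fun v hv => h v (le_iff_entails.1 hVW _ _ hv)

theorem isoterm_S (w : List ℕ) :
    Isoterm (.generatedBy (S {FreeMonoid.ofList w}) : MonoidVariety.{u}) w :=
  generatedBy_S_le_iff.1 le_rfl

/-! #### The words `x t₁ x t₂ x ⋯` -/

/-- The word `x t₁ x t₂ x ⋯ tₙ x` with `x` the letter `0` and given letters `tᵢ`. -/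
def interleave (ts : List ℕ) : List ℕ := 0 :: ts.flatMap fun t => [t, 0]

/-- The letters `1, …, m`. -/
def lettersTo (m : ℕ) : List ℕ := (List.range m).map (· + 1)

theorem lettersTo_succ (m : ℕ) : lettersTo (m + 1) = lettersTo m ++ [m + 1] := by
  simp [lettersTo, List.range_succ]

theorem interleave_lettersTo_succ (m : ℕ) :
    interleave (lettersTo (m + 1)) = interleave (lettersTo m) ++ [m + 1, 0] := by
  simp [interleave, lettersTo_succ]

theorem toList_prod_map {α β : Type*} (f : α → FreeMonoid β) (l : List α) :
    ((l.map f).prod).toList = l.flatMap fun i => (f i).toList := by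
  induction l with
  | nil => rfl
  | cons a l ih => simp [ih]

theorem xtWord_toList (m : ℕ) : (xtWord m).toList = interleave (lettersTo m) := by
  rw [xtWord, FreeMonoid.toList_mul, toList_prod_map]
  simp [interleave, lettersTo, List.flatMap_map, x, letter]

theorem tWord_toList (m : ℕ) : (tWord m).toList = lettersTo m := by
  rw [tWord, toList_prod_map]
  simp [lettersTo, List.map_eq_flatMap]

theorem varD_one : varD.{u} 1 = .generatedBy (S {FreeMonoid.ofList [0, 1]}) := rfl

theorem varD_coe_succ {k : ℕ} (hk : 1 ≤ k) :
    varD.{u} ((k + 1 : ℕ) : ℕ∞)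
      = .generatedBy (S {FreeMonoid.ofList (interleave (lettersTo k))}) := by
  have : varDFin.{u} (k + 1) = .generatedBy (S {xtWord k}) := by
    rw [varDFin, if_neg (by omega)]; rfl
  rw [← xtWord_toList, FreeMonoid.ofList_toList, ← this]
  rfl

theorem varM_eq : varM.{u} = .generatedBy (S {FreeMonoid.ofList [0, 1, 3, 0, 4, 1]}) := rfl

theorem varD_one_le_iff {V : MonoidVariety.{u}} : varD 1 ≤ V ↔ Isoterm V [0, 1] := by
  rw [varD_one, generatedBy_S_le_iff]

theorem varD_succ_le_iff {V : MonoidVariety.{u}} {k : ℕ} (hk : 1 ≤ k) :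
    varD ((k + 1 : ℕ) : ℕ∞) ≤ V ↔ Isoterm V (interleave (lettersTo k)) := by
  rw [varD_coe_succ hk, generatedBy_S_le_iff]

theorem varM_le_iff {V : MonoidVariety.{u}} : varM ≤ V ↔ Isoterm V [0, 1, 3, 0, 4, 1] := by
  rw [varM_eq, generatedBy_S_le_iff]

theorem isoterm_interleave_of_le {V : MonoidVariety.{u}} {j k : ℕ} (hjk : j ≤ k)
    (h : Isoterm V (interleave (lettersTo k))) : Isoterm V (interleave (lettersTo j)) := by
  induction k, hjk using Nat.le_induction with
  | base => exact h
  | succ k _ ih =>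
    rw [interleave_lettersTo_succ] at h
    exact ih (Isoterm.of_append (p := []) h)

theorem isoterm_pair_of_interleave {V : MonoidVariety.{u}} {k : ℕ} (hk : 1 ≤ k)
    (h : Isoterm V (interleave (lettersTo k))) : Isoterm V [0, 1] :=
  Isoterm.of_append (p := []) (q := [0]) (isoterm_interleave_of_le hk h)

theorem varD_mono {k l : ℕ∞} (hk : 1 ≤ k) (hkl : k ≤ l) : varD.{u} k ≤ varD l := by
  have hfin : ∀ m n : ℕ, 1 ≤ m → m ≤ n → varD.{u} m ≤ varD n := by
    intro m n hm hmn
    obtain ⟨m, rfl⟩ := Nat.exists_eq_add_of_le' hm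
    obtain ⟨n, rfl⟩ := Nat.exists_eq_add_of_le' (hm.trans hmn)
    -- The generator xy of D_1 is not of the form xt₁x⋯, so the index 1 is treated apart. Otherwise
    -- the shorter word is a prefix of the longer one.
    rcases Nat.eq_zero_or_pos n with rfl | hn
    · obtain rfl : m = 0 := by omega
      exact le_rfl
    · have h := (varD_succ_le_iff.{u} hn).1 le_rfl
      rcases Nat.eq_zero_or_pos m with rfl | hm'
      · exact varD_one_le_iff.2 (isoterm_pair_of_interleave hn h)
      · exact (varD_succ_le_iff hm').2 (isoterm_interleave_of_le (by omega) h)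
  cases l with
  | coe n =>
    lift k to ℕ using ne_top_of_le_ne_top (ENat.natCast_ne_top n) hkl
    exact hfin k n (by exact_mod_cast hk) (by exact_mod_cast hkl)
  | top =>
    cases k with
    | top => exact le_rfl
    | coe m => exact le_iff_entails.2 fun u v h => entails_varD_top.1 h m (by exact_mod_cast hk)


/-! ### Identities of the generating monoids -/

theorem lettersTo_nodup (m : ℕ) : (lettersTo m).Nodup :=
  List.nodup_range.map fun _ _ h => Nat.succ_injective h

theorem mem_lettersTo {m l : ℕ} : l ∈ lettersTo m ↔ 1 ≤ l ∧ l ≤ m := by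
  simp only [lettersTo, List.mem_map, List.mem_range]
  constructor
  · rintro ⟨i, hi, rfl⟩; omega
  · intro h; exact ⟨l - 1, by omega, by omega⟩

theorem length_lettersTo (m : ℕ) : (lettersTo m).length = m := by simp [lettersTo]

theorem count_interleave_of_ne {l : ℕ} (hl : l ≠ 0) (ts : List ℕ) :
    (interleave ts).count l = ts.count l := by
  rw [interleave, List.count_cons_of_ne (Ne.symm hl)]
  induction ts with
  | nil => rfl
  | cons a ts ih => simp [List.count_cons, ih, Ne.symm hl]

theorem count_zero_interleave {ts : List ℕ} (h : 0 ∉ ts) :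
    (interleave ts).count 0 = ts.length + 1 := by
  rw [interleave, List.count_cons_self]
  congr 1
  induction ts with
  | nil => rfl
  | cons a ts ih =>
    simp only [List.mem_cons, not_or] at h
    simp [ih h.2, Ne.symm h.1]

theorem isChain_interleave {ts : List ℕ} (h : 0 ∉ ts) :
    (interleave ts).IsChain fun c d => ¬ (c = 0 ∧ d = 0) := by
  induction ts with
  | nil => simp [interleave]
  | cons a ts ih =>
    simp only [List.mem_cons, not_or] at h
    have := ih h.2
    simp only [interleave, List.flatMap_cons, List.cons_append, List.nil_append,
      List.isChain_cons_cons] at this ⊢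
    exact ⟨by have := h.1; omega, by have := h.1; omega, this⟩

/-- The only letter of xt₁x⋯t_mx that can occur twice is x. So a would end and b would begin with x,
but two letters x are never adjacent. -/
theorem not_adjacent_interleave {ts p a b q : List ℕ} (h0 : 0 ∉ ts) (hn : ts.Nodup)
    (h : p ++ a ++ b ++ q = interleave ts) (ha : a ≠ []) (hb : b ≠ [])
    (ha2 : ∀ l ∈ a, 2 ≤ (interleave ts).count l) (hb2 : ∀ l ∈ b, 2 ≤ (interleave ts).count l) :
    False := by
  have hz : ∀ l, 2 ≤ (interleave ts).count l → l = 0 := by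
    intro l hl
    by_contra h
    rw [count_interleave_of_ne h] at hl
    have := List.nodup_iff_count_le_one.1 hn l
    omega
  obtain ⟨a, c, rfl⟩ := List.eq_nil_or_concat'  a |>.resolve_left ha
  obtain ⟨d, b, rfl⟩ := List.exists_cons_of_ne_nil hb
  have hc := hz c (ha2 c (by simp))
  have hd := hz d (hb2 d (by simp))
  subst hc hd
  have hch := isChain_interleave h0
  rw [← h] at hch
  have : [0, 0] <:+: p ++ (a ++ [0]) ++ 0 :: b ++ q := ⟨p ++ a, b ++ q, by simp⟩
  have := hch.infix this
  simp at this

/-! ### Identities checked by counting letters in images -/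

theorem count_mul_le_count_flatMap (φ : ℕ → List ℕ) (i l : ℕ) (u : List ℕ) :
    u.count i * (φ i).count l ≤ (u.flatMap φ).count l := by
  induction u with
  | nil => simp
  | cons a u ih =>
    rw [List.flatMap_cons, List.count_append, List.count_cons]
    by_cases h : a = i
    · subst h; simp [Nat.add_mul]; omega
    · simp [h]; omega

theorem two_le_count_of_mem_image {φ : ℕ → List ℕ} {i l n : ℕ} {p u q w : List ℕ}
    (h : p ++ u.flatMap φ ++ q = w) (hi : n ≤ u.count i) (hl : l ∈ φ i) : n ≤ w.count l := by
  have h1 := count_mul_le_count_flatMap φ i l u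
  have h2 : 1 ≤ (φ i).count l := List.count_pos_iff.2 hl
  rw [← h]
  simp only [List.count_append]
  have := Nat.mul_le_mul hi h2
  omega

/-- Satisfaction in `D_∞` can be checked in the monoids `S(x t₁ x ⋯ t_m x)`. -/
theorem entails_varD_top_of {u v : List ℕ}
    (h : ∀ m, ∀ (ψ : ℕ → List ℕ) (p q : List ℕ), p ++ u.flatMap ψ ++ q = interleave (lettersTo m) ↔
      p ++ v.flatMap ψ ++ q = interleave (lettersTo m)) : Entails (varD.{u} ⊤) u v := by
  refine entails_varD_top.2 fun k hk => ?_
  -- Passing to D_{k+1} avoids the exceptional generator of D_1.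
  refine le_iff_entails.1 (varD_mono (l := ((k + 1 : ℕ) : ℕ∞)) (by exact_mod_cast hk) (by
    exact_mod_cast Nat.le_succ k)) _ _ ?_
  rw [varD_coe_succ hk]
  exact entails_S.2 (h k)

theorem zero_notMem_lettersTo (m : ℕ) : 0 ∉ lettersTo m := by simp [mem_lettersTo]

/-- Identities of `D_∞`: adjacent occurrences of letters that are not simple commute. -/
theorem entails_varD_top_swap {α β : List ℕ} {i j : ℕ}
    (hi : 2 ≤ (α ++ i :: j :: β).count i) (hj : 2 ≤ (α ++ i :: j :: β).count j) :
    Entails (varD.{u} ⊤) (α ++ i :: j :: β) (α ++ j :: i :: β) := by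
  have key : ∀ {i j : ℕ}, 2 ≤ (α ++ i :: j :: β).count i → 2 ≤ (α ++ i :: j :: β).count j →
      ∀ (m : ℕ) (ψ : ℕ → List ℕ) (p q : List ℕ), ψ i ≠ [] → ψ j ≠ [] →
      p ++ (α ++ i :: j :: β).flatMap ψ ++ q ≠ interleave (lettersTo m) := by
    intro i j hi hj m ψ p q h1 h2 h
    refine not_adjacent_interleave (p := p ++ α.flatMap ψ) (a := ψ i) (b := ψ j)
      (q := β.flatMap ψ ++ q) (zero_notMem_lettersTo m) (lettersTo_nodup m) ?_ h1 h2
      (fun l hl => two_le_count_of_mem_image h hi hl)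
      (fun l hl => two_le_count_of_mem_image h hj hl)
    rw [← h]; simp
  have hc : ∀ l, (α ++ j :: i :: β).count l = (α ++ i :: j :: β).count l := fun l => by
    simp only [List.count_append, List.count_cons]; omega
  refine entails_varD_top_of fun m ψ p q => ?_
  by_cases h1 : ψ i = []
  · simp [h1]
  by_cases h2 : ψ j = []
  · simp [h2]
  exact iff_of_false (key hi hj m ψ p q h1 h2)
    (key (by rw [hc]; exact hj) (by rw [hc]; exact hi) m ψ p q h2 h1)

theorem not_square_interleave {m : ℕ} {p a q : List ℕ} (ha : a ≠ []) :
    p ++ a ++ a ++ q ≠ interleave (lettersTo m) := by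
  intro h
  have h2 : ∀ l ∈ a, 2 ≤ (interleave (lettersTo m)).count l := by
    intro l hl
    have := List.count_pos_iff.2 hl
    rw [← h]
    simp only [List.count_append]
    omega
  exact not_adjacent_interleave (zero_notMem_lettersTo m) (lettersTo_nodup m) h ha ha h2 h2

theorem entails_varD_top_sq : Entails (varD.{u} ⊤) [0, 0] [0, 0, 0] := by
  refine entails_varD_top_of fun m ψ p q => ?_
  by_cases h : ψ 0 = []
  · simp [h]
  · refine iff_of_false ?_ ?_
    · simpa using not_square_interleave (m := m) (p := p) (q := q) h
    · simpa using not_square_interleave (m := m) (p := p) (q := ψ 0 ++ q) h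

theorem entails_varD_top_central : Entails (varD.{u} ⊤) [0, 0, 1] [1, 0, 0] := by
  refine entails_varD_top_of fun m ψ p q => ?_
  by_cases h : ψ 0 = []
  · simp [h]
  · refine iff_of_false ?_ ?_
    · simpa using not_square_interleave (m := m) (p := p) (q := ψ 1 ++ q) h
    · simpa using not_square_interleave (m := m) (p := p ++ ψ 1) (q := q) h

theorem delta_fst_toList (n : ℕ) : (delta n).1.toList = interleave (lettersTo n) :=
  xtWord_toList n

theorem delta_snd_toList (n : ℕ) : (delta n).2.toList = 0 :: 0 :: lettersTo n := by
  change (x ^ 2 * tWord n).toList = _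
  rw [FreeMonoid.toList_mul, tWord_toList]
  rfl

theorem flatMap_interleave_of_eq_nil {ψ : ℕ → List ℕ} (h : ψ 0 = []) (ts : List ℕ) :
    (interleave ts).flatMap ψ = ts.flatMap ψ := by
  rw [interleave, List.flatMap_cons, h, List.nil_append]
  induction ts with
  | nil => rfl
  | cons a ts ih => simp [h, ih]

/-- If x has a nonempty image, neither side maps into a factor of the generating word: the left side
repeats some letter n + 1 times, and the right side repeats a letter twice if n = 1 and contains a
square if n > 1. -/
theorem entails_varD_delta {n : ℕ} (hn : 1 ≤ n) :
    Entails (varD.{u} n) (interleave (lettersTo n)) (0 :: 0 :: lettersTo n) := by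
  have hcn : (interleave (lettersTo n)).count 0 = n + 1 := by
    rw [count_zero_interleave (zero_notMem_lettersTo n), length_lettersTo]
  have hc2 : 2 ≤ (0 :: 0 :: lettersTo n).count 0 := by simp
  have hle : ∀ ψ : ℕ → List ℕ, ψ 0 = [] → (interleave (lettersTo n)).flatMap ψ
      = (0 :: 0 :: lettersTo n).flatMap ψ := by
    intro ψ h
    rw [flatMap_interleave_of_eq_nil h]
    simp [h]
  obtain ⟨n, rfl⟩ := Nat.exists_eq_add_of_le' hn
  rcases Nat.eq_zero_or_pos n with rfl | hn'
  · change Entails (varD 1) _ _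
    rw [varD_one]
    refine entails_S.2 fun ψ p q => ?_
    by_cases h : ψ 0 = []
    · rw [hle ψ h]
    · obtain ⟨l, hl⟩ := List.exists_mem_of_ne_nil _ h
      have hl1 : [0, 1].count l ≤ 1 := List.nodup_iff_count_le_one.1 (by decide) l
      refine iff_of_false (fun h1 => ?_) (fun h1 => ?_)
      · have := two_le_count_of_mem_image h1 hcn.ge hl
        omega
      · have := two_le_count_of_mem_image h1 hc2 hl
        omega
  · rw [varD_coe_succ hn']
    refine entails_S.2 fun ψ p q => ?_
    by_cases h : ψ 0 = []
    · rw [hle ψ h]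
    · obtain ⟨l, hl⟩ := List.exists_mem_of_ne_nil _ h
      have hl1 : (interleave (lettersTo n)).count l ≤ n + 1 := by
        by_cases hl0 : l = 0
        · rw [hl0, count_zero_interleave (zero_notMem_lettersTo n), length_lettersTo]
        · rw [count_interleave_of_ne hl0]
          have := List.nodup_iff_count_le_one.1 (lettersTo_nodup n) l
          omega
      refine iff_of_false (fun h1 => ?_) (fun h1 => ?_)
      · have := two_le_count_of_mem_image h1 hcn.ge hl
        omega
      · refine not_square_interleave (m := n) (p := p) (a := ψ 0)
          (q := (lettersTo (n + 1)).flatMap ψ ++ q) h ?_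
        rw [← h1]; simp

/-! #### The variety `N` -/

theorem le_varN_iff {V : MonoidVariety.{u}} : V ≤ varN ↔
    Entails V [0, 0] [0, 0, 0] ∧ Entails V [0, 0, 1] [1, 0, 0] ∧
    Entails V [0, 1, 0, 2, 0] [0, 0, 1, 2] ∧
    Entails V [0, 4, 1, 3, 0, 1] [0, 4, 1, 3, 1, 0] ∧
    Entails V [0, 4, 0, 1, 3, 1] [0, 4, 1, 0, 3, 1] := by
  rw [varN, le_ofIdentities_iff]
  simp only [Set.mem_insert_iff, Set.mem_singleton_iff, forall_eq_or_imp, forall_eq]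
  rfl

/-- A substitution with given values at the letters `0, 1, 2, 3, 4`. -/
def sub {A : Type u} [Monoid A] (a b d e f : A) : ℕ → A
  | 0 => a
  | 1 => b
  | 2 => d
  | 3 => e
  | 4 => f
  | _ => 1

theorem varN_laws {A : Type u} [Monoid A] (h : varN.{u}.Mem A) :
    (∀ a : A, a * a * a = a * a) ∧ (∀ a b : A, a * a * b = b * (a * a)) ∧
    (∀ a b d : A, a * b * a * d * a = a * a * b * d) ∧
    (∀ a b d e : A, a * d * b * e * a * b = a * d * b * e * b * a) ∧
    (∀ a b d e : A, a * d * a * b * e * b = a * d * b * a * e * b) := by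
  obtain ⟨h1, h2, h3, h4, h5⟩ := le_varN_iff.1 (le_refl varN.{u})
  refine ⟨fun a => ?_, fun a b => ?_, fun a b d => ?_, fun a b d e => ?_, fun a b d e => ?_⟩
  · simpa [sub, mul_assoc] using (h1 A h (sub a a a a a)).symm
  · simpa [sub, mul_assoc] using h2 A h (sub a b a a a)
  · simpa [sub, mul_assoc] using h3 A h (sub a b d a a)
  · simpa [sub, mul_assoc] using h4 A h (sub a b a e d)
  · simpa [sub, mul_assoc] using h5 A h (sub a b a e d)

theorem ev_interleave {A : Type u} [Monoid A] (φ : ℕ → A) (ts : List ℕ) :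
    ev φ (interleave ts) = φ 0 * ((ts.map φ).map (· * φ 0)).prod := by
  rw [interleave, ev_cons]
  congr 1
  induction ts with
  | nil => rfl
  | cons a ts ih => simp [ih, mul_assoc]

/-- Since n ≥ 2, there are three occurrences of x at the start, which xyxzx ≈ x²yz turns into a
central square; the square absorbs the rest. -/
theorem entails_varN_delta {n : ℕ} (hn : 2 ≤ n) :
    Entails varN.{u} (interleave (lettersTo n)) (0 :: 0 :: lettersTo n) := by
  intro A _ hA φ
  obtain ⟨h1, h2, h3, -⟩ := varN_laws hA
  have key : ∀ (a : A) (bs : List A), a * a * (bs.map (· * a)).prod = a * a * bs.prod := by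
    intro a bs
    induction bs with
    | nil => rfl
    | cons b bs ih =>
      rw [List.map_cons, List.prod_cons, List.prod_cons]
      calc a * a * (b * a * (bs.map (· * a)).prod)
          = (a * a * b) * (a * (bs.map (· * a)).prod) := by simp only [mul_assoc]
        _ = b * (a * a * a) * (bs.map (· * a)).prod := by rw [h2]; simp only [mul_assoc]
        _ = b * (a * a * (bs.map (· * a)).prod) := by rw [h1, mul_assoc]
        _ = a * a * (b * bs.prod) := by rw [ih, ← mul_assoc, ← h2]; simp only [mul_assoc]
  have key2 : ∀ (a : A) (bs : List A), 2 ≤ bs.length →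
      a * (bs.map (· * a)).prod = a * a * bs.prod := by
    intro a bs hb
    match bs, hb with
    | b :: d :: bs, _ =>
      calc a * ((b :: d :: bs).map (· * a)).prod
          = (a * b * a * d * a) * (bs.map (· * a)).prod := by simp [mul_assoc]
        _ = b * d * (a * a * (bs.map (· * a)).prod) := by
          rw [h3, mul_assoc (a * a), h2]; simp only [mul_assoc]
        _ = a * a * (b :: d :: bs).prod := by
          rw [key, ← mul_assoc, ← h2]; simp [mul_assoc]
  rw [ev_interleave, key2 _ _ (by simpa [length_lettersTo] using hn)]
  simp [ev, mul_assoc]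

/-! #### The basis of `D_∞ ∨ N` -/

theorem entails_varDN {u v : List ℕ} :
    Entails varDN.{u} u v ↔ Entails (varD.{u} ⊤) u v ∧ Entails varN.{u} u v := entails_sup

/-- The first seven laws are identities of both D_∞ and N. In D_∞ all adjacent occurrences of
letters that are not simple commute. In N the `thrice` laws hold because xyxzx ≈ x²yz makes a
central square of the thrice occurring letter on both sides. -/
theorem laws_of_le_varDN {V : MonoidVariety.{u}} {k : ℕ∞} {c : ℕ} (hV : V ≤ varDN)
    (hk : ∀ n : ℕ, k = n → Entails V (interleave (lettersTo n)) (0 :: 0 :: lettersTo n))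
    (h1 : c ≤ 1 → Entails V [0, 1, 2, 0, 1] [1, 0, 2, 0, 1])
    (h0 : c = 0 → Entails V [0, 1, 2, 0, 3, 1] [1, 0, 2, 0, 3, 1])
    {A : Type u} [Monoid A] (hA : V.Mem A) : Laws A k c := by
  have hDN : ∀ {u v : List ℕ}, Entails (varD.{u} ⊤) u v → Entails varN.{u} u v →
      ∀ φ : ℕ → A, ev φ u = ev φ v := fun hD hN =>
    entails_varDN.2 ⟨hD, hN⟩ A (hV A hA)
  have hsq := hDN entails_varD_top_sq (le_varN_iff.1 le_rfl).1
  have hcen := hDN entails_varD_top_central (le_varN_iff.1 le_rfl).2.1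
  have hll := hDN (entails_varD_top_swap (α := [0, 4, 1, 3]) (i := 0) (j := 1) (β := [])
    (by decide) (by decide)) (le_varN_iff.1 le_rfl).2.2.2.1
  have hlf := hDN (entails_varD_top_swap (α := [0, 4]) (i := 0) (j := 1) (β := [3, 1])
    (by decide) (by decide)) (le_varN_iff.1 le_rfl).2.2.2.2
  have ht1 := hDN (entails_varD_top_swap (α := []) (i := 0) (j := 1) (β := [2, 0, 3, 0, 4, 1])
    (by decide) (by decide)) (fun B _ hB φ => by
      obtain ⟨h1, h2, h3, -⟩ := varN_laws hB
      have e1 := congrArg (· * (φ 4 * φ 1)) (h3 (φ 0) (φ 1 * φ 2) (φ 3))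
      have e2 := congrArg (φ 1 * · * (φ 4 * φ 1)) (h3 (φ 0) (φ 2) (φ 3))
      have e3 := congrArg (· * (φ 2 * φ 3 * φ 4 * φ 1)) (h2 (φ 0) (φ 1))
      simp only [mul_assoc] at e1 e2 e3
      simp [e1, e2, e3])
  have ht2 := hDN (entails_varD_top_swap (α := []) (i := 0) (j := 1) (β := [2, 0, 3, 1, 4, 0])
    (by decide) (by decide)) (fun B _ hB φ => by
      obtain ⟨h1, h2, h3, -⟩ := varN_laws hB
      have e1 := h3 (φ 0) (φ 1 * φ 2) (φ 3 * φ 1 * φ 4)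
      have e2 := congrArg (φ 1 * ·) (h3 (φ 0) (φ 2) (φ 3 * φ 1 * φ 4))
      have e3 := congrArg (· * (φ 2 * φ 3 * φ 1 * φ 4)) (h2 (φ 0) (φ 1))
      simp only [mul_assoc] at e1 e2 e3
      simp [e1, e2, e3])
  have ht3 := hDN (entails_varD_top_swap (α := []) (i := 0) (j := 1) (β := [2, 1, 3, 0, 4, 0])
    (by decide) (by decide)) (fun B _ hB φ => by
      obtain ⟨h1, h2, h3, -⟩ := varN_laws hB
      have e1 := h3 (φ 0) (φ 1 * φ 2 * φ 1 * φ 3) (φ 4)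
      have e2 := congrArg (φ 1 * ·) (h3 (φ 0) (φ 2 * φ 1 * φ 3) (φ 4))
      have e3 := congrArg (· * (φ 2 * φ 1 * φ 3 * φ 4)) (h2 (φ 0) (φ 1))
      simp only [mul_assoc] at e1 e2 e3
      simp [e1, e2, e3])
  refine ⟨fun a => ?_, fun a b => ?_, fun a b d e => ?_, fun a b d e => ?_, fun a b d e f => ?_,
    fun a b d e f => ?_, fun a b d e f => ?_, fun n hn a bs hbs => ?_, fun hc a b d => ?_,
    fun hc a b d e => ?_⟩
  · simpa [sub, mul_assoc] using (hsq (sub a a a a a)).symm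
  · simpa [sub, mul_assoc] using hcen (sub a b a a a)
  · simpa [sub, mul_assoc] using hlf (sub a b a e d)
  · simpa [sub, mul_assoc] using hll (sub a b a e d)
  · simpa [sub, mul_assoc] using ht1 (sub a b d e f)
  · simpa [sub, mul_assoc] using ht2 (sub a b d e f)
  · simpa [sub, mul_assoc] using ht3 (sub a b d e f)
  -- Letter i with 1 ≤ i ≤ n takes the value of index i - 1 in the list; x, which is letter 0, falls
  -- under the default value a.
  · have := hk n hn A hA fun i => if h : 1 ≤ i ∧ i - 1 < bs.length then bs[i - 1] else a
    rw [ev_interleave] at this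
    have hm : (lettersTo n).map (fun i => if h : 1 ≤ i ∧ i - 1 < bs.length then bs[i - 1] else a)
        = bs := by
      apply List.ext_getElem
      · simp [length_lettersTo, hbs]
      · intro i h1 h2
        simp [lettersTo, h2]
    rw [hm] at this
    rw [ev_cons, ev_cons, ev, hm, ← mul_assoc] at this
    simpa using this
  · simpa [sub, mul_assoc] using h1 hc A hA (sub a b d a a)
  · simpa [sub, mul_assoc] using h0 hc A hA (sub a b d e a)

/-- Words that agree form an identity of a subvariety of `D_∞ ∨ N` with the corresponding
identities. -/
theorem Agree.entails {V : MonoidVariety.{u}} {k : ℕ∞} {c : ℕ} (hV : V ≤ varDN) (hk1 : 1 ≤ k)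
    (hk : ∀ n : ℕ, k = n → Entails V (interleave (lettersTo n)) (0 :: 0 :: lettersTo n))
    (h1 : c ≤ 1 → Entails V [0, 1, 2, 0, 1] [1, 0, 2, 0, 1])
    (h0 : c = 0 → Entails V [0, 1, 2, 0, 3, 1] [1, 0, 2, 0, 3, 1])
    {u v : List ℕ} (h : Agree k c u v) : Entails V u v :=
  fun _ _ hA φ => (laws_of_le_varDN hV hk h1 h0 hA).ev_eq_of_agree hk1 φ h


/-! ### Invariants from isoterms -/

theorem countBefore_self (x : ℕ) (u : List ℕ) : countBefore x x u = 0 := by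
  induction u with
  | nil => rfl
  | cons a u ih => simp only [countBefore_cons]; grind

theorem countBefore_pos_of_pos_of_eq_zero {x y s : ℕ} {u : List ℕ} (h : 0 < countBefore x s u)
    (h0 : countBefore y s u = 0) : 0 < countBefore x y u := by
  induction u with
  | nil => simp [countBefore_nil] at h
  | cons a u ih =>
    simp only [countBefore_cons] at h h0 ⊢
    grind

/-- The partial substitution that replaces the letters of the list `ls` by their positions in
`ls` and deletes all other letters. -/
def position (ls : List ℕ) (l : ℕ) : Option ℕ := if l ∈ ls then some (ls.idxOf l) else none

theorem position_eq_some_iff {ls : List ℕ} (hn : ls.Nodup) {i : ℕ} (hi : i < ls.length) (l : ℕ) :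
    position ls l = some i ↔ l = ls[i] := by
  unfold position
  constructor
  · intro h
    split_ifs at h with hl
    simp only [Option.some.injEq] at h
    subst h
    simp
  · rintro rfl
    rw [if_pos (List.getElem_mem hi), hn.idxOf_getElem]

theorem count_position {ls : List ℕ} (hn : ls.Nodup) {i : ℕ} (hi : i < ls.length) (u : List ℕ) :
    (u.filterMap (position ls)).count i = u.count ls[i] :=
  count_filterMap_of_iff _ (position_eq_some_iff hn hi) u

theorem lt_of_mem_position {ls u : List ℕ} {i : ℕ} (h : i ∈ u.filterMap (position ls)) :
    i < ls.length := by
  obtain ⟨l, _, hl⟩ := List.mem_filterMap.1 h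
  unfold position at hl
  split_ifs at hl with h
  simp only [Option.some.injEq] at hl
  rw [← hl]
  exact List.idxOf_lt_length_of_mem h

theorem count_position_of_le {ls : List ℕ} {i : ℕ} (hi : ls.length ≤ i) (u : List ℕ) :
    (u.filterMap (position ls)).count i = 0 :=
  List.count_eq_zero.2 fun h => absurd (lt_of_mem_position h) (not_lt.2 hi)

theorem countBefore_position {ls : List ℕ} (hn : ls.Nodup) {i j : ℕ} (hi : i < ls.length)
    (hj : j < ls.length) (u : List ℕ) :
    countBefore i j (u.filterMap (position ls)) = countBefore ls[i] ls[j] u :=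
  countBefore_filterMap_of_iff _ (position_eq_some_iff hn hi) (position_eq_some_iff hn hj) u

/-- A word with only one letter that is not simple is recognized as a projection of `u`. -/
theorem position_eq {ls : List ℕ} (hn : ls.Nodup) {u W : List ℕ}
    (hW : ∀ l ∈ W, l < ls.length) (hc : ∀ i (hi : i < ls.length), u.count ls[i] = W.count i)
    (hs : ∀ i, i ≠ 0 → i < ls.length → W.count i = 1)
    (hb : ∀ i j (hi : i < ls.length) (hj : j < ls.length), j ≠ 0 →
      countBefore ls[i] ls[j] u = countBefore i j W) : u.filterMap (position ls) = W := by
  have hc' : ∀ i, (u.filterMap (position ls)).count i = W.count i := by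
    intro i
    by_cases hi : i < ls.length
    · rw [count_position hn hi, hc i hi]
    · rw [count_position_of_le (not_lt.1 hi), List.count_eq_zero.2 fun h => hi (hW i h)]
  refine eq_of_count_eq 0 hc' (fun t ht h0 => ?_) (fun t ht h0 y => ?_)
  · rw [hc']; exact hs t h0 (lt_of_mem_position ht)
  · have htl := lt_of_mem_position ht
    by_cases hy : y < ls.length
    · rw [countBefore_position hn hy htl, hb y t hy htl h0]
    · rw [countBefore_eq_zero_of_notMem t fun h => hy (lt_of_mem_position h),
        countBefore_eq_zero_of_notMem t fun h => hy (hW y h)]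

/-- A projection of `w` agrees with a given word. -/
theorem agree_position {ls : List ℕ} (hn : ls.Nodup) {w W : List ℕ}
    (hW : ∀ l ∈ W, l < ls.length) (hc : ∀ i (hi : i < ls.length), w.count ls[i] = W.count i)
    (hb : ∀ i j (hi : i < ls.length) (hj : j < ls.length), W.count j = 1 →
      countBefore ls[i] ls[j] w = countBefore i j W)
    (ho : ∀ i j (hi : i < ls.length) (hj : j < ls.length), W.count i = 2 → W.count j = 2 →
      (0 < countBefore ls[i] ls[j] w ↔ 0 < countBefore i j W)) :
    Agree ⊤ 2 (w.filterMap (position ls)) W := by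
  have hc' : ∀ i, (w.filterMap (position ls)).count i = W.count i := by
    intro i
    by_cases hi : i < ls.length
    · rw [count_position hn hi, hc i hi]
    · rw [count_position_of_le (not_lt.1 hi), List.count_eq_zero.2 fun h => hi (hW i h)]
  have hlt : ∀ {i n}, (w.filterMap (position ls)).count i = n → 0 < n → i < ls.length := by
    intro i n h h0
    exact lt_of_mem_position (List.count_pos_iff.1 (h ▸ h0))
  refine ⟨sameShape_of_count_eq ⊤ hc' fun x t ht => ?_, fun x y _ _ hx hy _ => ?_⟩
  · have htl := hlt ht one_pos
    by_cases hy : x < ls.length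
    · rw [countBefore_position hn hy htl, hb x t hy htl (by rw [← hc']; exact ht)]
    · rw [countBefore_eq_zero_of_notMem t fun h => hy (lt_of_mem_position h),
        countBefore_eq_zero_of_notMem t fun h => hy (hW x h)]
  · have hxl := hlt hx two_pos
    have hyl := hlt hy two_pos
    rw [countBefore_position hn hxl hyl]
    exact ho x y hxl hyl (by rw [← hc']; exact hx) (by rw [← hc']; exact hy)

theorem count_simple_interleave {m i : ℕ} (h1 : 1 ≤ i) (h2 : i ≤ m) :
    (interleave (lettersTo m)).count i = 1 := by
  rw [count_interleave_of_ne (by omega)]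
  exact List.count_eq_one_of_mem (lettersTo_nodup m) (mem_lettersTo.2 ⟨h1, h2⟩)

theorem mem_interleave_lettersTo {m l : ℕ} : l ∈ interleave (lettersTo m) ↔ l ≤ m := by
  by_cases h : l = 0
  · simp [h, interleave]
  · rw [← List.count_pos_iff, count_interleave_of_ne h, List.count_pos_iff, mem_lettersTo]
    omega

theorem countBefore_interleave {m i j : ℕ} (h1 : 1 ≤ i) (h2 : i ≤ m) :
    countBefore j i (interleave (lettersTo m)) = if j = 0 then i else if j < i then 1 else 0 := by
  induction m with
  | zero => omega
  | succ m ih =>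
    rw [interleave_lettersTo_succ, countBefore_append]
    by_cases him : i ≤ m
    · rw [if_pos (mem_interleave_lettersTo.2 him), ih him]
    · obtain rfl : i = m + 1 := by omega
      rw [if_neg (by rw [mem_interleave_lettersTo]; omega)]
      simp only [countBefore_cons, if_true, add_zero]
      by_cases hj : j = 0
      · simp [hj, count_zero_interleave (zero_notMem_lettersTo m), length_lettersTo]
      · rw [if_neg hj]
        by_cases hjm : j ≤ m
        · rw [count_simple_interleave (by omega) hjm, if_pos (by omega)]
        · rw [List.count_eq_zero.2 (by rw [mem_interleave_lettersTo]; omega), if_neg (by omega)]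

/-! ### What an identity must preserve when certain words are isoterms -/

section sound
variable {V : MonoidVariety.{u}} {u v : List ℕ}

theorem Entails.count_eq_one (h0 : Isoterm V [0]) (h : Entails V u v) {l : ℕ}
    (hl : u.count l = 1) : v.count l = 1 := by
  have e : u.filterMap (position [l]) = [0] :=
    position_eq (by simp) (by simp) (by simpa using hl)
      (fun i h h' => absurd (Nat.lt_one_iff.1 h') h) (by simp)
  have := h.filterMap (position [l])
  rw [e] at this
  have := h0 _ this
  have h2 := count_position (ls := [l]) (by simp) (i := 0) (by simp) v
  rw [this] at h2
  exact h2.symm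

/-- If l were missing from u, projecting to l would give 1 ≈ xⁿ with n > 0. Then x ≈ x·xⁿ
contradicts the isoterm x. -/
theorem Entails.mem_of_mem (h0 : Isoterm V [0]) (h : Entails V u v) {l : ℕ}
    (hl : l ∈ v) : l ∈ u := by
  by_contra hu
  have e : u.filterMap (position [l]) = [] := by
    refine List.filterMap_eq_nil_iff.2 fun a ha => ?_
    have : a ≠ l := by rintro rfl; exact hu ha
    simp [position, this]
  have := h.filterMap (position [l])
  rw [e] at this
  have := h0 _ ((Entails.refl V [0]).append this)
  simp only [List.cons_append, List.nil_append, List.cons.injEq, true_and] at this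
  have h2 := count_position (ls := [l]) (by simp) (i := 0) (by simp) v
  rw [this] at h2
  have := List.count_pos_iff.2 hl
  simp at h2
  omega

theorem Isoterm.left (h01 : Isoterm V [0, 1]) : Isoterm V [0] :=
  Isoterm.of_append (p := []) (q := [1]) h01

theorem Entails.before_pos (h01 : Isoterm V [0, 1]) (h : Entails V u v) {s t : ℕ}
    (hs : u.count s = 1) (ht : u.count t = 1) (hst : 0 < countBefore s t u) :
    countBefore s t u = 1 ∧ countBefore s t v = 1 := by
  have hne : s ≠ t := by rintro rfl; rw [countBefore_self] at hst; omega
  have h1 : countBefore s t u = 1 := by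
    have := countBefore_le_count s t u
    omega
  have hn : [s, t].Nodup := by simp [hne]
  have e : u.filterMap (position [s, t]) = [0, 1] := by
    refine position_eq hn (by simp) ?_ ?_ ?_
    · intro i hi
      have : i < 2 := hi
      interval_cases i
      · exact hs
      · exact ht
    · intro i h0 hi
      have : i < 2 := hi
      interval_cases i
      · omega
      · rfl
    · intro i j hi hj h0
      have : i < 2 := hi
      have : j < 2 := hj
      interval_cases j
      · omega
      interval_cases i
      · exact h1
      · exact countBefore_self t u
  have := h.filterMap (position [s, t])
  rw [e] at this
  have h3 := countBefore_position hn (i := 0) (j := 1) (by simp) (by simp) v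
  rw [h01 _ this] at h3
  exact ⟨h1, h3.symm⟩

theorem Entails.before_simple (h01 : Isoterm V [0, 1]) (h : Entails V u v) {s t : ℕ}
    (hs : u.count s = 1) (ht : u.count t = 1) : countBefore s t u = countBefore s t v := by
  by_cases hst : s = t
  · rw [hst, countBefore_self, countBefore_self]
  · rcases countBefore_pos_or hst (List.count_pos_iff.1 (by omega : 0 < u.count s)) with h1 | h1
    · obtain ⟨h2, h3⟩ := h.before_pos h01 hs ht h1
      rw [h2, h3]
    · obtain ⟨_, h3⟩ := h.before_pos h01 ht hs h1
      rw [countBefore_eq_zero_of_pos h1, countBefore_eq_zero_of_pos (by omega)]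

/-- The number of occurrences of x passed so far grows along u, so the separators stand in the order
of their indices. The projection to x and the separators is therefore the isoterm, and v has the
same projection. -/
theorem Entails.of_separators {m : ℕ} (hm : Isoterm V (interleave (lettersTo m)))
    (h : Entails V u v) {x : ℕ} (hx : u.count x = m + 1) (τ : ℕ → ℕ)
    (hτ : ∀ i < m, u.count (τ i) = 1 ∧ countBefore x (τ i) u = i + 1) :
    v.count x = m + 1 ∧ ∀ i < m, countBefore x (τ i) v = i + 1 := by
  set ls := x :: (List.range m).map τ with hls
  have hlen : ls.length = m + 1 := by simp [hls]
  have hn : ls.Nodup := by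
    rw [hls, List.nodup_cons]
    constructor
    · intro hmem
      obtain ⟨i, hi, hix⟩ := List.mem_map.1 hmem
      have := (hτ i (List.mem_range.1 hi)).2
      rw [hix, countBefore_self] at this
      omega
    · refine List.Nodup.map_on (fun i hi j hj hij => ?_) List.nodup_range
      have h1 := (hτ i (List.mem_range.1 hi)).2
      have h2 := (hτ j (List.mem_range.1 hj)).2
      rw [hij] at h1
      omega
  have hget0 : ∀ h : 0 < ls.length, ls[0] = x := fun _ => rfl
  have hgets : ∀ i (h : i + 1 < ls.length), ls[i + 1] = τ i := fun i h => by
    simp [hls]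
  have e : u.filterMap (position ls) = interleave (lettersTo m) := by
    refine position_eq hn (fun l hl => ?_) (fun i hi => ?_) (fun i h0 hi => ?_)
      (fun i j hi hj h0 => ?_)
    · rw [mem_interleave_lettersTo] at hl; omega
    · cases i with
      | zero =>
        rw [hget0, hx, count_zero_interleave (zero_notMem_lettersTo m), length_lettersTo]
      | succ i =>
        rw [hgets, (hτ i (by omega)).1, count_simple_interleave (by omega) (by omega)]
    · exact count_simple_interleave (by omega) (by omega)
    · rw [countBefore_interleave (by omega) (by omega)]
      obtain ⟨j, rfl⟩ := Nat.exists_eq_succ_of_ne_zero h0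
      have hj' := hτ j (by omega)
      simp only [Nat.succ_eq_add_one, hgets] at hj' ⊢
      cases i with
      | zero => rw [hget0, hj'.2]; simp
      | succ i =>
        have hi' := hτ i (by omega)
        rw [hgets, if_neg (by omega)]
        rcases lt_trichotomy i j with hij | rfl | hij
        · rw [if_pos (by omega)]
          have h1 := countBefore_pos_of_lt (x := x) (s := τ i) (t := τ j) (u := u) (by omega)
          have h2 := countBefore_le_count (τ i) (τ j) u
          omega
        · rw [if_neg (by omega), countBefore_self]
        · rw [if_neg (by omega)]
          exact countBefore_eq_zero_of_pos
            (countBefore_pos_of_lt (x := x) (s := τ j) (t := τ i) (u := u) (by omega))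
  have := h.filterMap (position ls)
  rw [e] at this
  have hv := hm _ this
  constructor
  · rw [← hget0 (by omega), ← count_position hn (i := 0) (by omega), hv,
      count_zero_interleave (zero_notMem_lettersTo m), length_lettersTo]
  · intro i hi
    rw [← hgets i (by omega)]
    have := countBefore_position hn (i := 0) (j := i + 1) (by omega) (by omega) v
    rw [hv, countBefore_interleave (by omega) (by omega)] at this
    exact this.symm

theorem Entails.limited {k : ℕ∞}
    (hk : ∀ j : ℕ, (j : ℕ∞) < k → Isoterm V (interleave (lettersTo j))) (h : Entails V u v)
    {x : ℕ} (hx : Limited k x u) (hpos : 0 < u.count x) :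
    v.count x = u.count x ∧ ∀ t, u.count t = 1 → 1 ≤ countBefore x t u →
      countBefore x t u < u.count x → countBefore x t v = countBefore x t u := by
  obtain ⟨m, hm⟩ := Nat.exists_eq_succ_of_ne_zero (Nat.ne_of_gt hpos)
  have hmk : Isoterm V (interleave (lettersTo m)) := by
    refine hk m (lt_of_lt_of_le ?_ hx.1)
    rw [hm]; exact_mod_cast Nat.lt_succ_self m
  have : ∀ i, ∃ t, i < m → u.count t = 1 ∧ countBefore x t u = i + 1 := by
    intro i
    by_cases hi : i < m
    · obtain ⟨t, ht⟩ := hx.2 (i + 1) (by omega) (by omega)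
      exact ⟨t, fun _ => ht⟩
    · exact ⟨0, fun h => absurd h hi⟩
  choose τ hτ using this
  refine ⟨(h.of_separators hmk hm τ hτ).1.trans hm.symm, fun t ht h1 h2 => ?_⟩
  -- Any simple letter t inside a gap may replace the chosen separator of that gap. The index is
  -- shifted by one because τ starts at 0.
  have := (h.of_separators hmk hm (Function.update τ (countBefore x t u - 1) t) ?_).2
    (countBefore x t u - 1) (by omega)
  · rw [Function.update_self] at this
    omega
  · intro i hi
    by_cases hit : i = countBefore x t u - 1
    · rw [hit, Function.update_self]
      exact ⟨ht, by omega⟩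
    · rw [Function.update_of_ne hit]
      exact hτ i hi

/-- The identities of a variety that contains `D_k` respect the positions of limited letters. -/
theorem Entails.sameShape {k : ℕ∞} (h01 : Isoterm V [0, 1])
    (hk : ∀ j : ℕ, (j : ℕ∞) < k → Isoterm V (interleave (lettersTo j))) (h : Entails V u v) :
    SameShape k u v := by
  have h0 := h01.left
  have hmem : ∀ x, x ∈ u ↔ x ∈ v := fun x => ⟨h.symm.mem_of_mem h0, h.mem_of_mem h0⟩
  have hsim : ∀ x, u.count x = 1 ↔ v.count x = 1 := fun x =>
    ⟨h.count_eq_one h0, h.symm.count_eq_one h0⟩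
  have hcount : ∀ {u v : List ℕ}, Entails V u v → ∀ x, Limited k x u → u.count x = v.count x := by
    intro u v h x hx
    rcases Nat.eq_zero_or_pos (u.count x) with hc | hc
    · rw [hc, eq_comm, List.count_eq_zero]
      exact fun hv => List.count_eq_zero.1 hc (h.mem_of_mem h0 hv)
    · exact (h.limited hk hx hc).1.symm
  have hlim : ∀ {u v : List ℕ}, Entails V u v → ∀ x, Limited k x u → Limited k x v := by
    intro u v h x hx
    have hc := hcount h x hx
    refine ⟨hc ▸ hx.1, fun i h1 h2 => ?_⟩
    rw [← hc] at h2
    obtain ⟨t, ht, hti⟩ := hx.2 i h1 h2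
    refine ⟨t, h.count_eq_one h0 ht, ?_⟩
    rw [(h.limited hk hx (by omega)).2 t ht (by omega) (by omega), hti]
  refine ⟨hmem, hsim, fun x => ⟨hlim h x, hlim h.symm x⟩, hcount h, fun x t hx ht => ?_⟩
  have htv := (hsim t).1 ht
  have hc := hcount h x hx
  have hxv := hlim h x hx
  rcases Nat.lt_or_ge (u.count x) 2 with h2 | h2
  · rcases Nat.lt_or_ge (u.count x) 1 with h1 | h1
    · rw [countBefore_eq_zero_of_notMem, countBefore_eq_zero_of_notMem] <;>
        rw [← List.count_eq_zero] <;> omega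
    · exact h.before_simple h01 (by omega) ht
  · have hu := (h.limited hk hx (by omega)).2
    have hv := (h.symm.limited hk hxv (by omega)).2
    have hle := countBefore_le_count x t u
    have hle' := countBefore_le_count x t v
    by_cases hu1 : 1 ≤ countBefore x t u ∧ countBefore x t u < u.count x
    · exact (hu t ht hu1.1 hu1.2).symm
    by_cases hv1 : 1 ≤ countBefore x t v ∧ countBefore x t v < v.count x
    · exact hv t htv hv1.1 hv1.2
    -- What remains is that t stands before all or after all occurrences of x in each word. A
    -- separator r of the first two occurrences tells these cases apart, and the order of the simple
    -- letters t and r is preserved.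
    obtain ⟨r, hr, hr1⟩ := hx.2 1 le_rfl (by omega)
    have hrv := hu r hr (by omega) (by omega)
    have htr := h.before_simple h01 ht hr
    have hrt := h.before_simple h01 hr ht
    by_contra hne
    rcases Nat.lt_or_ge (countBefore x t u) 1 with hlt | hge
    · have h3 := countBefore_pos_of_lt (x := x) (s := t) (t := r) (u := u) (by omega)
      have h4 := countBefore_pos_of_lt (x := x) (s := r) (t := t) (u := v) (by omega)
      have := countBefore_eq_zero_of_pos h4
      omega
    · have h3 := countBefore_pos_of_lt (x := x) (s := r) (t := t) (u := u) (by omega)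
      have h4 := countBefore_pos_of_lt (x := x) (s := t) (t := r) (u := v) (by omega)
      have := countBefore_eq_zero_of_pos h4
      omega

theorem Entails.of_agree_top (hV : V ≤ varDN) (h : Agree ⊤ 2 u v) : Entails V u v :=
  h.entails hV le_top (by simp) (by omega) (by omega)

/-- Projection to x, y, s. The order of the second occurrences is not known, but `Agree` ignores it
and agreeing words are already equal in D_∞ ∨ N. -/
theorem Entails.first_block (hV : V ≤ varDN) (h : Entails V u v) {x y s : ℕ}
    (hd : ∀ w, w = u ∨ w = v → w.count x = 2 ∧ w.count y = 2 ∧ w.count s = 1 ∧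
      countBefore x s w = 1 ∧ countBefore y s w = 1)
    (hu : 0 < countBefore x y u) (hv : 0 < countBefore y x v) :
    Entails V [0, 1, 2, 0, 1] [1, 0, 2, 0, 1] := by
  have hxy : x ≠ y := by rintro rfl; rw [countBefore_self] at hu; omega
  have hxs : x ≠ s := by
    rintro rfl; obtain ⟨h1, _, h2, _⟩ := hd u (Or.inl rfl); omega
  have hys : y ≠ s := by
    rintro rfl; obtain ⟨_, h1, h2, _⟩ := hd u (Or.inl rfl); omega
  have hn : [x, y, s].Nodup := by simp [hxy, hxs, hys]
  have h1 : Agree ⊤ 2 (u.filterMap (position [x, y, s])) [0, 1, 2, 0, 1] := by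
    obtain ⟨d1, d2, d3, d4, d5⟩ := hd u (Or.inl rfl)
    refine agree_position hn (by simp) ?_ ?_ ?_
    · intro i hi
      have : i < 3 := hi
      interval_cases i <;> simp [d1, d2, d3]
    · intro i j hi hj hc
      have : i < 3 := hi
      have : j < 3 := hj
      interval_cases j <;> interval_cases i <;>
        simp [d4, d5, countBefore_self, countBefore_cons] at hc ⊢
    · intro i j hi hj hc hc'
      have : i < 3 := hi
      have : j < 3 := hj
      interval_cases j <;> interval_cases i <;>
        simp [hu, countBefore_eq_zero_of_pos hu, countBefore_self, countBefore_cons] at hc hc' ⊢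
  have h2 : Agree ⊤ 2 (v.filterMap (position [x, y, s])) [1, 0, 2, 0, 1] := by
    obtain ⟨d1, d2, d3, d4, d5⟩ := hd v (Or.inr rfl)
    refine agree_position hn (by simp) ?_ ?_ ?_
    · intro i hi
      have : i < 3 := hi
      interval_cases i <;> simp [d1, d2, d3]
    · intro i j hi hj hc
      have : i < 3 := hi
      have : j < 3 := hj
      interval_cases j <;> interval_cases i <;>
        simp [d4, d5, countBefore_self, countBefore_cons] at hc ⊢
    · intro i j hi hj hc hc'
      have : i < 3 := hi
      have : j < 3 := hj
      interval_cases j <;> interval_cases i <;>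
        simp [hv, countBefore_eq_zero_of_pos hv, countBefore_self, countBefore_cons] at hc hc' ⊢
  exact ((Entails.of_agree_top hV h1).symm.trans (h.filterMap _)).trans
    (Entails.of_agree_top hV h2)

/-- The same with a further simple letter t between the last occurrences of x and y. -/
theorem Entails.first_first (hV : V ≤ varDN) (h : Entails V u v) {x y s t : ℕ}
    (hd : ∀ w, w = u ∨ w = v → w.count x = 2 ∧ w.count y = 2 ∧ w.count s = 1 ∧ w.count t = 1 ∧
      countBefore x s w = 1 ∧ countBefore y s w = 1 ∧ countBefore x t w = 2 ∧
      countBefore y t w = 1)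
    (hu : 0 < countBefore x y u) (hv : 0 < countBefore y x v) :
    Entails V [0, 1, 2, 0, 3, 1] [1, 0, 2, 0, 3, 1] := by
  have hxy : x ≠ y := by rintro rfl; rw [countBefore_self] at hu; omega
  have hst : s ≠ t := by
    rintro rfl; obtain ⟨_, _, _, _, h1, _, h2, _⟩ := hd u (Or.inl rfl); omega
  have hxs : x ≠ s ∧ x ≠ t := by
    obtain ⟨h1, _, h2, h3, _⟩ := hd u (Or.inl rfl)
    constructor <;> rintro rfl <;> omega
  have hys : y ≠ s ∧ y ≠ t := by
    obtain ⟨_, h1, h2, h3, _⟩ := hd u (Or.inl rfl)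
    constructor <;> rintro rfl <;> omega
  have hn : [x, y, s, t].Nodup := by simp [hxy, hxs, hys, hst]
  have hst' : ∀ w, w = u ∨ w = v → countBefore s t w = 1 ∧ countBefore t s w = 0 := by
    intro w hw
    obtain ⟨_, _, h1, _, h2, _, h3, _⟩ := hd w hw
    have := countBefore_pos_of_lt (x := x) (s := s) (t := t) (u := w) (by omega)
    have h5 := countBefore_le_count s t w
    exact ⟨by omega, countBefore_eq_zero_of_pos this⟩
  have h1 : Agree ⊤ 2 (u.filterMap (position [x, y, s, t])) [0, 1, 2, 0, 3, 1] := by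
    obtain ⟨d1, d2, d3, d4, d5, d6, d7, d8⟩ := hd u (Or.inl rfl)
    obtain ⟨e1, e2⟩ := hst' u (Or.inl rfl)
    refine agree_position hn (by simp) ?_ ?_ ?_
    · intro i hi
      have : i < 4 := hi
      interval_cases i <;> simp [d1, d2, d3, d4]
    · intro i j hi hj hc
      have : i < 4 := hi
      have : j < 4 := hj
      interval_cases j <;> interval_cases i <;>
        simp [d5, d6, d7, d8, e1, e2, countBefore_self, countBefore_cons] at hc ⊢
    · intro i j hi hj hc hc'
      have : i < 4 := hi
      have : j < 4 := hj
      interval_cases j <;> interval_cases i <;>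
        simp [hu, countBefore_eq_zero_of_pos hu, countBefore_self, countBefore_cons] at hc hc' ⊢
  have h2 : Agree ⊤ 2 (v.filterMap (position [x, y, s, t])) [1, 0, 2, 0, 3, 1] := by
    obtain ⟨d1, d2, d3, d4, d5, d6, d7, d8⟩ := hd v (Or.inr rfl)
    obtain ⟨e1, e2⟩ := hst' v (Or.inr rfl)
    refine agree_position hn (by simp) ?_ ?_ ?_
    · intro i hi
      have : i < 4 := hi
      interval_cases i <;> simp [d1, d2, d3, d4]
    · intro i j hi hj hc
      have : i < 4 := hi
      have : j < 4 := hj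
      interval_cases j <;> interval_cases i <;>
        simp [d5, d6, d7, d8, e1, e2, countBefore_self, countBefore_cons] at hc ⊢
    · intro i j hi hj hc hc'
      have : i < 4 := hi
      have : j < 4 := hj
      interval_cases j <;> interval_cases i <;>
        simp [hv, countBefore_eq_zero_of_pos hv, countBefore_self, countBefore_cons] at hc hc' ⊢
  exact ((Entails.of_agree_top hV h1).symm.trans (h.filterMap _)).trans
    (Entails.of_agree_top hV h2)

end sound


/-! ### The order of first occurrences of letters occurring twice -/

section order
variable {V : MonoidVariety.{u}} {u v : List ℕ}

theorem Limited.exists_separator {k : ℕ∞} {x : ℕ} {u : List ℕ} (hx : Limited k x u)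
    (h2 : u.count x = 2) : ∃ s, u.count s = 1 ∧ countBefore x s u = 1 :=
  hx.2 1 le_rfl (by omega)

/-- The identities of a subvariety of `D_∞ ∨ N` respect the order of first occurrences. -/
theorem Entails.agree {k : ℕ∞} {c : ℕ} (hV : V ≤ varDN) (hs : SameShape k u v)
    (hc1 : 1 ≤ c → ¬ Entails V [0, 1, 2, 0, 3, 1] [1, 0, 2, 0, 3, 1])
    (hc2 : 2 ≤ c → ¬ Entails V [0, 1, 2, 0, 1] [1, 0, 2, 0, 1])
    (h : Entails V u v) : Agree k c u v := by
  -- opposite orders of first occurrences are impossible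
  have key : ∀ {u v : List ℕ}, Entails V u v → SameShape k u v → ∀ x y, Limited k x u →
      Limited k y u → u.count x = 2 → u.count y = 2 → Separated c x y u →
      0 < countBefore x y u → 0 < countBefore y x v → False := by
    intro u v h hs x y hx hy hx2 hy2 hsep hu hv
    have dx : ∀ w, w = u ∨ w = v → w.count x = 2 := by
      rintro w (rfl | rfl)
      · exact hx2
      · rw [← hs.count_eq x hx, hx2]
    have dy : ∀ w, w = u ∨ w = v → w.count y = 2 := by
      rintro w (rfl | rfl)
      · exact hy2
      · rw [← hs.count_eq y hy, hy2]
    have d1 : ∀ s, u.count s = 1 → ∀ w, w = u ∨ w = v → w.count s = 1 := by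
      rintro s hs1 w (rfl | rfl)
      · exact hs1
      · exact (hs.simple_iff s).1 hs1
    have bx : ∀ s, u.count s = 1 → ∀ w, w = u ∨ w = v → countBefore x s w = countBefore x s u := by
      rintro s hs1 w (rfl | rfl)
      · rfl
      · exact (hs.before_eq x s hx hs1).symm
    have byy : ∀ s, u.count s = 1 → ∀ w, w = u ∨ w = v → countBefore y s w = countBefore y s u := by
      rintro s hs1 w (rfl | rfl)
      · rfl
      · exact (hs.before_eq y s hy hs1).symm
    have hu0 := countBefore_eq_zero_of_pos hu
    have hv0 := countBefore_eq_zero_of_pos hv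
    -- no simple letter separates the first occurrences
    have nox : ∀ s, u.count s = 1 → 0 < countBefore x s u → 0 < countBefore y s u := by
      intro s hs1 hp
      by_contra h0
      have := countBefore_pos_of_pos_of_eq_zero (u := v) (x := x) (y := y) (s := s)
        (by rw [bx s hs1 v (Or.inr rfl)]; exact hp) (by rw [byy s hs1 v (Or.inr rfl)]; omega)
      omega
    have noy : ∀ s, u.count s = 1 → 0 < countBefore y s u → 0 < countBefore x s u := by
      intro s hs1 hp
      by_contra h0
      have := countBefore_pos_of_pos_of_eq_zero (u := u) (x := y) (y := x) (s := s) hp (by omega)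
      omega
    have hlt : ∀ {a s t}, countBefore a s u < countBefore a t u → ∀ b,
        countBefore b s u ≤ countBefore b t u := fun h b =>
      countBefore_le_of_eq_zero b (countBefore_eq_zero_of_pos (countBefore_pos_of_lt h))
    obtain ⟨s, hs1, hxs⟩ := hx.exists_separator hx2
    obtain ⟨t, ht1, hyt⟩ := hy.exists_separator hy2
    have hys := nox s hs1 (by omega)
    have hxt := noy t ht1 (by omega)
    have lex : ∀ r, countBefore x r u ≤ 2 := fun r => hx2 ▸ countBefore_le_count x r u
    have ley : ∀ r, countBefore y r u ≤ 2 := fun r => hy2 ▸ countBefore_le_count y r u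
    have lxs := lex t
    have lys := ley s
    match c, hsep, hc1, hc2 with
    -- The letter r separates the last occurrences. The letter with both occurrences before r has
    -- its own separator before r, with exactly one occurrence of each of x and y before it; so the
    -- pattern xyzxty arises, possibly with x and y exchanged.
    | 1, ⟨r, hr1, hr2, hr3, hr4⟩, hc1, _ =>
      have lxr := lex r
      have lyr := ley r
      rcases Nat.lt_or_ge (countBefore y r u) (countBefore x r u) with hlt' | hge
      · have hys1 : countBefore y s u = 1 := by
          have := hlt (a := x) (s := s) (t := r) (by omega) y
          omega
        exact hc1 le_rfl (h.first_first hV (x := x) (y := y) (s := s) (t := r) (fun w hw =>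
          ⟨dx w hw, dy w hw, d1 s hs1 w hw, d1 r hr1 w hw, by rw [bx s hs1 w hw, hxs],
            by rw [byy s hs1 w hw, hys1], by rw [bx r hr1 w hw]; omega,
            by rw [byy r hr1 w hw]; omega⟩) hu hv)
      · have hxt1 : countBefore x t u = 1 := by
          have := hlt (a := y) (s := t) (t := r) (by omega) x
          omega
        exact hc1 le_rfl (h.symm.first_first hV (x := y) (y := x) (s := t) (t := r)
          (fun w hw => by
            have hw := hw.symm
            exact ⟨dy w hw, dx w hw, d1 t ht1 w hw, d1 r hr1 w hw, by rw [byy t ht1 w hw, hyt],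
              by rw [bx t ht1 w hw, hxt1], by rw [byy r hr1 w hw]; omega,
              by rw [bx r hr1 w hw]; omega⟩) hv hu)
    -- The separators s of x and t of y both follow the two first occurrences. One of them precedes
    -- both second occurrences and serves as z in xyzxy.
    | c + 2, _, _, hc2 =>
      refine hc2 (by omega) ?_
      by_cases hys1 : countBefore y s u = 1
      · exact h.first_block hV (x := x) (y := y) (s := s) (fun w hw =>
          ⟨dx w hw, dy w hw, d1 s hs1 w hw, by rw [bx s hs1 w hw, hxs],
            by rw [byy s hs1 w hw, hys1]⟩) hu hv
      · have hxt1 : countBefore x t u = 1 := by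
          have := hlt (a := y) (s := t) (t := s) (by omega) x
          omega
        exact h.first_block hV (x := x) (y := y) (s := t) (fun w hw =>
          ⟨dx w hw, dy w hw, d1 t ht1 w hw, by rw [bx t ht1 w hw, hxt1],
            by rw [byy t ht1 w hw, hyt]⟩) hu hv
  refine ⟨hs, fun x y hx hy hx2 hy2 hsep => ?_⟩
  by_cases hxy : x = y
  · subst hxy; rw [countBefore_self, countBefore_self]
  have hxv : x ∈ v := (hs.mem_iff x).1 (List.count_pos_iff.1 (by omega))
  have hxu : x ∈ u := List.count_pos_iff.1 (by omega)
  constructor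
  · intro hu
    by_contra hv
    exact key h hs x y hx hy hx2 hy2 hsep hu
      ((countBefore_pos_or hxy hxv).resolve_left hv)
  · intro hv
    by_contra hu
    exact key h hs y x hy hx hy2 hx2 (separated_symm hsep)
      ((countBefore_pos_or hxy hxu).resolve_left hu) hv

end order

/-! ### Words `x t₁ x ⋯ t_k x` that are not isoterms -/

/-- Without a factor xx there is at most one x in each gap around the other letters. -/
theorem count_le_or_square : ∀ (w : List ℕ),
    [0, 0] <:+: w ∨ w.count 0 ≤ (w.filter (· ≠ 0)).length + 1
  | [] => by simp
  | [a] => by by_cases h : a = 0 <;> simp [h]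
  | a :: b :: w => by
    by_cases ha : a = 0
    · by_cases hb : b = 0
      · subst ha hb; exact Or.inl ⟨[], w, rfl⟩
      · rcases count_le_or_square w with h | h
        · exact Or.inl (h.trans ⟨[a, b], [], by simp⟩)
        · subst ha
          right; simp [hb] at h ⊢; omega
    · rcases count_le_or_square (b :: w) with h | h
      · exact Or.inl (h.trans ⟨[a], [], by simp⟩)
      · right
        rw [List.count_cons_of_ne ha, List.filter_cons_of_pos (by simpa using ha)]
        simp only [List.length_cons]
        omega

/-- The word after a leading x: without xx, each other letter is followed by at most one x, and
equality of the counts forces the form t₁xt₂x⋯. -/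
theorem eq_or_square_or_count_lt : ∀ (w : List ℕ),
    w = ((w.filter (· ≠ 0)).flatMap fun t => [t, 0]) ∨ [0, 0] <:+: 0 :: w ∨
      w.count 0 < (w.filter (· ≠ 0)).length
  | [] => by simp
  | [a] => by
    by_cases h : a = 0
    · subst h; exact Or.inr (Or.inl ⟨[], [], rfl⟩)
    · simp [h]
  | a :: b :: w => by
    by_cases ha : a = 0
    · subst ha; exact Or.inr (Or.inl ⟨[], b :: w, rfl⟩)
    · by_cases hb : b = 0
      · subst hb
        have hf : (a :: 0 :: w).filter (· ≠ 0) = a :: w.filter (· ≠ 0) := by simp [ha]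
        rw [hf]
        rcases eq_or_square_or_count_lt w with h | h | h
        · left
          rw [List.flatMap_cons, ← h]; rfl
        · exact Or.inr (Or.inl (h.trans ⟨[0, a], [], by simp⟩))
        · right; right
          rw [List.count_cons_of_ne ha, List.count_cons_self, List.length_cons]
          omega
      · rcases count_le_or_square w with h | h
        · exact Or.inr (Or.inl (h.trans ⟨[0, a, b], [], by simp⟩))
        · right; right
          have hf : (a :: b :: w).filter (· ≠ 0) = a :: b :: w.filter (· ≠ 0) := by simp [ha, hb]
          rw [hf, List.count_cons_of_ne ha, List.count_cons_of_ne hb, List.length_cons,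
            List.length_cons]
          omega

theorem eq_interleave_or (w : List ℕ) : w = interleave (w.filter (· ≠ 0)) ∨ [0, 0] <:+: w ∨
    w.count 0 ≤ (w.filter (· ≠ 0)).length := by
  match w with
  | [] => simp
  | a :: w =>
    by_cases ha : a = 0
    · subst ha
      have hf : (0 :: w).filter (· ≠ 0) = w.filter (· ≠ 0) := by simp
      rw [hf]
      rcases eq_or_square_or_count_lt w with h | h | h
      · left
        rw [interleave, ← h]
      · exact Or.inr (Or.inl h)
      · right; right
        rw [List.count_cons_self]
        omega
    · rcases count_le_or_square w with h | h
      · exact Or.inr (Or.inl (h.trans ⟨[a], [], by simp⟩))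
      · right; right
        rw [List.count_cons_of_ne ha, List.filter_cons_of_pos (by simpa using ha)]
        simpa using h

theorem not_limited_of_square {k : ℕ∞} {x : ℕ} {w : List ℕ} (h : [x, x] <:+: w) :
    ¬ Limited k x w := by
  obtain ⟨p, r, rfl⟩ := h
  intro hl
  obtain ⟨t, ht, hti⟩ := hl.2 (p.count x + 1) (by omega) (by simp)
  have hxt : x ≠ t := by rintro rfl; simp at ht; omega
  simp only [List.append_assoc, countBefore_append, List.cons_append, List.nil_append,
    countBefore_cons, hxt, if_false, if_true] at hti
  have := countBefore_le_count x t p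
  split_ifs at hti <;> omega

theorem filter_interleave (m : ℕ) : (interleave (lettersTo m)).filter (· ≠ 0) = lettersTo m := by
  induction m with
  | zero => rfl
  | succ m ih =>
    rw [interleave_lettersTo_succ, List.filter_append, ih, lettersTo_succ]
    simp

/-- If `x t₁ x ⋯ t_k x` is not an isoterm, then `δ_k` holds. -/
theorem entails_delta_of_not_isoterm {V : MonoidVariety.{u}} (hV : V ≤ varDN) {k : ℕ} (hk : 1 ≤ k)
    (h01 : Isoterm V [0, 1]) (hiso : ∀ j < k, Isoterm V (interleave (lettersTo j)))
    (hn : ¬ Isoterm V (interleave (lettersTo k))) :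
    Entails V (interleave (lettersTo k)) (0 :: 0 :: lettersTo k) := by
  simp only [Isoterm, not_forall] at hn
  obtain ⟨w, hw, hne⟩ := hn
  have hS : SameShape k (interleave (lettersTo k)) w :=
    hw.sameShape h01 fun j hj => hiso j (by exact_mod_cast hj)
  have hlim : ∀ x, x ≠ 0 → Limited k x (interleave (lettersTo k)) := by
    intro x hx
    refine limited_of_count_le_one (by exact_mod_cast hk) ?_
    rw [count_interleave_of_ne hx]
    exact List.nodup_iff_count_le_one.1 (lettersTo_nodup k) x
  have hcount : ∀ x, x ≠ 0 → w.count x = (interleave (lettersTo k)).count x := fun x hx =>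
    (hS.count_eq x (hlim x hx)).symm
  -- All letters other than x are simple on the left, so they form the same word t₁⋯t_k in w.
  have hfil : w.filter (· ≠ 0) = lettersTo k := by
    rw [← filter_interleave]
    symm
    refine eq_of_count_eq 0 (fun x => ?_) (fun t ht h0 => ?_) (fun t ht h0 y => ?_)
    · by_cases hx : x = 0
      · rw [hx, count_filter_ne_self, count_filter_ne_self]
      · rw [count_filter_ne hx, count_filter_ne hx, hcount x hx]
    · rw [filter_interleave] at ht ⊢
      exact List.count_eq_one_of_mem (lettersTo_nodup k) ht
    · rw [filter_interleave, mem_lettersTo] at ht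
      by_cases hy : y = 0
      · subst hy
        rw [countBefore_eq_zero_of_notMem, countBefore_eq_zero_of_notMem] <;> simp
      · rw [countBefore_filter_ne hy h0, countBefore_filter_ne hy h0]
        exact hS.before_eq y t (hlim y hy) (count_simple_interleave ht.1 ht.2)
  have hc0 : (interleave (lettersTo k)).count 0 = k + 1 := by
    rw [count_zero_interleave (zero_notMem_lettersTo k), length_lettersTo]
  have hnl : ¬ Limited k 0 w := fun h => by
    have h1 := ((hS.limited_iff 0).2 h).1
    rw [hc0] at h1
    have h1 : k + 1 ≤ k := by exact_mod_cast h1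
    omega
  -- Since w differs from the given word, it contains xx or has at most k letters x. In the latter
  -- case ⊤-limited would mean k-limited, which is excluded. So x becomes a central square by the
  -- laws of D_∞ ∨ N alone.
  have hnt : ¬ Limited ⊤ 0 w := by
    rcases eq_interleave_or w with h | h | h
    · rw [hfil] at h; exact absurd h hne
    · exact not_limited_of_square h
    · rw [hfil, length_lettersTo] at h
      exact fun hl => hnl (hl.mono (by exact_mod_cast h))
  refine hw.trans fun A _ hA φ => ?_
  have L : Laws A ⊤ 2 := laws_of_le_varDN hV (by simp) (by omega) (by omega) hA
  rw [L.ev_of_not_limited φ le_top hnt, hfil]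
  simp [mul_assoc]

/-! ### The varieties `M` and `N` -/

/-- Conditions on a set of words under which its syntactic monoid belongs to `N`. -/
structure Thin (L : Set (List ℕ)) : Prop where
  count_le : ∀ w ∈ L, ∀ l, w.count l ≤ 2
  length : ∀ w ∈ L, 4 ≤ w.length
  adjacent : ∀ p c d q, p ++ c :: d :: q ∈ L → 2 ≤ (p ++ c :: d :: q).count c →
    2 ≤ (p ++ c :: d :: q).count d → c ≠ d ∧ (p = [] ∨ (q = [] ∧ p ++ [d, c] ∈ L))

/-- Both a and b are single letters. If, say, a had two letters, its last two would have to open the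
word and the pair formed with the first letter of b would have to close it, leaving a word of length
three. -/
theorem Thin.pair {L : Set (List ℕ)} (hL : Thin L) {p a b q w : List ℕ}
    (hw : p ++ a ++ b ++ q = w) (h : w ∈ L)
    (ha : a ≠ []) (hb : b ≠ []) (ha2 : ∀ l ∈ a, 2 ≤ w.count l) (hb2 : ∀ l ∈ b, 2 ≤ w.count l) :
    a ++ b ≠ b ++ a ∧ (p = [] ∨ (q = [] ∧ p ++ b ++ a ∈ L)) := by
  obtain ⟨a, c, rfl⟩ := List.eq_nil_or_concat' a |>.resolve_left ha
  obtain ⟨d, b, rfl⟩ := List.exists_cons_of_ne_nil hb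
  have hadj : ∀ p' c d q', p' ++ c :: d :: q' = w → 2 ≤ w.count c → 2 ≤ w.count d →
      c ≠ d ∧ (p' = [] ∨ (q' = [] ∧ p' ++ [d, c] ∈ L)) := by
    intro p' c d q' e hc hd
    subst e
    exact hL.adjacent p' c d q' h hc hd
  have hlen := hL.length w h
  obtain ⟨hcd, h1⟩ := hadj (p ++ a) c d (b ++ q) (by rw [← hw]; simp)
    (ha2 c (by simp)) (hb2 d (by simp))
  have ha0 : a = [] := by
    by_contra hne
    obtain ⟨a, e, rfl⟩ := List.eq_nil_or_concat' a |>.resolve_left hne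
    obtain ⟨_, h2⟩ := hadj (p ++ a) e c (d :: (b ++ q)) (by rw [← hw]; simp)
      (ha2 e (by simp)) (ha2 c (by simp))
    rcases h2 with h2 | h2
    · rcases h1 with h1 | h1
      · simp at h1
      · rw [← hw] at hlen
        simp only [List.append_eq_nil_iff] at h1 h2
        simp [h1.1, h2] at hlen
    · simp at h2
  subst ha0
  have hb0 : b = [] := by
    by_contra hne
    obtain ⟨e, b, rfl⟩ := List.exists_cons_of_ne_nil hne
    obtain ⟨_, h2⟩ := hadj (p ++ [c]) d e (b ++ q) (by rw [← hw]; simp)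
      (hb2 d (by simp)) (hb2 e (by simp))
    rcases h2 with h2 | h2
    · simp at h2
    · rcases h1 with h1 | h1
      · rw [← hw] at hlen
        simp only [List.append_eq_nil_iff] at h1 h2
        simp [h1.1, h2.1] at hlen
      · simp at h1
  subst hb0
  refine ⟨by simp [hcd], ?_⟩
  simpa using h1

/-- The set `L` of words does not distinguish the sides of `u ≈ v` under any substitution. -/
def Respects (L : Set (List ℕ)) (u v : List ℕ) : Prop :=
  ∀ (ψ : ℕ → List ℕ) (p q : List ℕ), p ++ u.flatMap ψ ++ q ∈ L ↔ p ++ v.flatMap ψ ++ q ∈ L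

theorem Thin.image_pair {L : Set (List ℕ)} (hL : Thin L) {ψ : ℕ → List ℕ} {p q α β u : List ℕ}
    {i j : ℕ} (hu : u = α ++ i :: j :: β) (h : p ++ u.flatMap ψ ++ q ∈ L) (hi : ψ i ≠ [])
    (hj : ψ j ≠ []) (hi2 : 2 ≤ u.count i) (hj2 : 2 ≤ u.count j) :
    ψ i ++ ψ j ≠ ψ j ++ ψ i ∧ (p ++ α.flatMap ψ = [] ∨
      (β.flatMap ψ ++ q = [] ∧ p ++ α.flatMap ψ ++ ψ j ++ ψ i ∈ L)) :=
  hL.pair (p := p ++ α.flatMap ψ) (q := β.flatMap ψ ++ q) (w := p ++ u.flatMap ψ ++ q)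
    (by rw [hu]; simp) h hi hj (fun _ hl => two_le_count_of_mem_image rfl hi2 hl)
    (fun _ hl => two_le_count_of_mem_image rfl hj2 hl)

/-- Images containing squares or three occurrences of a letter are excluded. In the last two
identities the swapped pair has a nonempty image before it, so it must end the word and may be
exchanged; in the last identity this is impossible. -/
theorem Thin.respects {L : Set (List ℕ)} (hL : Thin L) :
    Respects L [0, 0] [0, 0, 0] ∧ Respects L [0, 0, 1] [1, 0, 0] ∧
    Respects L [0, 1, 0, 2, 0] [0, 0, 1, 2] ∧
    Respects L [0, 4, 1, 3, 0, 1] [0, 4, 1, 3, 1, 0] ∧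
    Respects L [0, 4, 0, 1, 3, 1] [0, 4, 1, 0, 3, 1] := by
  have hsq : ∀ {ψ : ℕ → List ℕ} {p q u : List ℕ} (α β : List ℕ), u = α ++ 0 :: 0 :: β →
      ψ 0 ≠ [] → p ++ u.flatMap ψ ++ q ∉ L := fun α β hu h0 h =>
    (hL.image_pair hu h h0 h0 (by simp [hu]; omega) (by simp [hu]; omega)).1 rfl
  refine ⟨fun ψ p q => ?_, fun ψ p q => ?_, fun ψ p q => ?_, fun ψ p q => ?_, fun ψ p q => ?_⟩
  · by_cases h0 : ψ 0 = []
    · simp [h0]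
    · exact iff_of_false (hsq [] [] rfl h0) (hsq [] [0] rfl h0)
  · by_cases h0 : ψ 0 = []
    · simp [h0]
    · exact iff_of_false (hsq [] [1] rfl h0) (hsq [1] [] rfl h0)
  · by_cases h0 : ψ 0 = []
    · simp [h0]
    · refine iff_of_false (fun h => ?_) (hsq [] [1, 2] rfl h0)
      obtain ⟨l, hl⟩ := List.exists_mem_of_ne_nil _ h0
      have := two_le_count_of_mem_image (n := 3) rfl (by decide) hl (p := p) (q := q)
        (u := [0, 1, 0, 2, 0])
      have := hL.count_le _ h l
      omega
  · by_cases h0 : ψ 0 = []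
    · simp [h0]
    by_cases h1 : ψ 1 = []
    · simp [h1]
    constructor <;> intro h
    · rcases (hL.image_pair (α := [0, 4, 1, 3]) (β := []) rfl h h0 h1 (by decide) (by decide)).2
        with h' | ⟨h', h''⟩
      · simp [h0] at h'
      · simp at h' h''
        subst h'
        simpa using h''
    · rcases (hL.image_pair (α := [0, 4, 1, 3]) (β := []) rfl h h1 h0 (by decide) (by decide)).2
        with h' | ⟨h', h''⟩
      · simp [h0] at h'
      · simp at h' h''
        subst h'
        simpa using h''
  · by_cases h0 : ψ 0 = []
    · simp [h0]
    by_cases h1 : ψ 1 = []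
    · simp [h1]
    refine iff_of_false (fun h => ?_) (fun h => ?_)
    · have := (hL.image_pair (α := [0, 4]) (β := [3, 1]) rfl h h0 h1 (by decide) (by decide)).2
      simp [h0, h1] at this
    · have := (hL.image_pair (α := [0, 4]) (β := [3, 1]) rfl h h1 h0 (by decide) (by decide)).2
      simp [h0, h1] at this

theorem thin_M : Thin {[0, 1, 3, 0, 4, 1]} where
  count_le := by
    rintro _ rfl l
    by_cases h : l ∈ [0, 1, 3, 0, 4, 1]
    · revert l; decide
    · simp [List.count_eq_zero.2 h]
  length := by rintro _ rfl; decide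
  adjacent := by
    intro p c d q h hc hd
    have h : p ++ c :: d :: q = [0, 1, 3, 0, 4, 1] := h
    have hlen := congrArg List.length h
    rw [h] at hc hd
    rcases p with _ | ⟨p0, _ | ⟨p1, _ | ⟨p2, _ | ⟨p3, _ | ⟨p4, p⟩⟩⟩⟩⟩ <;> simp at h
    · obtain ⟨rfl, rfl, -⟩ := h; simp
    · obtain ⟨-, rfl, rfl, -⟩ := h; simp at hd
    · obtain ⟨-, -, rfl, rfl, -⟩ := h; simp at hc
    · obtain ⟨-, -, -, rfl, rfl, -⟩ := h; simp at hd
    · obtain ⟨-, -, -, -, rfl, rfl, -⟩ := h; simp at hc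
    · simp at hlen; omega

theorem thin_N : Thin {[0, 1, 2, 0, 1], [0, 1, 2, 1, 0]} where
  count_le := by
    rintro w hw l
    by_cases h : l ∈ w
    · revert l
      rcases hw with rfl | rfl <;> decide
    · simp [List.count_eq_zero.2 h]
  length := by rintro _ (rfl | rfl) <;> decide
  adjacent := by
    rintro p c d q (h | h) hc hd <;> have hlen := congrArg List.length h <;> rw [h] at hc hd
    · rcases p with _ | ⟨p0, _ | ⟨p1, _ | ⟨p2, _ | ⟨p3, p⟩⟩⟩⟩ <;> simp at h
      · obtain ⟨rfl, rfl, -⟩ := h; simp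
      · obtain ⟨-, rfl, rfl, -⟩ := h; simp at hd
      · obtain ⟨-, -, rfl, rfl, -⟩ := h; simp at hc
      · obtain ⟨rfl, rfl, rfl, rfl, rfl, rfl⟩ := h; simp
      · simp at hlen; omega
    · rcases p with _ | ⟨p0, _ | ⟨p1, _ | ⟨p2, _ | ⟨p3, p⟩⟩⟩⟩ <;> simp at h
      · obtain ⟨rfl, rfl, -⟩ := h; simp
      · obtain ⟨-, rfl, rfl, -⟩ := h; simp at hd
      · obtain ⟨-, -, rfl, rfl, -⟩ := h; simp at hc
      · obtain ⟨rfl, rfl, rfl, rfl, rfl, rfl⟩ := h; simp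
      · simp at hlen; omega

theorem varM_entails {u v : List ℕ} (h : Respects {[0, 1, 3, 0, 4, 1]} u v) :
    Entails varM.{u} u v := by
  rw [varM_eq, entails_S]; exact h

theorem varM_le_varN : varM.{u} ≤ varN := by
  obtain ⟨h1, h2, h3, h4, h5⟩ := thin_M.respects
  exact le_varN_iff.2 ⟨varM_entails h1, varM_entails h2, varM_entails h3, varM_entails h4,
    varM_entails h5⟩

/-- In an image equal to xytxsy in context, the final pair would end the word and could be exchanged
within a set of one word, so the two images would commute; thinness forbids this. -/
theorem varM_first_block : Entails varM.{u} [0, 1, 2, 0, 1] [1, 0, 2, 0, 1] := by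
  refine varM_entails fun ψ p q => ?_
  by_cases h0 : ψ 0 = []
  · simp [h0]
  by_cases h1 : ψ 1 = []
  · simp [h1]
  refine iff_of_false (fun h => ?_) (fun h => ?_)
  · obtain ⟨h2, h3⟩ := thin_M.image_pair (α := [0, 1, 2]) (β := []) rfl h h0 h1 (by decide)
      (by decide)
    rcases h3 with h3 | ⟨h3, h4⟩
    · simp [h0] at h3
    · simp at h3
      subst h3
      refine h2 (List.append_cancel_left (as := p ++ [0, 1, 2].flatMap ψ) ?_)
      rw [Set.mem_singleton_iff] at h h4
      rw [← List.append_assoc _ (ψ 1), h4, ← h]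
      simp
  · obtain ⟨h2, h3⟩ := thin_M.image_pair (α := [1, 0, 2]) (β := []) rfl h h0 h1 (by decide)
      (by decide)
    rcases h3 with h3 | ⟨h3, h4⟩
    · simp [h0] at h3
    · simp at h3
      subst h3
      refine h2 (List.append_cancel_left (as := p ++ [1, 0, 2].flatMap ψ) ?_)
      rw [Set.mem_singleton_iff] at h h4
      rw [← List.append_assoc _ (ψ 1), h4, ← h]
      simp

/-- The syntactic congruence of a set of words. -/
def syntacticCon (L : Set (List ℕ)) : Con Word where
  r a b := ∀ p q : List ℕ, p ++ a.toList ++ q ∈ L ↔ p ++ b.toList ++ q ∈ L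
  iseqv := ⟨fun _ _ _ => Iff.rfl, fun h p q => (h p q).symm,
    fun h h' p q => (h p q).trans (h' p q)⟩
  mul' := by
    intro a b c d h h' p q
    have h1 := h p (c.toList ++ q)
    have h2 := h' (p ++ b.toList) q
    simp only [FreeMonoid.toList_mul, List.append_assoc] at h1 h2 ⊢
    exact h1.trans h2

theorem entails_syntactic {L : Set (List ℕ)} {u v : List ℕ} :
    Entails (.generatedBy (syntacticCon L).Quotient : MonoidVariety.{u}) u v ↔
      Respects L u v := by
  have hev : ∀ (ψ : ℕ → List ℕ) (u : List ℕ),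
      ev (fun n => (syntacticCon L).mk' (FreeMonoid.ofList (ψ n))) u
        = (syntacticCon L).mk' (FreeMonoid.ofList (u.flatMap ψ)) := by
    intro ψ u
    induction u with
    | nil => rfl
    | cons a u ih => rw [ev_cons, ih, ← map_mul, List.flatMap_cons]; rfl
  rw [entails_generatedBy]
  constructor
  · intro h ψ
    have := h fun n => (syntacticCon L).mk' (FreeMonoid.ofList (ψ n))
    rw [hev, hev] at this
    exact (Con.eq _).1 this
  · intro h φ
    choose f hf using fun n => Con.mk'_surjective (c := syntacticCon L) (φ n)
    obtain rfl : (fun n => (syntacticCon L).mk' (FreeMonoid.ofList (f n).toList)) = φ := funext hf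
    rw [hev, hev]
    exact (Con.eq _).2 (h _)

/-- The Rees quotient S(xyzxy) does not lie in N, because N satisfies xyzxy ≈ xyzyx. The syntactic
monoid of both words together does, and it distinguishes xyzxy from yxzxy. -/
theorem varN_not_first_block : ¬ Entails varN.{u} [0, 1, 2, 0, 1] [1, 0, 2, 0, 1] := by
  intro h
  obtain ⟨h1, h2, h3, h4, h5⟩ := thin_N.respects
  have hle : (.generatedBy (syntacticCon {[0, 1, 2, 0, 1], [0, 1, 2, 1, 0]}).Quotient :
      MonoidVariety.{u}) ≤ varN :=
    le_varN_iff.2 ⟨entails_syntactic.2 h1, entails_syntactic.2 h2, entails_syntactic.2 h3,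
      entails_syntactic.2 h4, entails_syntactic.2 h5⟩
  have := entails_syntactic.1 (le_iff_entails.1 hle _ _ h) (fun n => [n]) [] []
  simp at this


/-! ### The subvarieties that contain `D_2` -/

/-- The varieties `D_2`, `M`, `N`. -/
def varU : ℕ → MonoidVariety.{u}
  | 0 => varD 2
  | 1 => varM
  | _ => varN

theorem varD_le_varDN {k : ℕ∞} (hk : 1 ≤ k) : varD.{u} k ≤ varDN :=
  (varD_mono hk le_top).trans le_sup_left

theorem varN_le_varDN : varN.{u} ≤ varDN := le_sup_right

theorem varD_entails {k : ℕ∞} (hk : 1 ≤ k) {u v : List ℕ} (h : Entails (varD.{u} ⊤) u v) :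
    Entails (varD.{u} k) u v := le_iff_entails.1 (varD_mono hk le_top) _ _ h

theorem varD_first_block {k : ℕ∞} (hk : 1 ≤ k) :
    Entails (varD.{u} k) [0, 1, 2, 0, 1] [1, 0, 2, 0, 1] :=
  varD_entails hk (entails_varD_top_swap (α := []) (β := [2, 0, 1]) (by decide) (by decide))

theorem varD_first_first {k : ℕ∞} (hk : 1 ≤ k) :
    Entails (varD.{u} k) [0, 1, 2, 0, 3, 1] [1, 0, 2, 0, 3, 1] :=
  varD_entails hk (entails_varD_top_swap (α := []) (β := [2, 0, 3, 1]) (by decide) (by decide))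

theorem varM_not_first_first : ¬ Entails varM.{u} [0, 1, 2, 0, 3, 1] [1, 0, 2, 0, 3, 1] := by
  intro h
  have := varM_le_iff.1 (le_refl varM.{u}) _ (h.flatMap fun n =>
    if n = 2 then [3] else if n = 3 then [4] else [n])
  simp at this

theorem isoterm_of_varD_le {V : MonoidVariety.{u}} {k : ℕ∞} (hk : 2 ≤ k) (h : varD k ≤ V) :
    Isoterm V [0, 1] ∧ ∀ j : ℕ, (j : ℕ∞) < k → Isoterm V (interleave (lettersTo j)) := by
  have key : ∀ j : ℕ, 1 ≤ j → (j : ℕ∞) < k → Isoterm V (interleave (lettersTo j)) := by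
    intro j hj hjk
    refine (varD_succ_le_iff hj).1 ((varD_mono ?_ ?_).trans h)
    · exact_mod_cast Nat.le_add_left 1 j
    · exact_mod_cast Order.add_one_le_of_lt hjk
  have h1 : Isoterm V (interleave (lettersTo 1)) :=
    key 1 le_rfl (lt_of_lt_of_le (by norm_num) hk)
  refine ⟨isoterm_pair_of_interleave le_rfl h1, fun j hj => ?_⟩
  rcases Nat.eq_zero_or_pos j with rfl | hj'
  · exact isoterm_interleave_of_le (Nat.zero_le 1) h1
  · exact key j hj' hj

theorem not_entails_delta {V : MonoidVariety.{u}} {k : ℕ}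
    (h : Isoterm V (interleave (lettersTo k))) (hk : 1 ≤ k) :
    ¬ Entails V (interleave (lettersTo k)) (0 :: 0 :: lettersTo k) := by
  intro hd
  have := congrArg (fun w => [0, 0].isPrefixOf w) (h _ hd)
  obtain ⟨k, rfl⟩ := Nat.exists_eq_add_of_le' hk
  simp [interleave, lettersTo, List.range_succ_eq_map] at this

theorem varD_two_le {V : MonoidVariety.{u}} (hV : V ≤ varDN) (h01 : Isoterm V [0, 1])
    (h : ¬ Entails V (interleave (lettersTo 1)) (0 :: 0 :: lettersTo 1)) : varD 2 ≤ V := by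
  refine (varD_succ_le_iff le_rfl).2 ?_
  by_contra hn
  refine h (entails_delta_of_not_isoterm hV le_rfl h01 (fun j hj => ?_) hn)
  obtain rfl : j = 0 := by omega
  exact h01.left

theorem varD_two_le_varM : varD.{u} 2 ≤ varM := by
  have hM := varM_le_iff.1 (le_refl varM.{u})
  refine varD_two_le (varM_le_varN.trans varN_le_varDN)
    (Isoterm.of_append (p := []) (q := [3, 0, 4, 1]) hM) fun h => ?_
  -- Substituting yt for the letter t₁ of δ_1 and multiplying by sy on the right gives xytxsy ≈
  -- x²ytsy, against the isoterm.
  have := hM _ ((h.flatMap fun n => if n = 1 then [1, 3] else [n]).append (.refl _ [4, 1]))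
  revert this
  decide

theorem varU_mono {c d : ℕ} (h : c ≤ d) : varU.{u} c ≤ varU d := by
  refine monotone_nat_of_le_succ (fun n => ?_) h
  match n with
  | 0 => exact varD_two_le_varM
  | 1 => exact varM_le_varN
  | _ + 2 => exact le_rfl

theorem varU_le_varN (c : ℕ) : varU.{u} c ≤ varN :=
  (varU_mono (Nat.le_add_right c 2)).trans le_rfl

/-- The properties of a variety that characterize `D_k ∨ U`. -/
structure HasType (V : MonoidVariety.{u}) (k : ℕ∞) (c : ℕ) : Prop where
  two_le : 2 ≤ k
  le_varDN : V ≤ varDN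
  varD_le : varD k ≤ V
  delta : ∀ n : ℕ, k = n → Entails V (interleave (lettersTo n)) (0 :: 0 :: lettersTo n)
  first_block : c ≤ 1 → Entails V [0, 1, 2, 0, 1] [1, 0, 2, 0, 1]
  first_first : c = 0 → Entails V [0, 1, 2, 0, 3, 1] [1, 0, 2, 0, 3, 1]
  not_first_first : 1 ≤ c → ¬ Entails V [0, 1, 2, 0, 3, 1] [1, 0, 2, 0, 3, 1]
  not_first_block : 2 ≤ c → ¬ Entails V [0, 1, 2, 0, 1] [1, 0, 2, 0, 1]

/-- The two halves of the word problem meet here. In particular, a variety is determined by its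
type. -/
theorem HasType.entails_iff {V : MonoidVariety.{u}} {k : ℕ∞} {c : ℕ} (h : HasType V k c)
    {u v : List ℕ} : Entails V u v ↔ Agree k c u v := by
  obtain ⟨h01, hk⟩ := isoterm_of_varD_le h.two_le h.varD_le
  constructor
  · intro e
    exact e.agree h.le_varDN (e.sameShape h01 hk) h.not_first_first h.not_first_block
  · intro e
    exact e.entails h.le_varDN (le_trans (by norm_num) h.two_le) h.delta h.first_block h.first_first

theorem HasType.eq {V W : MonoidVariety.{u}} {k : ℕ∞} {c : ℕ} (h : HasType V k c)
    (h' : HasType W k c) : V = W :=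
  le_antisymm (le_iff_entails.2 fun _ _ e => h.entails_iff.2 (h'.entails_iff.1 e))
    (le_iff_entails.2 fun _ _ e => h'.entails_iff.2 (h.entails_iff.1 e))

theorem varU_first_block {c : ℕ} (hc : c ≤ 1) :
    Entails (varU.{u} c) [0, 1, 2, 0, 1] [1, 0, 2, 0, 1] :=
  le_iff_entails.1 (varU_mono hc) _ _ varM_first_block

theorem varU_not_first_first {c : ℕ} (hc : 1 ≤ c) :
    ¬ Entails (varU.{u} c) [0, 1, 2, 0, 3, 1] [1, 0, 2, 0, 3, 1] := fun h =>
  varM_not_first_first (le_iff_entails.1 (varU_mono hc) _ _ h)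

theorem varU_not_first_block {c : ℕ} (hc : 2 ≤ c) :
    ¬ Entails (varU.{u} c) [0, 1, 2, 0, 1] [1, 0, 2, 0, 1] := fun h =>
  varN_not_first_block (le_iff_entails.1 (varU_mono hc) _ _ h)

theorem hasType_sup {k : ℕ∞} (hk : 2 ≤ k) (c : ℕ) : HasType (varD.{u} k ⊔ varU c) k c := by
  have hk1 : 1 ≤ k := le_trans (by norm_num) hk
  refine ⟨hk, sup_le (varD_le_varDN hk1) ((varU_le_varN c).trans varN_le_varDN), le_sup_left,
    fun n hn => ?_, fun hc => ?_, fun hc => ?_, fun hc h => ?_, fun hc h => ?_⟩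
  · subst hn
    have hn : 2 ≤ n := by exact_mod_cast hk
    exact entails_sup.2 ⟨entails_varD_delta (by omega),
      le_iff_entails.1 (varU_le_varN c) _ _ (entails_varN_delta hn)⟩
  · exact entails_sup.2 ⟨varD_first_block hk1, varU_first_block hc⟩
  · subst hc
    exact entails_sup.2 ⟨varD_first_first hk1,
      varD_first_first (k := 2) (by norm_num)⟩
  · exact varU_not_first_first hc (entails_sup.1 h).2
  · exact varU_not_first_block hc (entails_sup.1 h).2

theorem varD_sup_zero {k : ℕ∞} (hk : 2 ≤ k) : varD.{u} k ⊔ varU 0 = varD k :=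
  sup_eq_left.2 (varD_mono (by norm_num) hk)

theorem exists_eq_sup {V : MonoidVariety.{u}} {k : ℕ∞} (hk : 2 ≤ k) (hV : V ≤ varDN)
    (hD : varD k ≤ V)
    (hd : ∀ n : ℕ, k = n → Entails V (interleave (lettersTo n)) (0 :: 0 :: lettersTo n)) :
    ∃ c ≤ 2, V = varD k ⊔ varU c := by
  by_cases h1 : Entails V [0, 1, 2, 0, 1] [1, 0, 2, 0, 1]
  · by_cases h0 : Entails V [0, 1, 2, 0, 3, 1] [1, 0, 2, 0, 3, 1]
    · exact ⟨0, by omega, HasType.eq ⟨hk, hV, hD, hd, fun _ => h1, fun _ => h0, by omega, by omega⟩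
        (hasType_sup hk 0)⟩
    · exact ⟨1, by omega, HasType.eq ⟨hk, hV, hD, hd, fun _ => h1, by omega, fun _ => h0, by omega⟩
        (hasType_sup hk 1)⟩
  -- Erasing t in xyzxty ≈ yxzxty gives xyzxy ≈ yxzxy, so only three combinations are possible.
  · have h0 : ¬ Entails V [0, 1, 2, 0, 3, 1] [1, 0, 2, 0, 3, 1] := by
      intro h
      have := h.flatMap fun n => if n = 3 then [] else [n]
      exact h1 (by simpa using this)
    exact ⟨2, le_rfl, HasType.eq ⟨hk, hV, hD, hd, by omega, by omega, fun _ => h0, fun _ => h1⟩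
      (hasType_sup hk 2)⟩

/-- The index is detected by δ_l, which fails above D_k for l < k, and the second component by the
two identities on first occurrences. -/
theorem sup_le_sup_iff {k l : ℕ∞} (hk : 2 ≤ k) (hl : 2 ≤ l) {c d : ℕ} (hc : c ≤ 2) :
    varD.{u} k ⊔ varU c ≤ varD l ⊔ varU d ↔ k ≤ l ∧ c ≤ d := by
  constructor
  · intro h
    constructor
    · by_contra hlk
      rw [not_le] at hlk
      lift l to ℕ using ne_top_of_lt hlk
      have h2 : 2 ≤ l := by exact_mod_cast hl
      exact not_entails_delta ((isoterm_of_varD_le hk le_sup_left).2 l hlk) (by omega)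
        (le_iff_entails.1 h _ _ ((hasType_sup hl d).delta l rfl))
    · by_contra hdc
      rcases Nat.eq_zero_or_pos d with rfl | hd
      · exact (hasType_sup hk c).not_first_first (by omega)
          (le_iff_entails.1 h _ _ ((hasType_sup hl 0).first_first rfl))
      · exact (hasType_sup hk c).not_first_block (by omega)
          (le_iff_entails.1 h _ _ ((hasType_sup hl d).first_block (by omega)))
  · rintro ⟨h1, h2⟩
    exact sup_le_sup (varD_mono (le_trans (by norm_num) hk) h1) (varU_mono h2)

theorem varU_le_iff {c d : ℕ} (hc : c ≤ 2) : varU.{u} c ≤ varU d ↔ c ≤ d :=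
  ⟨fun h => ((sup_le_sup_iff le_rfl le_rfl hc).1 (sup_le_sup_left h (varD 2))).2, varU_mono⟩

/-! ### The small subvarieties -/

theorem le_varT_iff {V : MonoidVariety.{u}} : V ≤ varT ↔ Entails V [0] [] := by
  rw [varT, le_ofIdentities_iff]
  simp only [Set.mem_singleton_iff, forall_eq]
  rfl

theorem le_varSL_iff {V : MonoidVariety.{u}} :
    V ≤ varSL ↔ Entails V [0, 0] [0] ∧ Entails V [0, 1] [1, 0] := by
  rw [varSL, le_ofIdentities_iff]
  simp only [Set.mem_insert_iff, Set.mem_singleton_iff, forall_eq_or_imp, forall_eq]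
  rfl

theorem le_varC2_iff {V : MonoidVariety.{u}} :
    V ≤ varC2 ↔ Entails V [0, 0] [0, 0, 0] ∧ Entails V [0, 1] [1, 0] := by
  rw [varC2, le_ofIdentities_iff]
  simp only [Set.mem_insert_iff, Set.mem_singleton_iff, forall_eq_or_imp, forall_eq]
  rfl

theorem ev_eq_pow {A : Type u} [Monoid A] (φ : ℕ → A) {x : ℕ} {w : List ℕ} (h : ∀ l ∈ w, l = x) :
    ev φ w = φ x ^ w.length := by
  induction w with
  | nil => simp
  | cons a w ih =>
    rw [ev_cons, ih fun l hl => h l (List.mem_cons_of_mem _ hl), h a (by simp), List.length_cons,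
      pow_succ']

theorem pow_eq_sq {A : Type u} [Monoid A] {a : A} (h : a * a * a = a * a) {n : ℕ} (hn : 2 ≤ n) :
    a ^ n = a * a := by
  induction n, hn using Nat.le_induction with
  | base => exact pow_two a
  | succ n _ ih => rw [pow_succ, ih, h]

/-- A letter on one side only gives 1 ≈ xⁿ with n > 0. Then x² = x^{2n} = 1 by x³ = x², and x³ = x²
becomes x = 1. -/
theorem Entails.mem_of_mem_of_not_le_varT {V : MonoidVariety.{u}} (hV : V ≤ varDN)
    (hT : ¬ V ≤ varT) {u v : List ℕ} (h : Entails V u v) {l : ℕ} (hl : l ∈ v) : l ∈ u := by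
  by_contra hu
  refine hT (le_varT_iff.2 fun A _ hA φ => ?_)
  have L : Laws A ⊤ 2 := laws_of_le_varDN hV (by simp) (by omega) (by omega) hA
  have e : u.filterMap (position [l]) = [] := by
    refine List.filterMap_eq_nil_iff.2 fun a ha => ?_
    have : a ≠ l := by rintro rfl; exact hu ha
    simp [position, this]
  have h1 := h.filterMap (position [l]) A hA φ
  rw [e, ev_nil, ev_eq_pow φ (x := 0) fun i hi => by simpa using lt_of_mem_position hi] at h1
  have h2 := count_position (ls := [l]) (by simp) (i := 0) (by simp) v
  have h3 : 0 < v.count l := List.count_pos_iff.2 hl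
  have h4 := List.count_le_length (a := 0) (l := v.filterMap (position [l]))
  simp only [List.getElem_cons_zero] at h2
  set n := (v.filterMap (position [l])).length with hn
  have h5 : φ 0 ^ (2 * n) = 1 := by rw [mul_comm, pow_mul, ← h1, one_pow]
  have h6 : φ 0 * φ 0 = 1 := by rw [← h5, pow_eq_sq (L.sq _) (by omega)]
  have h7 := L.sq (φ 0)
  rw [h6, one_mul] at h7
  simpa using h7

theorem varSL_le {V : MonoidVariety.{u}} (h : ∀ u v, Entails V u v → ∀ l ∈ v, l ∈ u) :
    varSL ≤ V := by
  refine le_iff_entails.2 fun u v huv A _ hA φ => ?_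
  obtain ⟨h1, h2⟩ := le_varSL_iff.1 (le_refl varSL.{u})
  have idem : ∀ a : A, a * a = a := fun a => by simpa [sub] using h1 A hA (sub a a a a a)
  have comm : ∀ a b : A, a * b = b * a := fun a b => by simpa [sub] using h2 A hA (sub a b a a a)
  have absorb : ∀ u v : List ℕ, (∀ l ∈ v, l ∈ u) → ev φ u * ev φ v = ev φ u := by
    intro u v
    induction v with
    | nil => simp
    | cons a v ih =>
      intro hl
      obtain ⟨p, q, rfl⟩ := List.append_of_mem (hl a (by simp))
      have ih := ih fun l h => hl l (List.mem_cons_of_mem _ h)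
      have e : ev φ (p ++ a :: q) * φ a = ev φ (p ++ a :: q) := by
        rw [ev_append, ev_cons, mul_assoc, mul_assoc, comm (ev φ q), ← mul_assoc (φ a), idem]
      rw [ev_cons, ← mul_assoc, e, ih]
  rw [← absorb u v (h u v huv), comm, absorb v u (h v u huv.symm)]

/-- In C_2 the value of a word depends only on its letters and on which of them are simple; both are
preserved if x is an isoterm. -/
theorem varC2_le {V : MonoidVariety.{u}} (h0 : Isoterm V [0]) : varC2 ≤ V := by
  refine le_iff_entails.2 fun u v huv A inst hA φ => ?_
  obtain ⟨h1, h2⟩ := le_varC2_iff.1 (le_refl varC2.{u})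
  have hsq : ∀ a : A, a * a * a = a * a := fun a => by
    simpa [sub, mul_assoc] using (h1 A hA (sub a a a a a)).symm
  have comm : ∀ a b : A, a * b = b * a := fun a b => by simpa [sub] using h2 A hA (sub a b a a a)
  let _ : CommMonoid A := { inst with mul_comm := comm }
  have hfs : u.toFinset = v.toFinset := by
    ext l
    simp only [List.mem_toFinset]
    exact ⟨huv.symm.mem_of_mem h0, huv.mem_of_mem h0⟩
  have key : ∀ w : List ℕ, ev φ w = ∏ l ∈ w.toFinset, φ l ^ w.count l := fun w =>
    Finset.prod_list_map_count w φ
  rw [key, key, hfs]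
  refine Finset.prod_congr rfl fun l hl => ?_
  have hv : 0 < v.count l := List.count_pos_iff.2 (List.mem_toFinset.1 hl)
  have hu : 0 < u.count l := List.count_pos_iff.2 (List.mem_toFinset.1 (hfs ▸ hl))
  by_cases hu1 : u.count l = 1
  · rw [hu1, huv.count_eq_one h0 hu1]
  · have hv1 : v.count l ≠ 1 := fun h => hu1 (huv.symm.count_eq_one h0 h)
    rw [pow_eq_sq (hsq _) (by omega), pow_eq_sq (hsq _) (by omega)]

/-- A word equal to x and different from it must be xⁿ with n ≥ 2, so x = x². Central squares then
give commutativity. -/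
theorem le_varSL_of_not_isoterm {V : MonoidVariety.{u}} (hV : V ≤ varDN) (hT : ¬ V ≤ varT)
    (h : ¬ Isoterm V [0]) : V ≤ varSL := by
  simp only [Isoterm, not_forall] at h
  obtain ⟨w, hw, hne⟩ := h
  have hall : ∀ l ∈ w, l = 0 := fun l hl => by
    simpa using hw.mem_of_mem_of_not_le_varT hV hT hl
  have hnil : w ≠ [] := by
    rintro rfl
    simpa using hw.symm.mem_of_mem_of_not_le_varT hV hT (l := 0) (by simp)
  have hlen : 2 ≤ w.length := by
    match w, hall, hnil, hne with
    | [a], hall, _, hne => exact absurd (by rw [hall a (by simp)]) hne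
    | _ :: _ :: _, _, _, _ => simp
  have key : ∀ (A : Type u) [Monoid A], V.Mem A → ∀ a : A, a * a = a := by
    intro A _ hA a
    have L : Laws A ⊤ 2 := laws_of_le_varDN hV (by simp) (by omega) (by omega) hA
    have := hw A hA fun _ => a
    rw [ev_eq_pow _ hall, pow_eq_sq (L.sq _) hlen] at this
    simpa using this.symm
  refine le_varSL_iff.2 ⟨fun A _ hA φ => by simpa using key A hA (φ 0), fun A _ hA φ => ?_⟩
  have L : Laws A ⊤ 2 := laws_of_le_varDN hV (by simp) (by omega) (by omega) hA
  have := L.central (φ 0) (φ 1)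
  rw [key A hA] at this
  simpa using this

theorem le_varC2_of_not_isoterm {V : MonoidVariety.{u}} (hV : V ≤ varDN) (h0 : Isoterm V [0])
    (h : ¬ Isoterm V [0, 1]) : V ≤ varC2 := by
  simp only [Isoterm, not_forall] at h
  obtain ⟨w, hw, hne⟩ := h
  have hp : w.Perm [0, 1] := by
    refine List.perm_iff_count.2 fun l => ?_
    by_cases hl : l ∈ [0, 1]
    · have h1 : [0, 1].count l = 1 := List.count_eq_one_of_mem (by decide) hl
      rw [h1, hw.count_eq_one h0 h1]
    · rw [List.count_eq_zero.2 hl, List.count_eq_zero.2 fun h => hl (hw.mem_of_mem h0 h)]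
  have hw' : w = [1, 0] := by
    have hmem : ∀ l ∈ w, l = 0 ∨ l = 1 := fun l hl => by simpa using hp.mem_iff.1 hl
    match w, hp.length_eq with
    | [a, b], _ =>
      rcases hmem a (by simp) with rfl | rfl <;> rcases hmem b (by simp) with rfl | rfl
      · exact absurd hp (by decide)
      · exact absurd rfl hne
      · rfl
      · exact absurd hp (by decide)
  refine le_varC2_iff.2 ⟨fun A _ hA φ => ?_, hw' ▸ hw⟩
  have L : Laws A ⊤ 2 := laws_of_le_varDN hV (by simp) (by omega) (by omega) hA
  simpa [mul_assoc] using (L.sq (φ 0)).symm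

/-- With δ_1 available, `Agree` for k = 1 suffices. The order condition is vacuous, as no letter
occurring twice is 1-limited. -/
theorem le_varD_one {V : MonoidVariety.{u}} (hV : V ≤ varDN)
    (h : Entails V (interleave (lettersTo 1)) (0 :: 0 :: lettersTo 1)) : V ≤ varD 1 := by
  refine le_iff_entails.2 fun u v huv => ?_
  have h01 := varD_one_le_iff.1 (le_refl (varD.{u} 1))
  have hS : SameShape 1 u v := huv.sameShape h01 fun j hj => by
    obtain rfl : j = 0 := by
      have : j < 1 := by exact_mod_cast hj
      omega
    exact h01.left
  refine Agree.entails (k := 1) (c := 2) hV le_rfl (fun n hn => ?_) (by omega) (by omega)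
    ⟨hS, fun x y hx _ hx2 _ _ => ?_⟩
  · obtain rfl : n = 1 := by exact_mod_cast hn.symm
    exact h
  · have := hx.1
    rw [hx2] at this
    have : 2 ≤ 1 := by exact_mod_cast this
    omega

/-- The classification of the subvarieties of `D_∞ ∨ N`. -/
theorem classification {V : MonoidVariety.{u}} (hV : V ≤ varDN) :
    V = varT ∨ V = varSL ∨ V = varC2 ∨ V = varD 1 ∨ ∃ k : ℕ∞, 2 ≤ k ∧ varD k ≤ V ∧
      ∀ n : ℕ, k = n → Entails V (interleave (lettersTo n)) (0 :: 0 :: lettersTo n) := by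
  by_cases hT : V ≤ varT
  · refine Or.inl (le_antisymm hT (le_iff_entails.2 fun u v _ A _ hA φ => ?_))
    have h1 := le_varT_iff.1 (le_refl varT.{u})
    have : ∀ a : A, a = 1 := fun a => by simpa using h1 A hA fun _ => a
    rw [this (ev φ u), this (ev φ v)]
  by_cases h0 : Isoterm V [0]
  swap
  · exact Or.inr (Or.inl (le_antisymm (le_varSL_of_not_isoterm hV hT h0)
      (varSL_le fun u v huv l => huv.mem_of_mem_of_not_le_varT hV hT)))
  by_cases h01 : Isoterm V [0, 1]
  swap
  · exact Or.inr (Or.inr (Or.inl (le_antisymm (le_varC2_of_not_isoterm hV h0 h01) (varC2_le h0))))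
  by_cases hd : Entails V (interleave (lettersTo 1)) (0 :: 0 :: lettersTo 1)
  · exact Or.inr (Or.inr (Or.inr (Or.inl (le_antisymm (le_varD_one hV hd)
      (varD_one_le_iff.2 h01)))))
  have h2 := (varD_succ_le_iff le_rfl).1 (varD_two_le hV h01 hd)
  refine Or.inr (Or.inr (Or.inr (Or.inr ?_)))
  -- The index k is the least m for which xt₁x⋯t_mx is not an isoterm, and ⊤ if there is none.
  by_cases hall : ∀ m, Isoterm V (interleave (lettersTo m))
  · refine ⟨⊤, le_top, ?_, fun n hn => absurd hn (ENat.top_ne_natCast n)⟩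
    refine le_iff_entails.2 fun u v huv => entails_varD_top.2 fun k hk => ?_
    exact le_iff_entails.1 ((varD_mono (by exact_mod_cast hk) (by exact_mod_cast Nat.le_succ k)).trans
      ((varD_succ_le_iff hk).2 (hall k))) _ _ huv
  · push Not at hall
    classical
    have hm := Nat.find_spec hall
    have hlt : ∀ j < Nat.find hall, Isoterm V (interleave (lettersTo j)) := fun j hj =>
      not_not.1 (Nat.find_min hall hj)
    set m := Nat.find hall
    have hm2 : 2 ≤ m := by
      by_contra hlt'
      exact hm (isoterm_interleave_of_le (by omega) h2)
    refine ⟨m, by exact_mod_cast hm2, ?_, fun n hn => ?_⟩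
    · have := (varD_succ_le_iff (k := m - 1) (by omega)).2 (hlt (m - 1) (by omega))
      rwa [Nat.sub_add_cancel (by omega)] at this
    · obtain rfl : m = n := by exact_mod_cast hn
      exact entails_delta_of_not_isoterm hV (by omega) h01 hlt hm

/-! ### Strict inclusions at the bottom of the lattice -/

theorem varT_le (V : MonoidVariety.{u}) : varT ≤ V := by
  refine le_iff_entails.2 fun u v _ A _ hA φ => ?_
  have h1 := le_varT_iff.1 (le_refl varT.{u})
  have : ∀ a : A, a = 1 := fun a => by simpa using h1 A hA fun _ => a
  rw [this (ev φ u), this (ev φ v)]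

theorem varT_lt_varSL : varT.{u} < varSL := by
  refine lt_of_le_of_ne (varT_le _) fun h => ?_
  -- The multiplicative monoid of `ZMod 2` is the two-element semilattice.
  have hle : (.generatedBy (ZMod 2) : MonoidVariety.{u}) ≤ varSL := by
    refine le_varSL_iff.2 ⟨entails_generatedBy.2 fun φ => ?_, entails_generatedBy.2 fun φ => ?_⟩
    · simp only [ev_cons, ev_nil, mul_one]
      generalize φ 0 = a
      revert a; decide
    · simp [mul_comm]
  have := entails_generatedBy.1 (le_varT_iff.1 (h ▸ hle)) fun _ => 0
  simp at this

theorem isoterm_varC2 : Isoterm varC2.{u} [0] := by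
  refine (isoterm_S [0]).mono (le_varC2_iff.2 ⟨entails_S.2 fun ψ p q => ?_,
    entails_S.2 fun ψ p q => ?_⟩)
  · by_cases h : ψ 0 = []
    · simp [h]
    · have := List.length_pos_iff.2 h
      refine iff_of_false (fun h => ?_) (fun h => ?_) <;>
      · have := congrArg List.length h
        simp at this
        omega
  · by_cases h : ψ 0 = []
    · simp [h]
    by_cases h1 : ψ 1 = []
    · simp [h1]
    have := List.length_pos_iff.2 h
    have := List.length_pos_iff.2 h1
    refine iff_of_false (fun h => ?_) (fun h => ?_) <;>
    · have := congrArg List.length h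
      simp at this
      omega

theorem varSL_lt_varC2 : varSL.{u} < varC2 := by
  obtain ⟨h1, h2⟩ := le_varSL_iff.1 (le_refl varSL.{u})
  refine lt_of_le_of_ne (le_varC2_iff.2 ⟨(h1.append (.refl _ [0])).symm, h2⟩) fun h => ?_
  have := isoterm_varC2 _ (h ▸ h1).symm
  simp at this

theorem varC2_lt_varD_one : varC2.{u} < varD 1 := by
  have h01 := varD_one_le_iff.1 (le_refl (varD.{u} 1))
  refine lt_of_le_of_ne (varC2_le h01.left) fun h => ?_
  have := h01 _ (h ▸ (le_varC2_iff.1 (le_refl varC2.{u})).2)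
  simp at this

theorem varD_one_lt_varD_two : varD.{u} 1 < varD 2 := by
  refine lt_of_le_of_ne (varD_mono le_rfl (by norm_num)) fun h => ?_
  have h1 := entails_varD_delta.{u} (n := 1) le_rfl
  exact not_entails_delta ((varD_succ_le_iff le_rfl).1 (le_refl (varD.{u} 2))) le_rfl (h ▸ h1)

/-! ### The intervals cut out by δ_k -/

theorem le_ofIdentities_delta_iff {V : MonoidVariety.{u}} {k : ℕ∞} :
    V ≤ .ofIdentities {delta k} ↔
      ∀ n : ℕ, k = n → Entails V (interleave (lettersTo n)) (0 :: 0 :: lettersTo n) := by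
  rw [le_ofIdentities_iff]
  simp only [Set.mem_singleton_iff, forall_eq]
  constructor
  · rintro h n rfl
    rw [← delta_fst_toList, ← delta_snd_toList]
    exact h
  · intro h
    cases k with
    | top => exact .refl _ _
    | coe n =>
      rw [delta_fst_toList, delta_snd_toList]
      exact h n rfl

theorem mem_Icc_iff {V : MonoidVariety.{u}} {k : ℕ∞} :
    V ∈ Set.Icc (varD k) (varDN ⊓ .ofIdentities {delta k}) ↔ varD k ≤ V ∧ V ≤ varDN ∧
      ∀ n : ℕ, k = n → Entails V (interleave (lettersTo n)) (0 :: 0 :: lettersTo n) := by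
  rw [Set.mem_Icc, le_inf_iff, le_ofIdentities_delta_iff]

theorem Icc_eq {k : ℕ∞} (hk : 2 ≤ k) :
    Set.Icc (varD.{u} k) (varDN ⊓ .ofIdentities {delta k}) =
      {varD k, varD k ⊔ varM, varD k ⊔ varN} := by
  have hP : ∀ c, varD k ⊔ varU c ∈ Set.Icc (varD.{u} k) (varDN ⊓ .ofIdentities {delta k}) :=
    fun c => mem_Icc_iff.2 ⟨(hasType_sup hk c).varD_le, (hasType_sup hk c).le_varDN,
      (hasType_sup hk c).delta⟩
  ext V
  constructor
  · intro h
    obtain ⟨h1, h2, h3⟩ := mem_Icc_iff.1 h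
    obtain ⟨c, hc, rfl⟩ := exists_eq_sup hk h2 h1 h3
    interval_cases c
    · exact Or.inl (varD_sup_zero hk)
    · exact Or.inr (Or.inl rfl)
    · exact Or.inr (Or.inr rfl)
  · rintro (rfl | rfl | rfl)
    · have := hP 0
      rwa [varD_sup_zero hk] at this
    · exact hP 1
    · exact hP 2


/-! ### Permutability -/

/-- Two words whose projections to the common letters coincide have a common amalgam. -/
theorem exists_amalgam (P Q : ℕ → Bool) : ∀ (a b : List ℕ), (∀ l ∈ a, P l) → (∀ l ∈ b, Q l) →
    a.filter Q = b.filter P → ∃ c : List ℕ, c.filter P = a ∧ c.filter Q = b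
  | [], b, _, hb, h => by
    refine ⟨b, h.symm, List.filter_eq_self.2 hb⟩
  | a, [], ha, _, h => ⟨a, List.filter_eq_self.2 ha, h⟩
  | x :: a, y :: b, ha, hb, h => by
    have hPx := ha x (by simp)
    have hQy := hb y (by simp)
    -- A leading letter that belongs to one alphabet only is written down at once; common letters
    -- are written down when they head both words.
    by_cases hx : Q x
    · by_cases hy : P y
      · rw [List.filter_cons_of_pos hx, List.filter_cons_of_pos hy, List.cons.injEq] at h
        obtain ⟨rfl, h⟩ := h
        obtain ⟨c, h1, h2⟩ := exists_amalgam P Q a b (fun l hl => ha l (List.mem_cons_of_mem _ hl))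
          (fun l hl => hb l (List.mem_cons_of_mem _ hl)) h
        exact ⟨x :: c, by rw [List.filter_cons_of_pos hPx, h1],
          by rw [List.filter_cons_of_pos hx, h2]⟩
      · rw [List.filter_cons_of_neg hy] at h
        obtain ⟨c, h1, h2⟩ := exists_amalgam P Q (x :: a) b ha
          (fun l hl => hb l (List.mem_cons_of_mem _ hl)) h
        exact ⟨y :: c, by rw [List.filter_cons_of_neg hy, h1],
          by rw [List.filter_cons_of_pos hQy, h2]⟩
    · rw [List.filter_cons_of_neg hx] at h
      obtain ⟨c, h1, h2⟩ := exists_amalgam P Q a (y :: b)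
        (fun l hl => ha l (List.mem_cons_of_mem _ hl)) hb h
      exact ⟨x :: c, by rw [List.filter_cons_of_pos hPx, h1],
        by rw [List.filter_cons_of_neg hx, h2]⟩
  termination_by a b => a.length + b.length

theorem SameShape.trans {k : ℕ∞} {u v w : List ℕ} (h : SameShape k u v) (h' : SameShape k v w) :
    SameShape k u w where
  mem_iff x := (h.mem_iff x).trans (h'.mem_iff x)
  simple_iff x := (h.simple_iff x).trans (h'.simple_iff x)
  limited_iff x := (h.limited_iff x).trans (h'.limited_iff x)
  count_eq x hx := (h.count_eq x hx).trans (h'.count_eq x ((h.limited_iff x).1 hx))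
  before_eq x t hx ht := (h.before_eq x t hx ht).trans
    (h'.before_eq x t ((h.limited_iff x).1 hx) ((h.simple_iff t).1 ht))

/-- The word b takes the k-limited letters from w and all others from u; both parts contain the
simple letters in the same order. So b has the counts and positions of u, hence its shape for every
l, while the order of k-limited letters is that of w, which suits every c. -/
theorem Agree.exists_between {k l : ℕ∞} {c d : ℕ} (hk : 2 ≤ k) {u w : List ℕ}
    (h : Agree k d u w) : ∃ b, Agree l d u b ∧ Agree k c b w := by
  classical
  have hk1 : 1 ≤ k := le_trans (by norm_num) hk
  set P : ℕ → Bool := fun x => decide (¬ Limited k x u ∨ u.count x = 1) with hP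
  set Q : ℕ → Bool := fun x => decide (Limited k x u) with hQ
  have hs1 : ∀ x, u.count x = 1 → Limited k x u := fun x hx =>
    limited_of_count_le_one hk1 hx.le
  have hPQ : ∀ x, (P x ∧ Q x) ↔ u.count x = 1 := by
    intro x
    simp only [hP, hQ, decide_eq_true_eq]
    have := hs1 x
    tauto
  have hor : ∀ x, P x ∨ Q x := by
    intro x
    simp only [hP, hQ, decide_eq_true_eq]
    tauto
  -- Both sides are projections to the simple letters of u, whose order is part of the agreement.
  have hfil : (u.filter P).filter Q = (w.filter Q).filter P := by
    obtain ⟨R, e, e', hR⟩ : ∃ R : ℕ → Bool, (∀ v : List ℕ, (v.filter P).filter Q = v.filter R) ∧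
        (∀ v : List ℕ, (v.filter Q).filter P = v.filter R) ∧ ∀ x, R x = true ↔ u.count x = 1 := by
      refine ⟨fun x => Q x && P x, fun v => by rw [List.filter_filter], fun v => ?_, fun x => ?_⟩
      · rw [List.filter_filter]
        congr 1; funext x; exact Bool.and_comm _ _
      · rw [Bool.and_eq_true, and_comm, hPQ]
    rw [e, e']
    have hnot : ∀ (v : List ℕ) (x : ℕ), u.count x ≠ 1 → x ∉ v.filter R := fun v x hx hm =>
      hx ((hR x).1 (List.mem_filter.1 hm).2)
    have hmem : ∀ (v : List ℕ) (x : ℕ), x ∈ v.filter R → u.count x = 1 := fun v x hm =>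
      (hR x).1 (List.mem_filter.1 hm).2
    refine eq_of_count_eq 0 (fun x => ?_) (fun t ht _ => ?_) (fun t ht _ y => ?_)
    · by_cases hx : u.count x = 1
      · rw [List.count_filter ((hR x).2 hx), List.count_filter ((hR x).2 hx),
          h.count_eq x (hs1 x hx)]
      · rw [List.count_eq_zero.2 (hnot u x hx), List.count_eq_zero.2 (hnot w x hx)]
    · have := hmem u t ht
      rw [List.count_filter ((hR t).2 this), this]
    · have ht1 := hmem u t ht
      by_cases hy : u.count y = 1
      · rw [countBefore_filter _ ((hR y).2 hy) ((hR t).2 ht1),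
          countBefore_filter _ ((hR y).2 hy) ((hR t).2 ht1), h.before_eq y t (hs1 y hy) ht1]
      · rw [countBefore_eq_zero_of_notMem t (hnot u y hy),
          countBefore_eq_zero_of_notMem t (hnot w y hy)]
  obtain ⟨b, hbP, hbQ⟩ := exists_amalgam P Q (u.filter P) (w.filter Q)
    (fun l hl => (List.mem_filter.1 hl).2) (fun l hl => (List.mem_filter.1 hl).2) hfil
  have hlimQ : ∀ {x}, Q x ↔ Limited k x u := by simp [hQ]
  have hcount : ∀ x, u.count x = b.count x := by
    intro x
    rcases hor x with hx | hx
    · rw [← List.count_filter hx, ← hbP, List.count_filter hx]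
    · rw [h.count_eq x (hlimQ.1 hx), ← List.count_filter hx, ← hbQ, List.count_filter hx]
  have hbefQ : ∀ x y, Q x → Q y → countBefore x y b = countBefore x y w := by
    intro x y hx hy
    rw [← countBefore_filter Q hx hy b, hbQ, countBefore_filter Q hx hy]
  have hbef : ∀ x t, u.count t = 1 → countBefore x t u = countBefore x t b := by
    intro x t ht
    obtain ⟨hPt, hQt⟩ := (hPQ t).2 ht
    rcases hor x with hx | hx
    · rw [← countBefore_filter P hx hPt b, hbP, countBefore_filter P hx hPt]
    · rw [hbefQ x t hx hQt, h.before_eq x t (hlimQ.1 hx) ht]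
  have hub : ∀ k, SameShape k u b := fun k => sameShape_of_count_eq k hcount hbef
  refine ⟨b, ⟨hub l, fun x y hx hy hx2 hy2 hs => ?_⟩,
    ⟨(hub k).symm.trans h.toSameShape, fun x y hx hy _ _ _ => ?_⟩⟩
  -- A limited letter occurring twice is k-limited because k ≥ 2, so its order relations in b are
  -- those of w.
  · have hxk := hx.mono (l := k) (by rw [hx2]; exact hk)
    have hyk := hy.mono (l := k) (by rw [hy2]; exact hk)
    rw [hbefQ x y (hlimQ.2 hxk) (hlimQ.2 hyk)]
    exact h.order_iff x y hxk hyk hx2 hy2 hs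
  · rw [hbefQ x y (hlimQ.2 (((hub k).limited_iff x).2 hx)) (hlimQ.2 (((hub k).limited_iff y).2 hy))]

/-- Any subvariety of `D_∞ ∨ N` is either below `D_2` or one of the `D_k ∨ U`. -/
theorem comparable_or_hasType {V : MonoidVariety.{u}} (hV : V ≤ varDN) :
    ((V = varT ∨ V = varSL ∨ V = varC2 ∨ V = varD 1)) ∨ ∃ k c, HasType V k c := by
  rcases classification hV with h | h | h | h | ⟨k, hk, h1, h2⟩
  · exact Or.inl (Or.inl h)
  · exact Or.inl (Or.inr (Or.inl h))
  · exact Or.inl (Or.inr (Or.inr (Or.inl h)))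
  · exact Or.inl (Or.inr (Or.inr (Or.inr h)))
  · obtain ⟨c, _, rfl⟩ := exists_eq_sup hk hV h1 h2
    exact Or.inr ⟨k, c, hasType_sup hk c⟩

theorem HasType.eq_sup {V : MonoidVariety.{u}} {k : ℕ∞} {c : ℕ} (h : HasType V k c) :
    V = varD k ⊔ varU c := h.eq (hasType_sup h.two_le c)

theorem HasType.le_of_le {V W : MonoidVariety.{u}} {k l : ℕ∞} {c d : ℕ} (h : HasType V k c)
    (h' : HasType W l d) (hkl : k ≤ l) (hcd : c ≤ d) : V ≤ W := by
  rw [h.eq_sup, h'.eq_sup]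
  exact sup_le_sup (varD_mono (le_trans (by norm_num) h.two_le) hkl) (varU_mono hcd)

/-- The four small varieties form a chain below all varieties that have a type. -/
theorem le_or_le_or_hasType {V W : MonoidVariety.{u}} (hV : V ≤ varDN) (hW : W ≤ varDN) :
    V ≤ W ∨ W ≤ V ∨ ∃ k c l d, HasType V k c ∧ HasType W l d := by
  have small : ∀ {V : MonoidVariety.{u}},
      (V = varT ∨ V = varSL ∨ V = varC2 ∨ V = varD 1) → V ≤ varD 1 := by
    rintro V (rfl | rfl | rfl | rfl)
    · exact varT_le _
    · exact varSL_lt_varC2.le.trans varC2_lt_varD_one.le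
    · exact varC2_lt_varD_one.le
    · exact le_rfl
  have big : ∀ {V : MonoidVariety.{u}} {k c}, HasType V k c → varD 1 ≤ V := fun h =>
    (varD_mono le_rfl (le_trans (by norm_num) h.two_le)).trans h.varD_le
  rcases comparable_or_hasType hV with h | ⟨k, c, h⟩
  · rcases comparable_or_hasType hW with h' | ⟨l, d, h'⟩
    · have h1 := varT_lt_varSL.{u}.le
      have h2 := varSL_lt_varC2.{u}.le
      have h3 := varC2_lt_varD_one.{u}.le
      have h12 := h1.trans h2
      have h23 := h2.trans h3
      have h13 := h12.trans h3
      rcases h with rfl | rfl | rfl | rfl <;> rcases h' with rfl | rfl | rfl | rfl <;>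
        simp [*]
    · exact Or.inl ((small h).trans (big h'))
  · rcases comparable_or_hasType hW with h' | ⟨l, d, h'⟩
    · exact Or.inr (Or.inl ((small h').trans (big h)))
    · exact Or.inr (Or.inr ⟨k, c, l, d, h, h'⟩)

theorem exists_entails_between {V W : MonoidVariety.{u}} (hV : V ≤ varDN) (hW : W ≤ varDN)
    {u v w : List ℕ} (h : Entails V u v) (h' : Entails W v w) :
    ∃ b, Entails W u b ∧ Entails V b w := by
  rcases le_or_le_or_hasType hV hW with hle | hle | ⟨k, c, l, d, hVt, hWt⟩
  · exact ⟨u, .refl _ _, h.trans (le_iff_entails.1 hle _ _ h')⟩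
  · exact ⟨w, (le_iff_entails.1 hle _ _ h).trans h', .refl _ _⟩
  · rcases le_total k l with hkl | hkl
    · rcases le_total c d with hcd | hcd
      · exact ⟨u, .refl _ _, h.trans (le_iff_entails.1 (hVt.le_of_le hWt hkl hcd) _ _ h')⟩
      -- With k ≤ l and d ≤ c, the variety D_k ∨ U_d lies below both V and W, so it satisfies u ≈ w.
      · have hI := hasType_sup.{u} hVt.two_le d
        have huw : Entails (varD.{u} k ⊔ varU d) u w :=
          (le_iff_entails.1 (hI.le_of_le hVt le_rfl hcd) _ _ h).trans
            (le_iff_entails.1 (hI.le_of_le hWt hkl le_rfl) _ _ h')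
        obtain ⟨b, h1, h2⟩ := (hI.entails_iff.1 huw).exists_between (l := l) (c := c) hVt.two_le
        exact ⟨b, hWt.entails_iff.2 h1, hVt.entails_iff.2 h2⟩
    · rcases le_total d c with hcd | hcd
      · exact ⟨w, (le_iff_entails.1 (hWt.le_of_le hVt hkl hcd) _ _ h).trans h', .refl _ _⟩
      · have hI := hasType_sup.{u} hWt.two_le c
        have huw : Entails (varD.{u} l ⊔ varU c) u w :=
          (le_iff_entails.1 (hI.le_of_le hVt hkl le_rfl) _ _ h).trans
            (le_iff_entails.1 (hI.le_of_le hWt le_rfl hcd) _ _ h')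
        -- The roles of V and W are exchanged, so the identity is read from w to u.
        obtain ⟨b, h1, h2⟩ := (hI.entails_iff.1 huw.symm).exists_between (l := k) (c := d)
          hWt.two_le
        exact ⟨b, (hWt.entails_iff.2 h2).symm, (hVt.entails_iff.2 h1).symm⟩

/-! #### Fully invariant congruences and varieties -/

section fullyInvariant
variable {V : MonoidVariety.{u}} {X : Type u} (α : Con (V.FreeObj X))

theorem entails_generatedBy_iff {A : Type u} [Monoid A] {u v : List ℕ} :
    Entails (.generatedBy A : MonoidVariety.{u}) u v ↔ ∀ φ : ℕ → A, ev φ u = ev φ v := by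
  constructor
  · intro h
    exact h A fun e he => he
  · intro h M _ hM
    exact (holds_iff (FreeMonoid.ofList u, FreeMonoid.ofList v)).1 (hM _ ((holds_iff _).2 h))

theorem generatedBy_quotient_le : .generatedBy α.Quotient ≤ V := by
  refine le_iff_entails.2 fun u v h => entails_generatedBy_iff.2 fun φ => ?_
  choose f hf using fun n => Con.mk'_surjective (c := α) (φ n)
  obtain rfl : (fun n => α.mk' (f n)) = φ := funext hf
  rw [← map_ev, ← map_ev, h _ (V.mem_freeObj X) f]

/-- Evaluation of a word over `ℕ` in the free monoid over `X`. -/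
theorem mk_ev (f : ℕ → FreeMonoid X) (w : List ℕ) :
    α.mk' ((V.freeCon X).mk' (ev f w)) = ev (fun n => α.mk' ((V.freeCon X).mk' (f n))) w := by
  rw [map_ev, map_ev]

theorem rel_iff_mk_eq {a b : V.FreeObj X} : α a b ↔ α.mk' a = α.mk' b := (Con.eq α).symm

theorem rel_of_entails {u v : List ℕ} (h : Entails (.generatedBy α.Quotient : MonoidVariety.{u}) u v)
    (f : ℕ → FreeMonoid X) :
    α ((V.freeCon X).mk' (ev f u)) ((V.freeCon X).mk' (ev f v)) := by
  rw [rel_iff_mk_eq, mk_ev, mk_ev]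
  exact entails_generatedBy_iff.1 h _

/-- An assignment of elements of the quotient to letters lifts to an endomorphism of the free
monoid, to which full invariance applies. The encoding ι need not be injective. -/
theorem entails_of_rel (hα : IsFullyInvariant α)
    (ι : X → ℕ) {a b : FreeMonoid X} (h : α ((V.freeCon X).mk' a) ((V.freeCon X).mk' b)) :
    Entails (.generatedBy α.Quotient : MonoidVariety.{u}) (a.toList.map ι) (b.toList.map ι) := by
  refine entails_generatedBy_iff.2 fun φ => ?_
  choose f hf using fun n => Con.mk'_surjective (c := α) (φ n)
  obtain ⟨g, hg, -⟩ := V.existsUnique_freeObj_hom X (V.FreeObj X) (V.mem_freeObj X)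
    fun x => f (ι x)
  have key : ∀ a : FreeMonoid X, α.mk' (g ((V.freeCon X).mk' a)) = ev φ (a.toList.map ι) := by
    intro a
    induction a using FreeMonoid.inductionOn' with
    | one => simp
    | of_mul x a ih => rw [map_mul, map_mul, map_mul, hg, ih, hf]; simp
  rw [← key, ← key]
  exact (rel_iff_mk_eq α).1 (hα g _ _ h)

end fullyInvariant

theorem comp_subset_comp {X : Type u} {α β : Con (varDN.{u}.FreeObj X)} (hα : IsFullyInvariant α)
    (hβ : IsFullyInvariant β) {a c : varDN.{u}.FreeObj X} (h : ∃ b, α a b ∧ β b c) :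
    ∃ b, β a b ∧ α b c := by
  classical
  obtain ⟨b, hab, hbc⟩ := h
  obtain ⟨a, rfl⟩ := Con.mk'_surjective a
  obtain ⟨b, rfl⟩ := Con.mk'_surjective b
  obtain ⟨c, rfl⟩ := Con.mk'_surjective c
  -- Letters are encoded by positions in `ls`. Letters of b outside `ls` all get the same index,
  -- which is harmless because only a and c are decoded; f sends indices out of range to 1.
  set ls := a.toList ++ c.toList with hls
  set f : ℕ → FreeMonoid X := fun n => (ls[n]?).elim 1 FreeMonoid.of with hf
  have hev : ∀ w : FreeMonoid X, (∀ l ∈ w.toList, l ∈ ls) →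
      ev f (w.toList.map ls.idxOf) = w := by
    intro w
    induction w using FreeMonoid.inductionOn' with
    | one => simp
    | of_mul x w ih =>
      intro h
      have hx : x ∈ ls := h x (by simp)
      have := ih fun l hl => h l (by simp [hl])
      rw [FreeMonoid.toList_of_mul, List.map_cons, ev_cons, this]
      simp [hf, List.getElem?_eq_getElem (List.idxOf_lt_length_of_mem hx)]
  obtain ⟨m, h1, h2⟩ := exists_entails_between (generatedBy_quotient_le α)
    (generatedBy_quotient_le β) (entails_of_rel α hα ls.idxOf hab) (entails_of_rel β hβ ls.idxOf hbc)
  have h1 := rel_of_entails β h1 f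
  have h2 := rel_of_entails α h2 f
  rw [hev a fun l hl => by simp [hls, hl]] at h1
  rw [hev c fun l hl => by simp [hls, hl]] at h2
  exact ⟨_, h1, h2⟩

theorem isFiPermutable_varDN : IsFiPermutable varDN.{u} := by
  intro X α β hα hβ
  funext a c
  exact propext ⟨comp_subset_comp hα hβ, comp_subset_comp hβ hα⟩

theorem mem_varU_iff {V : MonoidVariety.{u}} :
    V ∈ ({varD 2, varM, varN} : Set MonoidVariety.{u}) ↔ ∃ c ≤ 2, V = varU c := by
  constructor
  · rintro (rfl | rfl | rfl)
    · exact ⟨0, by omega, rfl⟩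
    · exact ⟨1, by omega, rfl⟩
    · exact ⟨2, by omega, rfl⟩
  · rintro ⟨c, hc, rfl⟩
    interval_cases c
    · exact Or.inl rfl
    · exact Or.inr (Or.inl rfl)
    · exact Or.inr (Or.inr rfl)

theorem sup_lt_sup {k : ℕ∞} (hk : 2 ≤ k) {c d : ℕ} (hcd : c < d) (hd : d ≤ 2) :
    varD.{u} k ⊔ varU c < varD k ⊔ varU d := by
  refine lt_of_le_not_ge (sup_le_sup_left (varU_mono hcd.le) _) fun h => ?_
  have := ((sup_le_sup_iff hk hk hd).1 h).2
  omega

theorem varU_lt_varU {c d : ℕ} (hcd : c < d) (hd : d ≤ 2) : varU.{u} c < varU d :=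
  lt_of_le_not_ge (varU_mono hcd.le) fun h => absurd ((varU_le_iff hd).1 h) (not_le.2 hcd)

end MonVar

/-! ### Assembly of the proposition -/

theorem mainTheorem8 :
    -- the variety is fi-permutable
    MonVar.IsFiPermutable MonVar.varDN.{u} ∧
    -- each interval `[D_k, (D_∞ ∨ N){δ_k}]` with `2 ≤ k ≤ ∞` is a three-element chain
    (∀ k : ℕ∞, 2 ≤ k →
      Set.Icc (MonVar.varD.{u} k)
          (MonVar.varDN ⊓ MonVar.MonoidVariety.ofIdentities {MonVar.delta k}) =
        {MonVar.varD k, MonVar.varD k ⊔ MonVar.varM, MonVar.varD k ⊔ MonVar.varN} ∧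
      MonVar.varD.{u} k < MonVar.varD k ⊔ MonVar.varM ∧
      MonVar.varD.{u} k ⊔ MonVar.varM < MonVar.varD k ⊔ MonVar.varN) ∧
    -- every subvariety is `T`, `SL`, `C_2`, `D_1` or lies in one of these intervals
    (∀ V : MonVar.MonoidVariety.{u}, V ≤ MonVar.varDN ↔
      V = MonVar.varT ∨ V = MonVar.varSL ∨ V = MonVar.varC2 ∨ V = MonVar.varD 1 ∨
        ∃ k : ℕ∞, 2 ≤ k ∧
          V ∈ Set.Icc (MonVar.varD k)
            (MonVar.varDN ⊓ MonVar.MonoidVariety.ofIdentities {MonVar.delta k})) ∧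
    -- the inclusions between the subvarieties
    (MonVar.varT.{u} < MonVar.varSL ∧ MonVar.varSL.{u} < MonVar.varC2 ∧
      MonVar.varC2.{u} < MonVar.varD 1 ∧ MonVar.varD.{u} 1 < MonVar.varD 2) ∧
    (MonVar.varD.{u} 2 < MonVar.varM ∧ MonVar.varM.{u} < MonVar.varN) ∧
    (∀ k l : ℕ∞, 2 ≤ k → 2 ≤ l →
      ∀ U ∈ ({MonVar.varD 2, MonVar.varM, MonVar.varN} : Set MonVar.MonoidVariety.{u}),
      ∀ W ∈ ({MonVar.varD 2, MonVar.varM, MonVar.varN} : Set MonVar.MonoidVariety.{u}),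
        (MonVar.varD k ⊔ U ≤ MonVar.varD l ⊔ W ↔ k ≤ l ∧ U ≤ W)) := by
  open MonVar in
  refine ⟨isFiPermutable_varDN, fun k hk => ⟨Icc_eq hk, ?_, ?_⟩, fun V => ⟨fun hV => ?_, ?_⟩,
    ⟨varT_lt_varSL, varSL_lt_varC2, varC2_lt_varD_one, varD_one_lt_varD_two⟩,
    ⟨varU_lt_varU (c := 0) (d := 1) (by omega) (by omega),
      varU_lt_varU (c := 1) (d := 2) (by omega) le_rfl⟩, fun k l hk hl U hU W hW => ?_⟩
  · have := sup_lt_sup hk (c := 0) (d := 1) (by omega) (by omega)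
    rwa [varD_sup_zero hk] at this
  · exact sup_lt_sup hk (c := 1) (d := 2) (by omega) le_rfl
  · rcases classification hV with h | h | h | h | ⟨k, hk, h1, h2⟩
    · exact Or.inl h
    · exact Or.inr (Or.inl h)
    · exact Or.inr (Or.inr (Or.inl h))
    · exact Or.inr (Or.inr (Or.inr (Or.inl h)))
    · exact Or.inr (Or.inr (Or.inr (Or.inr ⟨k, hk, mem_Icc_iff.2 ⟨h1, hV, h2⟩⟩)))
  · have h1 := varD_le_varDN (k := 1) le_rfl
    rintro (rfl | rfl | rfl | rfl | ⟨k, -, h⟩)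
    · exact varT_le _
    · exact (varSL_lt_varC2.le.trans varC2_lt_varD_one.le).trans h1
    · exact varC2_lt_varD_one.le.trans h1
    · exact h1
    · exact (mem_Icc_iff.1 h).2.1
  · obtain ⟨c, hc, rfl⟩ := mem_varU_iff.1 hU
    obtain ⟨d, hd, rfl⟩ := mem_varU_iff.1 hW
    rw [sup_le_sup_iff hk hl hc, varU_le_iff hc]
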